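/- **Codes.** For $0\le r\le m$ let $\mathrm{RM}(r,m)$ be the Reed-Muller code of length $n=2^m$: its codewords are the vectors of all values of the Boolean polynomials of degree at most $r$ in $m$ variables. The $k=\sum_{i=0}^r\binom mi$ information bits are the coefficients of the polynomial, and the rate is $k/n$. Splitting on the first remaining variable, each codeword is $(u,u+v)$ with $u\in \mathrm{RM}(r,m-1)$, $v\in \mathrm{RM}(r-1,m-1)$. **Channels.** In soft decision reception (AWGN$(\sigma^2)$) the symbols $0,1$ are sent as $+1,-1$, independent $\mathcal N(0,\sigma^2)$ noise is added, and a received value $y$ has likelihood $g=2y/\sigma^2$. In hard decision reception the channel is BSC$(p)$ with $p=Q(1/\sigma)$, $Q(x)=\int_x^\infty e^{-y^2/2}\,dy/\sqrt{2\pi}$, and a received symbol $a\in\{0,1\}$ has likelihood $g=(-1)^a\log\frac{1-p}{p}$. **Recursive decoding.** The input is the vector $g=(g',g'')$ of the $n$ likelihoods. If $2\le r\le m-2$, then: (1) form the spreads $h'=\tanh(g'/2)$, $h''=\tanh(g''/2)$, and decode $v$ recursively in $\mathrm{RM}(r-1,m-1)$ from the likelihoods $\log\frac{1+h'h''}{1-h'h''}$;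 (2) decode $u$ recursively in $\mathrm{RM}(r,m-1)$ from the likelihoods $g'+(-1)^{v}g''$; (3) output $(u,u+v)$ and the corresponding information bits. (All operations are symbol by symbol.) If $r=1$ or $r=m-1$, use maximum likelihood decoding: output a codeword $z$ (and its information bits) that minimizes $\sum_{j:\,z_j\ne a_j}|g_j|$, where $a_j=0$ if $g_j\ge0$ and $a_j=1$ otherwise; ties are broken by a fixed rule. **Sustainable noise.** Let $0<\alpha<1/2$. We say that decoding has output bit error probability at most $\alpha$ if, for a uniformly random information block, each single information bit is decoded incorrectly with probability at most $\alpha$. The $\alpha$-sustainable noise powers $\sigma_s^2=\sigma_s^2(m,r,\alpha)$ and $\sigma_h^2=\sigma_h^2(m,r,\alpha)$ are the suprema of all $\sigma^2>0$ for which, respectively, soft decision and hard decision recursive decoding of $\mathrm{RM}(r,m)$ has output bit error probability at most $\alpha$. The corresponding $\alpha$-sustainable transition error probabilities are $p_s=Q(1/\sigma_s)$ and $p_h=Q(1/\sigma_h)$. **Theorem 3.** Let $0<\alpha<1/2$. (i) For every fixed order $r\ge1$ the sets of noise powers that define $\sigma_s^2$ and $\sigma_h^2$ are non-empty and bounded for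 all sufficiently large $m$, and $$\sigma_s^2/\sigma_h^2\to\pi/2\qquad (m\to\infty).$$ (ii) For every $R$ with $0<R<1$ and all orders $r=r(m)$ for which the rate of $\mathrm{RM}(r(m),m)$ tends to $R$ as $m\to\infty$, the same sets are non-empty and bounded for all sufficiently large $m$, and $$p_s/p_h\to 4/\pi\qquad (m\to\infty).$$ -/

import Mathlib

open MeasureTheory ProbabilityTheory

noncomputable section

namespace RecursiveRM

/-- The `2 ^ m` positions of a binary vector of length `2 ^ m`. -/
abbrev Cube (m : ℕ) : Type := Fin m → ZMod 2

/-- An information block of the Reed-Muller code of length `2 ^ m` and order `r`: the coefficients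
`c S` of the monomials `∏ i ∈ S, x i` in a Boolean polynomial of degree at most `r`. -/
abbrev InfoBlock (m r : ℕ) : Type :=
  {c : Finset (Fin m) → ZMod 2 // ∀ S : Finset (Fin m), r < S.card → c S = 0}

/-- The vector of all values of the Boolean polynomial with coefficients `c`. -/
def encode {m : ℕ} (c : Finset (Fin m) → ZMod 2) (x : Cube m) : ZMod 2 :=
  ∑ S : Finset (Fin m), c S * ∏ i ∈ S, x i

/-- The code rate `k / n`, with `k = ∑_{i ≤ r} (m choose i)` and `n = 2 ^ m`. -/
def rate (m r : ℕ) : ℝ := (∑ i ∈ Finset.range (r + 1), (m.choose i : ℝ)) / 2 ^ m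

/-- The symbols `0` and `1` are transmitted as `+1` and `-1`. -/
def bpsk (b : ZMod 2) : ℝ := if b = 0 then 1 else -1

/-- The symbol-wise hard decision for a likelihood `g` of the symbol `0`. -/
def hardDecision (g : ℝ) : ZMod 2 := if 0 ≤ g then 0 else 1

/-- The spread `q - p` between the posterior probabilities `q` of `0` and `p` of `1`,
where `g = log (q / p)`. -/
def spread (g : ℝ) : ℝ := Real.tanh (g / 2)

/-- The likelihood `log (q / p)`, where `q = (1 + h) / 2` and `p = (1 - h) / 2`. -/
def likelihood (h : ℝ) : ℝ := Real.log ((1 + h) / (1 - h))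

/-- Total reliability of the positions in which `z` differs from the hard decisions. -/
def mlCost {m : ℕ} (g : Cube m → ℝ) (z : Cube m → ZMod 2) : ℝ :=
  ∑ x : Cube m, if z x ≠ hardDecision (g x) then |g x| else 0

/-- Maximum likelihood decoding: an information block whose codeword has the least cost
(if there are several, the choice depends only on the set of these blocks). -/
def mlDecode (m r : ℕ) (g : Cube m → ℝ) : InfoBlock m r :=
  have : Nonempty (InfoBlock m r) := ⟨⟨0, fun _ _ => rfl⟩⟩
  Classical.choose (Finite.exists_min fun w : InfoBlock m r => mlCost g (encode w.1))

/-- Information block of the codeword `(u, u + v)`, given those of `u` and `v`: the first variable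
is the one that distinguishes the two halves. -/
def plotkin {m : ℕ} (cu cv : Finset (Fin m) → ZMod 2) : Finset (Fin (m + 1)) → ZMod 2 := fun S =>
  if 0 ∈ S then cv (Finset.univ.filter fun i => i.succ ∈ S)
  else cu (Finset.univ.filter fun i => i.succ ∈ S)

/-- Recursive decoding, from the vector `g` of likelihoods to the information block. First `v` is
decoded from the products of the spreads of the two halves; then `u` is decoded from the sums of
the likelihoods of the halves, where those of the second half change sign if `v = 1`. The recursion
ends with maximum likelihood decoding at the codes of order `1` and `m - 1`. -/
def recDecode : (m r : ℕ) → (Cube m → ℝ) → Finset (Fin m) → ZMod 2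
  | 0, r, g => (mlDecode 0 r g).1
  | m + 1, r, g =>
    if 2 ≤ r ∧ r + 2 ≤ m + 1 then
      let g₁ : Cube m → ℝ := fun x => g (Fin.cons 0 x)
      let g₂ : Cube m → ℝ := fun x => g (Fin.cons 1 x)
      let cv := recDecode m (r - 1) fun x => likelihood (spread (g₁ x) * spread (g₂ x))
      let cu := recDecode m r fun x => g₁ x + bpsk (encode cv x) * g₂ x
      plotkin cu cv
    else (mlDecode (m + 1) r g).1

/-- The tail `∫_x^∞ exp (-y² / 2) dy / √(2π)` of the standard Gaussian density. -/
def Q (x : ℝ) : ℝ := ∫ y in Set.Ioi x, Real.exp (-y ^ 2 / 2) / Real.sqrt (2 * Real.pi)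

/-- Law of the output of the channel AWGN(`v`), with noise power `v = σ²`, for the input `z`. -/
def awgn {m : ℕ} (v : ℝ) (z : Cube m → ZMod 2) : Measure (Cube m → ℝ) :=
  Measure.pi fun x => gaussianReal (bpsk (z x)) v.toNNReal

/-- Transition probability of the channel BSC(`p`) from the input `z` to the output `a`. -/
def bsc {m : ℕ} (p : ℝ) (z a : Cube m → ZMod 2) : ℝ :=
  ∏ x : Cube m, if a x = z x then 1 - p else p

/-- Probability that the information bit `S` of a uniformly random information block is decoded
incorrectly by soft decision recursive decoding on AWGN(`v`). -/
def softBitError (m r : ℕ) (v : ℝ) (S : Finset (Fin m)) : ℝ :=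
  (∑ w : InfoBlock m r,
    (awgn v (encode w.1)).real {y | recDecode m r (fun x => 2 * y x / v) S ≠ w.1 S}) /
    Fintype.card (InfoBlock m r)

/-- Probability that the information bit `S` of a uniformly random information block is decoded
incorrectly by hard decision recursive decoding on BSC(`p`). -/
def hardBitError (m r : ℕ) (p : ℝ) (S : Finset (Fin m)) : ℝ :=
  (∑ w : InfoBlock m r, ∑ a : Cube m → ZMod 2,
    if recDecode m r (fun x => bpsk (a x) * Real.log ((1 - p) / p)) S ≠ w.1 S
    then bsc p (encode w.1) a else 0) /
    Fintype.card (InfoBlock m r)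

/-- Noise powers `v = σ²` for which soft decision recursive decoding has output bit error
probability at most `α`, for every information bit. -/
def softPowers (α : ℝ) (m r : ℕ) : Set ℝ :=
  {v | 0 < v ∧ ∀ S : Finset (Fin m), S.card ≤ r → softBitError m r v S ≤ α}

/-- Noise powers `v = σ²` for which hard decision recursive decoding, on BSC(`Q (1 / σ)`), has
output bit error probability at most `α`, for every information bit. -/
def hardPowers (α : ℝ) (m r : ℕ) : Set ℝ :=
  {v | 0 < v ∧ ∀ S : Finset (Fin m), S.card ≤ r → hardBitError m r (Q (1 / Real.sqrt v)) S ≤ α}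

/-- The sets of noise powers are non-empty and bounded, so that their suprema are genuine ones. -/
def SustainableAt (α : ℝ) (m r : ℕ) : Prop :=
  ((softPowers α m r).Nonempty ∧ BddAbove (softPowers α m r)) ∧
    ((hardPowers α m r).Nonempty ∧ BddAbove (hardPowers α m r))

/-- The `α`-sustainable noise power `σ_s²` of soft decision recursive decoding. -/
def softNoisePower (α : ℝ) (m r : ℕ) : ℝ := sSup (softPowers α m r)

/-- The `α`-sustainable noise power `σ_h²` of hard decision recursive decoding. -/
def hardNoisePower (α : ℝ) (m r : ℕ) : ℝ := sSup (hardPowers α m r)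

/-- The `α`-sustainable transition error probability `p_s = Q (1 / σ_s)`. -/
def softTransition (α : ℝ) (m r : ℕ) : ℝ := Q (1 / Real.sqrt (softNoisePower α m r))

/-- The `α`-sustainable transition error probability `p_h = Q (1 / σ_h)`. -/
def hardTransition (α : ℝ) (m r : ℕ) : ℝ := Q (1 / Real.sqrt (hardNoisePower α m r))

end RecursiveRM

end

noncomputable section

namespace RecursiveRM

open scoped ENNReal

/-! ### Signs, spreads and likelihoods -/

/-! Only a few numbers of the law of the likelihood of a sent 0 matter. Both channels give laws P in
which e and -e have odds exp e (`SymLaw`), and both steps of the recursion preserve this. With h the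
spread, let θ = E h² (which equals E h by symmetry), κ = E h⁴ and Z = E √(1 - h²). A product step
(`chk`) squares θ and κ exactly and sends Z to at most 2Z - Z². A sum step (`rep`) squares Z and
reduces 1/θ - 1 to at most half (`SymLaw.theta_rep_ge`).

The bottleneck is the decoding that comes first. After r - 1 products in a row it meets the code of
order one and length 2^n, n = m - r + 1, with second moment θ^(2^(r-1)). For small spreads a symbol
carries about θ/2 nats, while the block holds about n log 2 nats. Hence the critical noise is given
by 2^n θ^(2^(r-1)) ≈ 2 n log 2.

Below the critical noise, the output is right if every leaf decoding would be right given correct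
earlier decisions (`recDecode_eq_of_good`), so a union bound over decoding paths suffices. Paths
that have taken sums are far more reliable, and the erasure-channel bound `SymLaw.bad_le` together
with the invariants `ThetaBound` and `BhatBound` disposes of them. For fixed order, the leaves of
order one with few sums need the bound `SymLaw.bad_one_le`, which is sharp at capacity. For fixed
rate, constant factors in 2^n θ^(2^(r-1)) do not matter and the crude bound is enough throughout.

Above the critical noise, the constant coefficient of the first code of order one is hidden. The
output density averaged over the linear parts is close in L¹ to that of uniform noise
(`setIntegral_average_le`, a truncated second moment), for either value of the coefficient. So this
bit is wrong with probability close to 1/2 > α (`eventually_corr_le`).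

It remains to compare θ for the two receptions at noise power v. For fixed order the critical θ
tends to 0 and v to infinity; then vθ tends to 1 (soft) and 2/π (hard), with κ/θ → 0, whence the
ratio π/2. For fixed rate r is close to m/2, and the critical 1 - θ is about n log 2 / 2^(r-1),
which tends to 0. Then 1 - θ is asymptotic to πp (soft) and 4p (hard), where p = Q(1/√v), whence the
ratio 4/π. -/

lemma zmod_two_cases (a : ZMod 2) : a = 0 ∨ a = 1 := by
  revert a; decide

@[simp] lemma bpsk_zero : bpsk 0 = 1 := by simp [bpsk]

@[simp] lemma bpsk_one : bpsk 1 = -1 := by simp [bpsk]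

lemma bpsk_eq (a : ZMod 2) : bpsk a = 1 ∨ bpsk a = -1 := by
  rcases zmod_two_cases a with rfl | rfl <;> simp

lemma bpsk_add (a b : ZMod 2) : bpsk (a + b) = bpsk a * bpsk b := by
  have h : (1 : ZMod 2) + 1 = 0 := by decide
  rcases zmod_two_cases a with rfl | rfl <;> rcases zmod_two_cases b with rfl | rfl <;> simp [h]

@[simp] lemma bpsk_mul_self (a : ZMod 2) : bpsk a * bpsk a = 1 := by
  rcases zmod_two_cases a with rfl | rfl <;> simp

lemma spread_neg (e : ℝ) : spread (-e) = -spread e := by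
  simp [spread, neg_div]

lemma spread_bpsk_mul (a : ZMod 2) (e : ℝ) : spread (bpsk a * e) = bpsk a * spread e := by
  rcases zmod_two_cases a with rfl | rfl <;> simp [spread_neg]

lemma likelihood_neg (h : ℝ) : likelihood (-h) = -likelihood h := by
  rw [likelihood, likelihood, ← Real.log_inv, inv_div, sub_neg_eq_add, sub_eq_add_neg]

lemma likelihood_bpsk_mul (a : ZMod 2) (h : ℝ) :
    likelihood (bpsk a * h) = bpsk a * likelihood h := by
  rcases zmod_two_cases a with rfl | rfl <;> simp [likelihood_neg]

lemma abs_spread_lt_one (e : ℝ) : |spread e| < 1 := Real.abs_tanh_lt_one _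

lemma spread_lt_one (e : ℝ) : spread e < 1 := Real.tanh_lt_one _

lemma neg_one_lt_spread (e : ℝ) : -1 < spread e := Real.neg_one_lt_tanh _

lemma spread_eq (e : ℝ) : spread e = (1 - Real.exp (-e)) / (1 + Real.exp (-e)) := by
  have h1 : Real.exp (e / 2) * Real.exp (-e) = Real.exp (-(e / 2)) := by
    rw [← Real.exp_add]; congr 1; ring
  have h2 := Real.exp_pos (e / 2)
  have h3 := Real.exp_pos (-e)
  rw [spread, Real.tanh_eq, ← h1]
  field_simp

lemma one_sub_spread (e : ℝ) : 1 - spread e = (1 + spread e) * Real.exp (-e) := by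
  have h3 := Real.exp_pos (-e)
  rw [spread_eq]; field_simp; ring

lemma spread_likelihood {h : ℝ} (h1 : -1 < h) (h2 : h < 1) : spread (likelihood h) = h := by
  have h3 : 0 < 1 + h := by linarith
  have h4 : 0 < 1 - h := by linarith
  rw [spread_eq, likelihood, Real.exp_neg, Real.exp_log (by positivity)]
  field_simp; ring

lemma abs_mul_lt_one {a b : ℝ} (ha : |a| < 1) (hb : |b| < 1) : |a * b| < 1 := by
  rw [abs_mul]; nlinarith [abs_nonneg a, abs_nonneg b]

lemma spread_likelihood_mul (e f : ℝ) :
    spread (likelihood (spread e * spread f)) = spread e * spread f := by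
  have h := abs_lt.1 (abs_mul_lt_one (abs_spread_lt_one e) (abs_spread_lt_one f))
  exact spread_likelihood h.1 h.2

lemma spread_add (e f : ℝ) :
    spread (e + f) = (spread e + spread f) / (1 + spread e * spread f) := by
  have h1 := Real.exp_pos (-e)
  have h2 := Real.exp_pos (-f)
  have h3 : 1 + spread e * spread f ≠ 0 := by
    have h := abs_lt.1 (abs_mul_lt_one (abs_spread_lt_one e) (abs_spread_lt_one f))
    linarith
  rw [eq_div_iff h3, spread_eq, spread_eq, spread_eq, neg_add, Real.exp_add]
  field_simp; ring

/-! ### The Plotkin construction -/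

lemma sum_finset_fin_succ {M : Type*} [AddCommMonoid M] {m : ℕ}
    (f : Finset (Fin (m + 1)) → M) :
    ∑ S, f S = ∑ T : Finset (Fin m), f (T.map (Fin.succEmb m)) +
      ∑ T : Finset (Fin m), f (insert 0 (T.map (Fin.succEmb m))) := by
  have h0 : (0 : Fin (m + 1)) ∉ (Finset.univ : Finset (Fin m)).map (Fin.succEmb m) := by
    simp
  have hu : (Finset.univ : Finset (Fin (m + 1))) =
      insert 0 ((Finset.univ : Finset (Fin m)).map (Fin.succEmb m)) := by
    ext i; refine Fin.cases ?_ (fun j => ?_) i <;> simp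
  have hp : ∀ g : Finset (Fin (m + 1)) → M,
      ∑ t ∈ ((Finset.univ : Finset (Fin m)).map (Fin.succEmb m)).powerset, g t =
      ∑ T : Finset (Fin m), g (T.map (Fin.succEmb m)) := by
    intro g
    symm
    refine Finset.sum_bij (fun T _ => T.map (Fin.succEmb m)) ?_ ?_ ?_ ?_
    · intro T _
      exact Finset.mem_powerset.2 (Finset.map_subset_map.2 (Finset.subset_univ T))
    · intro T _ T' _ h
      exact Finset.map_injective _ h
    · intro S hS
      obtain ⟨T, -, rfl⟩ := Finset.subset_map_iff.1 (Finset.mem_powerset.1 hS)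
      exact ⟨T, Finset.mem_univ _, rfl⟩
    · intros; rfl
  rw [← Finset.powerset_univ, hu, Finset.sum_powerset_insert h0, hp, hp]

lemma filter_succ_mem_map {m : ℕ} (T : Finset (Fin m)) :
    (Finset.univ.filter fun i => i.succ ∈ T.map (Fin.succEmb m)) = T := by
  ext i; simp

lemma filter_succ_mem_insert {m : ℕ} (T : Finset (Fin m)) :
    (Finset.univ.filter fun i => i.succ ∈ insert 0 (T.map (Fin.succEmb m))) = T := by
  ext i; simp [Fin.succ_ne_zero]

lemma plotkin_map {m : ℕ} (cu cv : Finset (Fin m) → ZMod 2) (T : Finset (Fin m)) :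
    plotkin cu cv (T.map (Fin.succEmb m)) = cu T := by
  rw [plotkin, if_neg (by simp), filter_succ_mem_map]

lemma plotkin_insert {m : ℕ} (cu cv : Finset (Fin m) → ZMod 2) (T : Finset (Fin m)) :
    plotkin cu cv (insert 0 (T.map (Fin.succEmb m))) = cv T := by
  rw [plotkin, if_pos (by simp), filter_succ_mem_insert]

lemma encode_cons {m : ℕ} (c : Finset (Fin (m + 1)) → ZMod 2) (b : ZMod 2) (x : Cube m) :
    encode c (Fin.cons b x : Cube (m + 1)) =
      encode (fun T => c (T.map (Fin.succEmb m))) x +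
        b * encode (fun T => c (insert 0 (T.map (Fin.succEmb m)))) x := by
  unfold encode
  rw [sum_finset_fin_succ, Finset.mul_sum]
  congr 1
  · refine Finset.sum_congr rfl fun T _ => ?_
    simp
  · refine Finset.sum_congr rfl fun T _ => ?_
    rw [Finset.prod_insert (by simp)]
    simp; ring

/-- Information block of the `u`-half of a codeword `(u, u + v)`. -/
def uPart {m : ℕ} (c : Finset (Fin (m + 1)) → ZMod 2) : Finset (Fin m) → ZMod 2 :=
  fun T => c (T.map (Fin.succEmb m))

/-- Information block of the `v`-part of a codeword `(u, u + v)`. -/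
def vPart {m : ℕ} (c : Finset (Fin (m + 1)) → ZMod 2) : Finset (Fin m) → ZMod 2 :=
  fun T => c (insert 0 (T.map (Fin.succEmb m)))

lemma card_insert_map {m : ℕ} (T : Finset (Fin m)) :
    (insert 0 (T.map (Fin.succEmb m))).card = T.card + 1 := by
  rw [Finset.card_insert_of_notMem (by simp), Finset.card_map]

lemma plotkin_parts {m : ℕ} (c : Finset (Fin (m + 1)) → ZMod 2) :
    plotkin (uPart c) (vPart c) = c := by
  ext S
  unfold plotkin uPart vPart
  split_ifs with h
  · congr 1; ext i
    refine Fin.cases (by simp [h]) (fun j => by simp [Fin.succ_ne_zero]) i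
  · congr 1; ext i
    refine Fin.cases (by simp [h]) (fun j => by simp) i

lemma encode_cons_zero {m : ℕ} (c : Finset (Fin (m + 1)) → ZMod 2) (x : Cube m) :
    encode c (Fin.cons 0 x : Cube (m + 1)) = encode (uPart c) x := by
  rw [encode_cons, zero_mul, add_zero]; rfl

lemma encode_cons_one {m : ℕ} (c : Finset (Fin (m + 1)) → ZMod 2) (x : Cube m) :
    encode c (Fin.cons 1 x : Cube (m + 1)) = encode (uPart c) x + encode (vPart c) x := by
  rw [encode_cons, one_mul]; rfl

/-- The `u`-half of an information block. -/
def InfoBlock.u {m r : ℕ} (w : InfoBlock (m + 1) r) : InfoBlock m r :=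
  ⟨uPart w.1, fun S hS => w.2 _ (by simpa using hS)⟩

/-- The `v`-part of an information block. -/
def InfoBlock.v {m r : ℕ} (w : InfoBlock (m + 1) (r + 1)) : InfoBlock m r :=
  ⟨vPart w.1, fun S hS => w.2 _ (by rw [card_insert_map]; omega)⟩

/-! ### A sufficient condition for correct decoding -/

/-- The all-zero codeword is the unique most likely codeword of the Reed-Muller code of order `r`
when the likelihoods are `e`. -/
def LeafGood (m r : ℕ) (e : Cube m → ℝ) : Prop :=
  ∀ w : InfoBlock m r, w.1 ≠ 0 → 0 < ∑ x : Cube m, if encode w.1 x ≠ 0 then e x else 0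

/-- All maximum likelihood decodings in the course of recursive decoding from the likelihoods `e`
have the all-zero codeword as their unique result. -/
def Good : (m r : ℕ) → (Cube m → ℝ) → Prop
  | 0, r, e => LeafGood 0 r e
  | m + 1, r, e =>
    if 2 ≤ r ∧ r + 2 ≤ m + 1 then
      Good m (r - 1) (fun x => likelihood
        (spread (e (Fin.cons 0 x : Cube (m + 1))) * spread (e (Fin.cons 1 x : Cube (m + 1))))) ∧
      Good m r (fun x => e (Fin.cons 0 x : Cube (m + 1)) + e (Fin.cons 1 x : Cube (m + 1)))
    else LeafGood (m + 1) r e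

lemma encode_sub {m : ℕ} (c d : Finset (Fin m) → ZMod 2) (x : Cube m) :
    encode (c - d) x = encode c x - encode d x := by
  simp [encode, sub_mul, Finset.sum_sub_distrib]

/-- Exactly one of two different symbols agrees with the hard decision, and in each case the cost
changes by e with its sign. Comparing two codewords thus reduces to comparing their difference with
the zero codeword under the likelihoods e. -/
lemma cost_term (z z' : ZMod 2) (e : ℝ) :
    (if z' ≠ hardDecision (bpsk z * e) then |bpsk z * e| else 0) -
      (if z ≠ hardDecision (bpsk z * e) then |bpsk z * e| else 0) =
    if z' - z ≠ 0 then e else 0 := by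
  have h10 : (1 : ZMod 2) ≠ 0 := by decide
  have h01 : (0 : ZMod 2) ≠ 1 := by decide
  rcases zmod_two_cases z with rfl | rfl <;> rcases zmod_two_cases z' with rfl | rfl
  · simp
  · unfold hardDecision
    by_cases h : 0 ≤ e
    · simp [h]
    · simp [h, abs_of_neg (not_le.1 h)]
  · unfold hardDecision
    by_cases h : 0 ≤ -e
    · have h' : e ≤ 0 := by linarith
      simp [h', abs_of_nonpos h']
    · have h' : ¬ e ≤ 0 := by linarith
      simp [h', abs_of_pos (not_le.1 h')]
  · simp

lemma mlCost_sub {m : ℕ} (e : Cube m → ℝ) (c d : Finset (Fin m) → ZMod 2) :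
    mlCost (fun x => bpsk (encode c x) * e x) (encode d) -
      mlCost (fun x => bpsk (encode c x) * e x) (encode c) =
    ∑ x, if encode (d - c) x ≠ 0 then e x else 0 := by
  unfold mlCost
  rw [← Finset.sum_sub_distrib]
  refine Finset.sum_congr rfl fun x _ => ?_
  rw [cost_term, encode_sub]

lemma mlDecode_le (m r : ℕ) (g : Cube m → ℝ) (w : InfoBlock m r) :
    mlCost g (encode (mlDecode m r g).1) ≤ mlCost g (encode w.1) :=
  have : Nonempty (InfoBlock m r) := ⟨⟨0, fun _ _ => rfl⟩⟩
  Classical.choose_spec (Finite.exists_min fun w : InfoBlock m r => mlCost g (encode w.1)) w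

lemma mlDecode_eq_of_leafGood {m r : ℕ} {e : Cube m → ℝ} (he : LeafGood m r e)
    (w : InfoBlock m r) : mlDecode m r (fun x => bpsk (encode w.1 x) * e x) = w := by
  by_contra hne
  set w' := mlDecode m r (fun x => bpsk (encode w.1 x) * e x) with hw'
  have h1 := mlDecode_le m r (fun x => bpsk (encode w.1 x) * e x) w
  rw [← hw'] at h1
  have h2 := mlCost_sub e w.1 w'.1
  have h3 := he ⟨w'.1 - w.1, fun S hS => by simp [w.2 S hS, w'.2 S hS]⟩
    (fun h => hne (Subtype.ext (sub_eq_zero.1 h)))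
  simp only at h3
  linarith

/-- The signs of u occur in both halves and cancel in the product, so the decoder of v sees the word
v with the likelihoods that belong to the zero codeword. -/
lemma likelihood_mul_encode {m r : ℕ} (w : InfoBlock (m + 1) (r + 1)) (e : Cube (m + 1) → ℝ) :
    (fun x : Cube m => likelihood
      (spread (bpsk (encode w.1 (Fin.cons 0 x : Cube (m + 1))) *
          e (Fin.cons 0 x : Cube (m + 1))) *
        spread (bpsk (encode w.1 (Fin.cons 1 x : Cube (m + 1))) *
          e (Fin.cons 1 x : Cube (m + 1))))) =
    fun x => bpsk (encode w.v.1 x) * likelihood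
      (spread (e (Fin.cons 0 x : Cube (m + 1))) * spread (e (Fin.cons 1 x : Cube (m + 1)))) := by
  funext x
  rw [spread_bpsk_mul, spread_bpsk_mul, encode_cons_zero, encode_cons_one, bpsk_add,
    ← likelihood_bpsk_mul]
  congr 1
  have := bpsk_mul_self (encode (uPart w.1) x)
  calc _ = (bpsk (encode (uPart w.1) x) * bpsk (encode (uPart w.1) x)) *
        (bpsk (encode (vPart w.1) x) * (spread (e (Fin.cons 0 x : Cube (m + 1))) *
          spread (e (Fin.cons 1 x : Cube (m + 1))))) := by ring
    _ = _ := by rw [this, one_mul]; rfl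

/-- Transmitted signs factor out of each step, and once v is decoded correctly the sums carry the
signs of u alone. Since `Good` refers to the zero codeword only, its probability does not depend on
what is sent. -/
lemma recDecode_eq_of_good : ∀ (m r : ℕ) (e : Cube m → ℝ), Good m r e → ∀ w : InfoBlock m r,
    recDecode m r (fun x => bpsk (encode w.1 x) * e x) = w.1
  | 0, r, e, he, w => by
    rw [recDecode, mlDecode_eq_of_leafGood he]
  | m + 1, r, e, he, w => by
    rw [recDecode]
    rw [Good] at he
    split_ifs at he ⊢ with h
    · obtain ⟨r, rfl⟩ : ∃ s, r = s + 1 := ⟨r - 1, by omega⟩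
      simp only [Nat.add_sub_cancel] at he ⊢
      have h1 := recDecode_eq_of_good m r _ he.1 w.v
      rw [← likelihood_mul_encode] at h1
      have hu : (fun x : Cube m => bpsk (encode w.1 (Fin.cons 0 x : Cube (m + 1))) *
              e (Fin.cons 0 x : Cube (m + 1)) + bpsk (encode w.v.1 x) *
            (bpsk (encode w.1 (Fin.cons 1 x : Cube (m + 1))) *
              e (Fin.cons 1 x : Cube (m + 1)))) =
          fun x => bpsk (encode w.u.1 x) *
            (e (Fin.cons 0 x : Cube (m + 1)) + e (Fin.cons 1 x : Cube (m + 1))) := by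
        funext x
        rw [encode_cons_zero, encode_cons_one, bpsk_add]
        have := bpsk_mul_self (encode (vPart w.1) x)
        change _ + bpsk (encode (vPart w.1) x) * _ = bpsk (encode (uPart w.1) x) * _
        calc _ = bpsk (encode (uPart w.1) x) * e (Fin.cons 0 x : Cube (m + 1)) +
              (bpsk (encode (vPart w.1) x) * bpsk (encode (vPart w.1) x)) *
                (bpsk (encode (uPart w.1) x) * e (Fin.cons 1 x : Cube (m + 1))) := by ring
          _ = _ := by rw [this]; ring
      have h2 := recDecode_eq_of_good m (r + 1) _ he.2 w.u
      rw [← hu] at h2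
      rw [h1, h2]
      exact plotkin_parts w.1
    · rw [mlDecode_eq_of_leafGood he]

/-! ### Weights of codewords -/

/-- The point of the cube with support `S`. -/
def indicatorPoint {m : ℕ} (S : Finset (Fin m)) : Cube m := fun i => if i ∈ S then 1 else 0

lemma encode_indicatorPoint {m : ℕ} (c : Finset (Fin m) → ZMod 2) (S : Finset (Fin m)) :
    encode c (indicatorPoint S) = ∑ T ∈ S.powerset, c T := by
  unfold encode indicatorPoint
  rw [← Finset.sum_subset (Finset.subset_univ S.powerset)]
  · refine Finset.sum_congr rfl fun T hT => ?_
    rw [Finset.prod_eq_one, mul_one]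
    intro i hi
    rw [if_pos (Finset.mem_powerset.1 hT hi)]
  · intro T _ hT
    rw [Finset.mem_powerset, Finset.not_subset] at hT
    obtain ⟨i, hi, hi'⟩ := hT
    rw [Finset.prod_eq_zero hi (by rw [if_neg hi']), mul_zero]

/-- The value at the indicator of S is the sum of the coefficients of the subsets of S; Möbius
inversion by induction on S. -/
lemma eq_zero_of_encode_eq_zero {m : ℕ} {c : Finset (Fin m) → ZMod 2}
    (h : ∀ x, encode c x = 0) : c = 0 := by
  funext S
  induction S using Finset.strongInduction with
  | _ S ih =>
    have h1 := h (indicatorPoint S)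
    rw [encode_indicatorPoint, ← Finset.sum_erase_add _ _ (Finset.mem_powerset_self S),
      Finset.sum_eq_zero, zero_add] at h1
    · exact h1
    · intro T hT
      rw [Finset.mem_erase, Finset.mem_powerset] at hT
      exact ih T (Finset.ssubset_iff_subset_ne.2 ⟨hT.2, hT.1⟩)

/-- Every monomial misses some variable i, and flipping i pairs the points at which it has the same
value. Consequently nonzero codewords have even, positive weight. -/
lemma sum_encode_eq_zero {m r : ℕ} (hr : r < m) (w : InfoBlock m r) :
    ∑ x, encode w.1 x = 0 := by
  unfold encode
  rw [Finset.sum_comm]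
  refine Finset.sum_eq_zero fun S _ => ?_
  rw [← Finset.mul_sum]
  by_cases hS : r < S.card
  · rw [w.2 S hS, zero_mul]
  · have hS' : ∃ i, i ∉ S := by
      by_contra! hcon
      have : S = Finset.univ := Finset.eq_univ_iff_forall.2 hcon
      rw [this, Finset.card_univ, Fintype.card_fin] at hS
      omega
    obtain ⟨i, hi⟩ := hS'
    have h0 : ∑ x : Cube m, ∏ j ∈ S, x j = 0 := by
      refine Finset.sum_involution (fun x _ => Function.update x i (x i + 1)) ?_ ?_ ?_ ?_
      · intro x _
        have : ∏ j ∈ S, Function.update x i (x i + 1) j = ∏ j ∈ S, x j :=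
          Finset.prod_congr rfl fun j hj => by
            rw [Function.update_of_ne (ne_of_mem_of_not_mem hj hi)]
        rw [this]; exact CharTwo.add_self_eq_zero _
      · intro x _ _ h
        have := congrFun h i
        simp at this
      · intros; exact Finset.mem_univ _
      · intro x _
        simp only [Function.update_self, Function.update_idem]
        rw [add_assoc, CharTwo.add_self_eq_zero, add_zero, Function.update_eq_self]
    rw [h0, mul_zero]

lemma two_le_weight {m r : ℕ} (hr : r < m) (w : InfoBlock m r) (hw : w.1 ≠ 0) :
    2 ≤ (Finset.univ.filter fun x : Cube m => encode w.1 x ≠ 0).card := by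
  by_contra hlt
  have h := sum_encode_eq_zero hr w
  rw [← Finset.sum_filter_ne_zero] at h
  rcases Nat.lt_or_ge 0 (Finset.univ.filter fun x : Cube m => encode w.1 x ≠ 0).card with h0 | h0
  · obtain ⟨a, ha⟩ := Finset.card_eq_one.1
      (show (Finset.univ.filter fun x : Cube m => encode w.1 x ≠ 0).card = 1 by omega)
    rw [ha, Finset.sum_singleton] at h
    have : a ∈ (Finset.univ.filter fun x : Cube m => encode w.1 x ≠ 0) := by rw [ha]; simp
    simp [h] at this
  · have h1 := Finset.card_eq_zero.1 (Nat.le_zero.1 h0)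
    apply hw
    apply eq_zero_of_encode_eq_zero
    intro x
    by_contra hx
    have : x ∈ (Finset.univ.filter fun x : Cube m => encode w.1 x ≠ 0) := by simp [hx]
    rw [h1] at this
    simp at this

lemma encode_update {m : ℕ} (w : InfoBlock m 1) (x : Cube m) (i : Fin m) :
    encode w.1 (Function.update x i (x i + 1)) = encode w.1 x + w.1 {i} := by
  rw [← sub_eq_iff_eq_add']
  unfold encode
  rw [← Finset.sum_sub_distrib, Finset.sum_eq_single {i}]
  · simp; ring
  · intro S _ hS
    by_cases h1 : 1 < S.card
    · rw [w.2 S h1]; simp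
    · have : i ∉ S := by
        intro hi
        apply hS
        exact (Finset.eq_of_subset_of_card_le (Finset.singleton_subset_iff.2 hi)
          (by simp; omega)).symm
      have h2 : ∏ j ∈ S, Function.update x i (x i + 1) j = ∏ j ∈ S, x j :=
        Finset.prod_congr rfl fun j hj => by
          rw [Function.update_of_ne (ne_of_mem_of_not_mem hj this)]
      rw [h2, sub_self]
  · simp

/-- A nonconstant affine function is balanced, by flipping a variable that it contains; the constant
1 has sum -2^m. This distance property serves both the direct part and the converse. -/
lemma sum_bpsk_encode_le {m : ℕ} (w : InfoBlock m 1) (hw : w.1 ≠ 0) :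
    ∑ x, bpsk (encode w.1 x) ≤ 0 := by
  by_cases h : ∃ i, w.1 {i} ≠ 0
  · obtain ⟨i, hi⟩ := h
    have hi1 : w.1 {i} = 1 := (zmod_two_cases _).resolve_left hi
    refine (Finset.sum_involution (fun x _ => Function.update x i (x i + 1)) ?_ ?_ ?_ ?_).le
    · intro x _
      rw [encode_update, hi1, bpsk_add]; simp
    · intro x _ _ h
      have := congrFun h i
      simp at this
    · intros; exact Finset.mem_univ _
    · intro x _
      simp only [Function.update_self, Function.update_idem]
      rw [add_assoc, CharTwo.add_self_eq_zero, add_zero, Function.update_eq_self]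
  · push Not at h
    have h0 : ∀ S, S ≠ ∅ → w.1 S = 0 := by
      intro S hS
      by_cases h1 : 1 < S.card
      · exact w.2 S h1
      · obtain ⟨i, rfl⟩ := Finset.card_eq_one.1
          (show S.card = 1 by have := Finset.card_pos.2 (Finset.nonempty_iff_ne_empty.2 hS); omega)
        exact h i
    have h1 : w.1 ∅ = 1 := by
      refine (zmod_two_cases _).resolve_left fun h2 => hw (funext fun S => ?_)
      by_cases hS : S = ∅
      · rw [hS, h2]; rfl
      · exact h0 S hS
    have h2 : ∀ x, encode w.1 x = 1 := by
      intro x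
      unfold encode
      rw [Finset.sum_eq_single ∅ (fun S _ hS => by rw [h0 S hS, zero_mul]) (by simp)]
      simp [h1]
    simp [h2]

lemma card_infoBlock_one (m : ℕ) : Fintype.card (InfoBlock m 1) ≤ 2 ^ (m + 1) := by
  have hinj : Function.Injective (fun w : InfoBlock m 1 => fun o : Option (Fin m) =>
      w.1 (o.elim ∅ fun i => {i})) := by
    intro w w' h
    apply Subtype.ext
    funext S
    by_cases h1 : 1 < S.card
    · rw [w.2 S h1, w'.2 S h1]
    · rcases Nat.lt_or_ge 0 S.card with h0 | h0
      · obtain ⟨i, rfl⟩ := Finset.card_eq_one.1 (show S.card = 1 by omega)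
        exact congrFun h (some i)
      · rw [Finset.card_eq_zero.1 (Nat.le_zero.1 h0)]
        exact congrFun h none
  calc _ ≤ Fintype.card (Option (Fin m) → ZMod 2) := Fintype.card_le_of_injective _ hinj
    _ = 2 ^ (m + 1) := by simp [ZMod.card]

/-! ### Symmetric laws of likelihoods -/

lemma measurable_spread : Measurable spread := by
  have : spread = fun e => (1 - Real.exp (-e)) / (1 + Real.exp (-e)) := funext spread_eq
  rw [this]; fun_prop

lemma measurable_likelihood : Measurable likelihood := by
  unfold likelihood; fun_prop

attribute [fun_prop] measurable_spread measurable_likelihood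

/-- `P` is the law of the likelihood of a symbol `0` that is transmitted over a symmetric channel:
the likelihoods `e` and `-e` have probabilities in the ratio `exp e`. -/
structure SymLaw (P : Measure ℝ) : Prop where
  prob : IsProbabilityMeasure P
  flip : ∀ f : ℝ → ℝ≥0∞, Measurable f →
    ∫⁻ e, f (-e) * ENNReal.ofReal (1 - spread e) ∂P = ∫⁻ e, f e * ENNReal.ofReal (1 - spread e) ∂P

/-- The second moment of the spread. -/
def theta (P : Measure ℝ) : ℝ := ∫ e, spread e ^ 2 ∂P

/-- The fourth moment of the spread. -/
def kappa (P : Measure ℝ) : ℝ := ∫ e, spread e ^ 4 ∂P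

/-- The Bhattacharyya parameter. -/
def bhat (P : Measure ℝ) : ℝ := ∫ e, Real.sqrt (1 - spread e ^ 2) ∂P

/-- The law of the likelihoods from which `v` is decoded. -/
def chk (P : Measure ℝ) : Measure ℝ :=
  (P.prod P).map fun p => likelihood (spread p.1 * spread p.2)

/-- The law of the likelihoods from which `u` is decoded. -/
def rep (P : Measure ℝ) : Measure ℝ := (P.prod P).map fun p => p.1 + p.2

lemma measurable_chk : Measurable fun p : ℝ × ℝ => likelihood (spread p.1 * spread p.2) := by
  fun_prop

lemma integrable_of_abs_le {α : Type*} [MeasurableSpace α] {μ : Measure α} [IsFiniteMeasure μ]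
    {f : α → ℝ} (hf : Measurable f) (C : ℝ) (h : ∀ x, |f x| ≤ C) : Integrable f μ :=
  Integrable.of_bound hf.aestronglyMeasurable C (Filter.Eventually.of_forall h)

lemma spread_sq_lt_one (e : ℝ) : spread e ^ 2 < 1 := by
  have := abs_spread_lt_one e
  rw [← sq_abs]; nlinarith [abs_nonneg (spread e)]

section flips

variable {P : Measure ℝ}

/-- A symmetric law is a mixture of two-point laws on ±e with weights (1 ± h)/2. Bounds for
expectations therefore reduce to pointwise bounds for a binary symmetric channel. -/
lemma SymLaw.lintegral_mix (hP : SymLaw P) {f : ℝ → ℝ≥0∞} (hf : Measurable f) :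
    ∫⁻ e, f e ∂P = ∫⁻ e, f e * ENNReal.ofReal ((1 + spread e) / 2) +
      f (-e) * ENNReal.ofReal ((1 - spread e) / 2) ∂P := by
  have h2 : ∀ e, ENNReal.ofReal ((1 - spread e) / 2) =
      ENNReal.ofReal (1 - spread e) * ENNReal.ofReal (1 / 2) := by
    intro e
    rw [← ENNReal.ofReal_mul (by linarith [spread_lt_one e])]; congr 1; ring
  have h1 : ∫⁻ e, f (-e) * ENNReal.ofReal ((1 - spread e) / 2) ∂P =
      ∫⁻ e, f e * ENNReal.ofReal ((1 - spread e) / 2) ∂P := by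
    simp_rw [h2, ← mul_assoc]
    rw [lintegral_mul_const _ (by fun_prop), lintegral_mul_const _ (by fun_prop), hP.flip f hf]
  rw [lintegral_add_left (by fun_prop), h1, ← lintegral_add_left (by fun_prop)]
  refine lintegral_congr fun e => ?_
  rw [← mul_add, ← ENNReal.ofReal_add (by linarith [neg_one_lt_spread e])
    (by linarith [spread_lt_one e])]
  ring_nf; simp

lemma SymLaw.lintegral_flip_fst (hP : SymLaw P) {G : ℝ × ℝ → ℝ≥0∞} (hG : Measurable G) :
    ∫⁻ p, G (-p.1, p.2) * ENNReal.ofReal (1 - spread p.1) ∂(P.prod P) =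
      ∫⁻ p, G p * ENNReal.ofReal (1 - spread p.1) ∂(P.prod P) := by
  have := hP.prob
  rw [lintegral_prod_symm _ (by fun_prop), lintegral_prod_symm _ (by fun_prop)]
  refine lintegral_congr fun y => ?_
  exact hP.flip (fun x => G (x, y)) (by fun_prop)

lemma SymLaw.lintegral_flip_snd (hP : SymLaw P) {G : ℝ × ℝ → ℝ≥0∞} (hG : Measurable G) :
    ∫⁻ p, G (p.1, -p.2) * ENNReal.ofReal (1 - spread p.2) ∂(P.prod P) =
      ∫⁻ p, G p * ENNReal.ofReal (1 - spread p.2) ∂(P.prod P) := by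
  have := hP.prob
  rw [lintegral_prod _ (by fun_prop), lintegral_prod _ (by fun_prop)]
  refine lintegral_congr fun x => ?_
  exact hP.flip (fun y => G (x, y)) (by fun_prop)

/-- The hypothesis says that the measure with density d is invariant under s. Put this way, the
identity passes to real functions without any integrability condition. -/
lemma integral_flip_of_lintegral {α : Type*} [MeasurableSpace α] {μ : Measure α} {s : α → α}
    (hs : Measurable s) {d : α → ℝ} (hd : Measurable d) (hd0 : ∀ x, 0 ≤ d x)
    (h : ∀ G : α → ℝ≥0∞, Measurable G →
      ∫⁻ p, G (s p) * ENNReal.ofReal (d p) ∂μ = ∫⁻ p, G p * ENNReal.ofReal (d p) ∂μ)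
    {g : α → ℝ} (hg : Measurable g) : ∫ p, g (s p) * d p ∂μ = ∫ p, g p * d p ∂μ := by
  have hm : (μ.withDensity fun p => ENNReal.ofReal (d p)).map s =
      μ.withDensity fun p => ENNReal.ofReal (d p) := by
    refine Measure.ext_of_lintegral _ fun G hG => ?_
    rw [lintegral_map hG hs, lintegral_withDensity_eq_lintegral_mul _ (by fun_prop) (by fun_prop),
      lintegral_withDensity_eq_lintegral_mul _ (by fun_prop) hG]
    simpa [mul_comm] using h G hG
  have key : ∀ f : α → ℝ, ∫ p, f p * d p ∂μ =
      ∫ p, f p ∂(μ.withDensity fun p => ENNReal.ofReal (d p)) := by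
    intro f
    rw [integral_withDensity_eq_integral_toReal_smul (by fun_prop) (by simp)]
    refine integral_congr_ae (Filter.Eventually.of_forall fun p => ?_)
    simp [ENNReal.toReal_ofReal (hd0 p), mul_comm]
  rw [key, key]
  conv_rhs => rw [← hm]
  rw [integral_map hs.aemeasurable hg.aestronglyMeasurable]

lemma SymLaw.integral_flip (hP : SymLaw P) {g : ℝ → ℝ} (hg : Measurable g) :
    ∫ e, g (-e) * (1 - spread e) ∂P = ∫ e, g e * (1 - spread e) ∂P :=
  integral_flip_of_lintegral measurable_neg (by fun_prop)
    (fun e => by linarith [spread_lt_one e]) hP.flip hg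

lemma SymLaw.integral_flip_fst (hP : SymLaw P) {g : ℝ × ℝ → ℝ} (hg : Measurable g) :
    ∫ p, g (-p.1, p.2) * (1 - spread p.1) ∂(P.prod P) =
      ∫ p, g p * (1 - spread p.1) ∂(P.prod P) :=
  integral_flip_of_lintegral (s := fun p : ℝ × ℝ => (-p.1, p.2)) (by fun_prop) (by fun_prop)
    (fun p => by linarith [spread_lt_one p.1]) (fun _ hG => hP.lintegral_flip_fst hG) hg

lemma SymLaw.integral_flip_snd (hP : SymLaw P) {g : ℝ × ℝ → ℝ} (hg : Measurable g) :
    ∫ p, g (p.1, -p.2) * (1 - spread p.2) ∂(P.prod P) =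
      ∫ p, g p * (1 - spread p.2) ∂(P.prod P) :=
  integral_flip_of_lintegral (s := fun p : ℝ × ℝ => (p.1, -p.2)) (by fun_prop) (by fun_prop)
    (fun p => by linarith [spread_lt_one p.2]) (fun _ hG => hP.lintegral_flip_snd hG) hg

lemma abs_pow_spread_le (e : ℝ) (k : ℕ) : |spread e ^ k| ≤ 1 := by
  rw [abs_pow]; exact pow_le_one₀ (abs_nonneg _) (abs_spread_lt_one e).le

lemma SymLaw.integrable_pow (hP : SymLaw P) (k : ℕ) : Integrable (fun e => spread e ^ k) P := by
  have := hP.prob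
  exact integrable_of_abs_le (by fun_prop) 1 fun e => abs_pow_spread_le e k

/-- The flip turns E h^k (1 - h) into its negative when k is odd, so it vanishes. The cases needed
are E h = E h² and E h³ = E h⁴. -/
lemma SymLaw.integral_odd (hP : SymLaw P) {k : ℕ} (hk : Odd k) :
    ∫ e, spread e ^ k ∂P = ∫ e, spread e ^ (k + 1) ∂P := by
  have h := hP.integral_flip (g := fun e => spread e ^ k) (by fun_prop)
  simp only [spread_neg, hk.neg_pow] at h
  have h1 : ∫ e, spread e ^ k * (1 - spread e) ∂P =
      ∫ e, spread e ^ k ∂P - ∫ e, spread e ^ (k + 1) ∂P := by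
    rw [← integral_sub (hP.integrable_pow _) (hP.integrable_pow _)]
    refine integral_congr_ae (Filter.Eventually.of_forall fun e => ?_)
    simp only; ring
  simp only [neg_mul, integral_neg] at h
  linarith

lemma SymLaw.integral_spread (hP : SymLaw P) : ∫ e, spread e ∂P = theta P := by
  simpa [theta] using hP.integral_odd (k := 1) odd_one

lemma SymLaw.theta_nonneg (_hP : SymLaw P) : 0 ≤ theta P :=
  integral_nonneg fun _ => sq_nonneg _

lemma SymLaw.theta_le_one (hP : SymLaw P) : theta P ≤ 1 := by
  have := hP.prob
  calc theta P ≤ ∫ _, (1 : ℝ) ∂P :=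
        integral_mono (hP.integrable_pow 2) (integrable_const _) fun e => (spread_sq_lt_one e).le
    _ = 1 := by simp

lemma SymLaw.kappa_le_theta (hP : SymLaw P) : kappa P ≤ theta P :=
  integral_mono (hP.integrable_pow 4) (hP.integrable_pow 2) fun e => by
    have := spread_sq_lt_one e
    simp only
    nlinarith [sq_nonneg (spread e)]

lemma SymLaw.kappa_nonneg (_hP : SymLaw P) : 0 ≤ kappa P :=
  integral_nonneg fun _ => by positivity

lemma SymLaw.integrable_sqrt (hP : SymLaw P) :
    Integrable (fun e => Real.sqrt (1 - spread e ^ 2)) P := by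
  have := hP.prob
  refine integrable_of_abs_le (by fun_prop) 1 fun e => ?_
  rw [abs_of_nonneg (Real.sqrt_nonneg _)]
  exact Real.sqrt_le_one.2 (by linarith [sq_nonneg (spread e)])

lemma SymLaw.bhat_nonneg (_hP : SymLaw P) : 0 ≤ bhat P :=
  integral_nonneg fun _ => Real.sqrt_nonneg _

/-- Jensen's inequality for the square, since E (1 - h²) = 1 - θ. -/
lemma SymLaw.bhat_sq_le (hP : SymLaw P) : bhat P ^ 2 ≤ 1 - theta P := by
  have := hP.prob
  have i1 : Integrable (fun e => 1 - spread e ^ 2) P :=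
    (integrable_const _).sub (hP.integrable_pow 2)
  have h1 : 2 * bhat P * bhat P ≤ (1 - theta P) + bhat P ^ 2 := by
    have h2 : ∫ e, 2 * bhat P * Real.sqrt (1 - spread e ^ 2) ∂P ≤
        ∫ e, ((1 - spread e ^ 2) + bhat P ^ 2) ∂P := by
      refine integral_mono (hP.integrable_sqrt.const_mul _)
        (i1.add (integrable_const _)) fun e => ?_
      have h3 := Real.sq_sqrt (show 0 ≤ 1 - spread e ^ 2 by linarith [spread_sq_lt_one e])
      simp only
      nlinarith [sq_nonneg (Real.sqrt (1 - spread e ^ 2) - bhat P)]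
    rw [integral_const_mul,
      integral_add i1 (integrable_const _),
      integral_sub (integrable_const _) (hP.integrable_pow 2)] at h2
    simpa [bhat, theta] using h2
  nlinarith

lemma SymLaw.bhat_le_one (hP : SymLaw P) : bhat P ≤ 1 := by
  have h1 := hP.bhat_sq_le
  have h2 := hP.theta_nonneg
  nlinarith [hP.bhat_nonneg]

lemma SymLaw.bhat_le (hP : SymLaw P) : bhat P ≤ 1 - theta P / 2 := by
  have h1 := hP.bhat_sq_le
  nlinarith [hP.theta_le_one, sq_nonneg (theta P)]

lemma exp_half_mul (e : ℝ) :
    Real.exp (-e / 2) * (1 + spread e) = Real.sqrt (1 - spread e ^ 2) := by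
  have h1 : 0 < 1 + spread e := by linarith [neg_one_lt_spread e]
  symm
  rw [Real.sqrt_eq_iff_mul_self_eq (by linarith [spread_sq_lt_one e]) (by positivity)]
  symm
  have h2 : Real.exp (-e / 2) * Real.exp (-e / 2) = Real.exp (-e) := by
    rw [← Real.exp_add]; congr 1; ring
  calc Real.exp (-e / 2) * (1 + spread e) * (Real.exp (-e / 2) * (1 + spread e))
      = (Real.exp (-e / 2) * Real.exp (-e / 2)) * (1 + spread e) * (1 + spread e) := by ring
    _ = ((1 + spread e) * Real.exp (-e)) * (1 + spread e) := by rw [h2]; ring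
    _ = _ := by rw [← one_sub_spread]; ring

/-- Averaging exp (-e/2) over ±e with weights (1 ± h)/2 gives √(1 - h²). So the Bhattacharyya
parameter is an exponential moment, which makes it multiplicative under sums and the right quantity
for Chernoff bounds. -/
lemma SymLaw.lintegral_exp_half (hP : SymLaw P) :
    ∫⁻ e, ENNReal.ofReal (Real.exp (-e / 2)) ∂P = ENNReal.ofReal (bhat P) := by
  rw [hP.lintegral_mix (by fun_prop), bhat,
    ofReal_integral_eq_lintegral_ofReal hP.integrable_sqrt
      (Filter.Eventually.of_forall fun e => Real.sqrt_nonneg _)]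
  refine lintegral_congr fun e => ?_
  have h1 : 0 < 1 + spread e := by linarith [neg_one_lt_spread e]
  have h2 : 0 < 1 - spread e := by linarith [spread_lt_one e]
  rw [← ENNReal.ofReal_mul (Real.exp_nonneg _), ← ENNReal.ofReal_mul (Real.exp_nonneg _),
    ← ENNReal.ofReal_add (by positivity) (by positivity), ← exp_half_mul]
  congr 1
  have h3 : Real.exp (- -e / 2) * Real.exp (-e) = Real.exp (-e / 2) := by
    rw [← Real.exp_add]; congr 1; ring
  calc Real.exp (-e / 2) * ((1 + spread e) / 2) + Real.exp (- -e / 2) * ((1 - spread e) / 2)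
      = Real.exp (-e / 2) * ((1 + spread e) / 2) +
        (Real.exp (- -e / 2) * Real.exp (-e)) * ((1 + spread e) / 2) := by
        rw [one_sub_spread]; ring
    _ = _ := by rw [h3]; ring

lemma SymLaw.integrable_exp_half (hP : SymLaw P) :
    Integrable (fun e => Real.exp (-e / 2)) P := by
  refine ⟨by fun_prop, ?_⟩
  rw [hasFiniteIntegral_iff_ofReal (Filter.Eventually.of_forall fun e => Real.exp_nonneg _),
    hP.lintegral_exp_half]
  exact ENNReal.ofReal_lt_top

lemma SymLaw.integral_exp_half (hP : SymLaw P) : ∫ e, Real.exp (-e / 2) ∂P = bhat P := by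
  rw [integral_eq_lintegral_of_nonneg_ae (Filter.Eventually.of_forall fun e => Real.exp_nonneg _)
    (by fun_prop), hP.lintegral_exp_half, ENNReal.toReal_ofReal hP.bhat_nonneg]

/-! ### The two transformations -/

lemma one_add_mul_spread_pos (e f : ℝ) : 0 < 1 + spread e * spread f := by
  have h := abs_lt.1 (abs_mul_lt_one (abs_spread_lt_one e) (abs_spread_lt_one f))
  linarith

lemma one_sub_mul_spread_pos (e f : ℝ) : 0 < 1 - spread e * spread f := by
  have h := abs_lt.1 (abs_mul_lt_one (abs_spread_lt_one e) (abs_spread_lt_one f))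
  linarith

lemma one_sub_spread_add (e f : ℝ) : 1 - spread (e + f) =
    (1 - spread f) / (1 + spread e * spread f) * (1 - spread e) := by
  have := one_add_mul_spread_pos e f
  rw [spread_add]; field_simp; ring

lemma one_sub_spread_add' (e f : ℝ) : 1 - spread (e + f) =
    (1 - spread e) / (1 + spread e * spread f) * (1 - spread f) := by
  have := one_add_mul_spread_pos e f
  rw [spread_add]; field_simp; ring

/-- The weight splits as 1 - h₁h₂ = (1 + h₂)/2 · (1 - h₁) + (1 + h₁)/2 · (1 - h₂). In each term the
flip of a single coordinate is available, and it changes the sign of the product. -/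
lemma SymLaw.chk (hP : SymLaw P) : SymLaw (chk P) := by
  have := hP.prob
  refine ⟨Measure.isProbabilityMeasure_map measurable_chk.aemeasurable, fun f hf => ?_⟩
  unfold RecursiveRM.chk
  rw [lintegral_map (by fun_prop) measurable_chk, lintegral_map (by fun_prop) measurable_chk]
  simp only [spread_likelihood_mul]
  have hsplit : ∀ p : ℝ × ℝ, ENNReal.ofReal (1 - spread p.1 * spread p.2) =
      ENNReal.ofReal ((1 + spread p.2) / 2) * ENNReal.ofReal (1 - spread p.1) +
      ENNReal.ofReal ((1 + spread p.1) / 2) * ENNReal.ofReal (1 - spread p.2) := by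
    intro p
    have h1 := spread_lt_one p.1
    have h2 := spread_lt_one p.2
    have h3 := neg_one_lt_spread p.1
    have h4 := neg_one_lt_spread p.2
    rw [← ENNReal.ofReal_mul (by linarith), ← ENNReal.ofReal_mul (by linarith),
      ← ENNReal.ofReal_add (by nlinarith) (by nlinarith)]
    congr 1; ring
  simp only [hsplit, mul_add, ← mul_assoc]
  rw [lintegral_add_left (by fun_prop), lintegral_add_left (by fun_prop)]
  congr 1
  · rw [← hP.lintegral_flip_fst (G := fun p => f (likelihood (spread p.1 * spread p.2)) *
      ENNReal.ofReal ((1 + spread p.2) / 2)) (by fun_prop)]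
    simp [spread_neg, likelihood_neg]
  · rw [← hP.lintegral_flip_snd (G := fun p => f (likelihood (spread p.1 * spread p.2)) *
      ENNReal.ofReal ((1 + spread p.1) / 2)) (by fun_prop)]
    simp [spread_neg, likelihood_neg]

/-- The weight 1 - `spread` (e₁ + e₂) equals (1 - h₁)(1 - h₂)/(1 + h₁h₂), so it allows flips in
either coordinate. Flipping the two coordinates one after the other, through functions of e₁ - e₂,
negates the sum. -/
lemma SymLaw.rep (hP : SymLaw P) : SymLaw (rep P) := by
  have := hP.prob
  have hm : Measurable fun p : ℝ × ℝ => p.1 + p.2 := by fun_prop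
  refine ⟨Measure.isProbabilityMeasure_map hm.aemeasurable, fun f hf => ?_⟩
  unfold RecursiveRM.rep
  rw [lintegral_map (by fun_prop) hm, lintegral_map (by fun_prop) hm]
  have h1 : ∀ p : ℝ × ℝ, ENNReal.ofReal (1 - spread (p.1 + p.2)) =
      ENNReal.ofReal ((1 - spread p.2) / (1 + spread p.1 * spread p.2)) *
        ENNReal.ofReal (1 - spread p.1) := by
    intro p
    have h2 := spread_lt_one p.2
    have h3 := one_add_mul_spread_pos p.1 p.2
    rw [one_sub_spread_add, ENNReal.ofReal_mul (div_nonneg (by linarith) h3.le)]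
  have h2 : ∀ p : ℝ × ℝ, ENNReal.ofReal (1 - spread (p.1 + p.2)) =
      ENNReal.ofReal ((1 - spread p.1) / (1 + spread p.1 * spread p.2)) *
        ENNReal.ofReal (1 - spread p.2) := by
    intro p
    have h2 := spread_lt_one p.1
    have h3 := one_add_mul_spread_pos p.1 p.2
    rw [one_sub_spread_add', ENNReal.ofReal_mul (div_nonneg (by linarith) h3.le)]
  have e1 := hP.lintegral_flip_fst (G := fun p => f (p.1 - p.2) *
    ENNReal.ofReal ((1 - spread p.2) / (1 - spread p.1 * spread p.2))) (by fun_prop)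
  have e2 := hP.lintegral_flip_snd (G := fun p => f (p.1 + p.2) *
    ENNReal.ofReal ((1 - spread p.1) / (1 + spread p.1 * spread p.2))) (by fun_prop)
  simp only [spread_neg] at e1 e2
  calc _ = ∫⁻ p, f (-p.1 - p.2) *
        ENNReal.ofReal ((1 - spread p.2) / (1 - -spread p.1 * spread p.2)) *
        ENNReal.ofReal (1 - spread p.1) ∂(P.prod P) := by
        refine lintegral_congr fun p => ?_
        rw [h1, ← mul_assoc]; congr 3
        · ring
        · ring
    _ = _ := e1
    _ = ∫⁻ p, f (p.1 + -p.2) *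
        ENNReal.ofReal ((1 - spread p.1) / (1 + spread p.1 * -spread p.2)) *
        ENNReal.ofReal (1 - spread p.2) ∂(P.prod P) := by
        refine lintegral_congr fun p => ?_
        have h4 := spread_lt_one p.1
        have h5 := spread_lt_one p.2
        have h6 := one_sub_mul_spread_pos p.1 p.2
        rw [mul_assoc, mul_assoc, ← ENNReal.ofReal_mul (div_nonneg (by linarith) h6.le),
          ← ENNReal.ofReal_mul (div_nonneg (by linarith) (by rw [mul_neg]; linarith))]
        congr 2
        rw [mul_neg]; ring
    _ = _ := e2
    _ = _ := by
        refine lintegral_congr fun p => ?_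
        rw [h2, ← mul_assoc]

lemma SymLaw.integral_chk_pow (hP : SymLaw P) (k : ℕ) :
    ∫ e, spread e ^ k ∂(RecursiveRM.chk P) = (∫ e, spread e ^ k ∂P) ^ 2 := by
  have := hP.prob
  unfold RecursiveRM.chk
  rw [integral_map measurable_chk.aemeasurable (by fun_prop)]
  simp only [spread_likelihood_mul, mul_pow]
  rw [integral_prod_mul (fun e => spread e ^ k) (fun e => spread e ^ k), sq]

lemma SymLaw.theta_chk (hP : SymLaw P) : theta (RecursiveRM.chk P) = theta P ^ 2 :=
  hP.integral_chk_pow 2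

lemma SymLaw.kappa_chk (hP : SymLaw P) : kappa (RecursiveRM.chk P) = kappa P ^ 2 :=
  hP.integral_chk_pow 4

/-- With x and y the two roots, the square of the right side exceeds that of the left by 2xy(1 -
x)(1 - y). -/
lemma sqrt_one_sub_mul_le {a b : ℝ} (ha : a ^ 2 < 1) (hb : b ^ 2 < 1) :
    Real.sqrt (1 - (a * b) ^ 2) ≤ Real.sqrt (1 - a ^ 2) + Real.sqrt (1 - b ^ 2) -
      Real.sqrt (1 - a ^ 2) * Real.sqrt (1 - b ^ 2) := by
  have h1 := Real.sq_sqrt (show 0 ≤ 1 - a ^ 2 by linarith)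
  have h2 := Real.sq_sqrt (show 0 ≤ 1 - b ^ 2 by linarith)
  have h3 := Real.sqrt_nonneg (1 - a ^ 2)
  have h4 := Real.sqrt_nonneg (1 - b ^ 2)
  have h5 : Real.sqrt (1 - a ^ 2) ≤ 1 := Real.sqrt_le_one.2 (by linarith [sq_nonneg a])
  have h6 : Real.sqrt (1 - b ^ 2) ≤ 1 := Real.sqrt_le_one.2 (by linarith [sq_nonneg b])
  set x := Real.sqrt (1 - a ^ 2)
  set y := Real.sqrt (1 - b ^ 2)
  have hx : a ^ 2 = 1 - x ^ 2 := by linarith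
  have hy : b ^ 2 = 1 - y ^ 2 := by linarith
  apply Real.sqrt_le_iff.2 ⟨by nlinarith, ?_⟩
  rw [mul_pow, hx, hy]
  nlinarith [mul_nonneg (mul_nonneg h3 h4) (mul_nonneg (sub_nonneg.2 h5) (sub_nonneg.2 h6))]

lemma SymLaw.bhat_chk_le (hP : SymLaw P) :
    bhat (RecursiveRM.chk P) ≤ 2 * bhat P - bhat P ^ 2 := by
  have := hP.prob
  have hi := hP.integrable_sqrt
  unfold RecursiveRM.chk
  rw [bhat, integral_map measurable_chk.aemeasurable (by fun_prop)]
  simp only [spread_likelihood_mul]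
  have i1 : Integrable (fun p : ℝ × ℝ => Real.sqrt (1 - spread p.1 ^ 2)) (P.prod P) :=
    hi.comp_fst P
  have i2 : Integrable (fun p : ℝ × ℝ => Real.sqrt (1 - spread p.2 ^ 2)) (P.prod P) :=
    hi.comp_snd P
  have i3 : Integrable (fun p : ℝ × ℝ => Real.sqrt (1 - spread p.1 ^ 2) *
    Real.sqrt (1 - spread p.2 ^ 2)) (P.prod P) := hi.mul_prod hi
  calc _ ≤ ∫ p : ℝ × ℝ, (Real.sqrt (1 - spread p.1 ^ 2) + Real.sqrt (1 - spread p.2 ^ 2) -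
        Real.sqrt (1 - spread p.1 ^ 2) * Real.sqrt (1 - spread p.2 ^ 2)) ∂(P.prod P) := by
        refine integral_mono (integrable_of_abs_le (by fun_prop) 1 fun p => ?_)
          ((i1.add i2).sub i3) fun p =>
            sqrt_one_sub_mul_le (spread_sq_lt_one _) (spread_sq_lt_one _)
        rw [abs_of_nonneg (Real.sqrt_nonneg _)]
        exact Real.sqrt_le_one.2 (by linarith [sq_nonneg (spread p.1 * spread p.2)])
    _ = _ := by
        have e1 : ∫ p : ℝ × ℝ, Real.sqrt (1 - spread p.1 ^ 2) ∂(P.prod P) = bhat P := by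
          rw [integral_fun_fst (fun e => Real.sqrt (1 - spread e ^ 2))]; simp [bhat]
        have e2 : ∫ p : ℝ × ℝ, Real.sqrt (1 - spread p.2 ^ 2) ∂(P.prod P) = bhat P := by
          rw [integral_fun_snd (fun e => Real.sqrt (1 - spread e ^ 2))]; simp [bhat]
        have i12 : Integrable (fun p : ℝ × ℝ => Real.sqrt (1 - spread p.1 ^ 2) +
          Real.sqrt (1 - spread p.2 ^ 2)) (P.prod P) := i1.add i2
        rw [integral_sub i12 i3, integral_add i1 i2, e1, e2,
          integral_prod_mul (fun e => Real.sqrt (1 - spread e ^ 2))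
            (fun e => Real.sqrt (1 - spread e ^ 2))]
        simp only [bhat]; ring

lemma SymLaw.bhat_rep (hP : SymLaw P) : bhat (RecursiveRM.rep P) = bhat P ^ 2 := by
  have := hP.prob
  rw [← hP.rep.integral_exp_half, ← hP.integral_exp_half]
  unfold RecursiveRM.rep
  rw [integral_map (by fun_prop) (by fun_prop), sq, ← integral_prod_mul]
  refine integral_congr_ae (Filter.Eventually.of_forall fun p => ?_)
  simp only
  rw [← Real.exp_add]; congr 1; ring

/-- Cauchy-Schwarz for h₁₂ = `spread` (e₁ + e₂) against h₁ + h₂: E (h₁ + h₂)h₁₂ = 2θ and E (h₁ +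
h₂)² = 2θ + 2θ². For θ > 0 the bound says that 1/θ - 1 is at most half of what it was. -/
lemma SymLaw.theta_rep_ge (hP : SymLaw P) :
    2 * theta P / (1 + theta P) ≤ theta (RecursiveRM.rep P) := by
  have := hP.prob
  have h0 := hP.theta_nonneg
  have bd : ∀ p : ℝ × ℝ, |spread p.1 + spread p.2| ≤ 2 := fun p =>
    (abs_add_le _ _).trans (by linarith [abs_spread_lt_one p.1, abs_spread_lt_one p.2])
  have i1 : Integrable (fun p : ℝ × ℝ => spread p.1 + spread p.2) (P.prod P) :=
    integrable_of_abs_le (by fun_prop) 2 bd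
  have i2 : Integrable (fun p : ℝ × ℝ => (spread p.1 + spread p.2) * spread (p.1 + p.2))
      (P.prod P) := by
    refine integrable_of_abs_le (by fun_prop) 2 fun p => ?_
    rw [abs_mul]
    nlinarith [bd p, abs_spread_lt_one (p.1 + p.2), abs_nonneg (spread (p.1 + p.2)),
      abs_nonneg (spread p.1 + spread p.2)]
  have i3 : Integrable (fun p : ℝ × ℝ => (spread p.1 + spread p.2) ^ 2) (P.prod P) := by
    refine integrable_of_abs_le (by fun_prop) (2 ^ 2) fun p => ?_
    rw [abs_pow]; exact pow_le_pow_left₀ (abs_nonneg _) (bd p) 2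
  have i4 : Integrable (fun p : ℝ × ℝ => spread (p.1 + p.2) ^ 2) (P.prod P) :=
    integrable_of_abs_le (by fun_prop) 1 fun p => abs_pow_spread_le _ 2
  have s1 : ∫ p : ℝ × ℝ, spread p.1 ∂(P.prod P) = theta P := by
    rw [integral_fun_fst spread, hP.integral_spread]; simp
  have s2 : ∫ p : ℝ × ℝ, spread p.2 ∂(P.prod P) = theta P := by
    rw [integral_fun_snd spread, hP.integral_spread]; simp
  have j1 : Integrable (fun p : ℝ × ℝ => spread p.1) (P.prod P) :=
    integrable_of_abs_le (by fun_prop) 1 fun p => (abs_spread_lt_one _).le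
  have j2 : Integrable (fun p : ℝ × ℝ => spread p.2) (P.prod P) :=
    integrable_of_abs_le (by fun_prop) 1 fun p => (abs_spread_lt_one _).le
  have m1 : ∫ p : ℝ × ℝ, (spread p.1 + spread p.2) ∂(P.prod P) = 2 * theta P := by
    rw [integral_add j1 j2, s1, s2]; ring
  have m3 : ∫ p : ℝ × ℝ, (spread p.1 + spread p.2) ^ 2 ∂(P.prod P) =
      2 * theta P + 2 * theta P ^ 2 := by
    have k1 : Integrable (fun p : ℝ × ℝ => spread p.1 ^ 2) (P.prod P) :=
      integrable_of_abs_le (by fun_prop) 1 fun p => abs_pow_spread_le _ 2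
    have k2 : Integrable (fun p : ℝ × ℝ => spread p.2 ^ 2) (P.prod P) :=
      integrable_of_abs_le (by fun_prop) 1 fun p => abs_pow_spread_le _ 2
    have k3 : Integrable (fun p : ℝ × ℝ => spread p.1 * spread p.2) (P.prod P) :=
      integrable_of_abs_le (by fun_prop) 1 fun p =>
        (abs_mul_lt_one (abs_spread_lt_one _) (abs_spread_lt_one _)).le
    have t1 : ∫ p : ℝ × ℝ, spread p.1 ^ 2 ∂(P.prod P) = theta P := by
      rw [integral_fun_fst fun e => spread e ^ 2]; simp [theta]
    have t2 : ∫ p : ℝ × ℝ, spread p.2 ^ 2 ∂(P.prod P) = theta P := by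
      rw [integral_fun_snd fun e => spread e ^ 2]; simp [theta]
    have t3 : ∫ p : ℝ × ℝ, spread p.1 * spread p.2 ∂(P.prod P) = theta P ^ 2 := by
      rw [integral_prod_mul spread spread, hP.integral_spread, sq]
    calc _ = ∫ p : ℝ × ℝ, (spread p.1 ^ 2 + spread p.2 ^ 2 + 2 * (spread p.1 * spread p.2))
          ∂(P.prod P) := by
          refine integral_congr_ae (Filter.Eventually.of_forall fun p => ?_); simp only; ring
      _ = _ := by
          have k12 : Integrable (fun p : ℝ × ℝ => spread p.1 ^ 2 + spread p.2 ^ 2) (P.prod P) :=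
            k1.add k2
          rw [integral_add k12 (k3.const_mul 2), integral_add k1 k2, integral_const_mul,
            t1, t2, t3]; ring
  have m2 : ∫ p : ℝ × ℝ, (spread p.1 + spread p.2) * spread (p.1 + p.2) ∂(P.prod P) =
      2 * theta P := by
    -- The function h₁ + h₂ is odd under the joint flip, so its integral against 1 - h₁₂ is zero.
    have e1 := hP.integral_flip_fst (g := fun p => (spread p.1 - spread p.2) *
      ((1 - spread p.2) / (1 - spread p.1 * spread p.2))) (by fun_prop)
    have e2 := hP.integral_flip_snd (g := fun p => (spread p.1 + spread p.2) *
      ((1 - spread p.1) / (1 + spread p.1 * spread p.2))) (by fun_prop)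
    simp only [spread_neg] at e1 e2
    have f1 : ∫ p : ℝ × ℝ, (-spread p.1 - spread p.2) *
        ((1 - spread p.2) / (1 - -spread p.1 * spread p.2)) * (1 - spread p.1) ∂(P.prod P) =
        -∫ p : ℝ × ℝ, (spread p.1 + spread p.2) * (1 - spread (p.1 + p.2)) ∂(P.prod P) := by
      rw [← integral_neg]
      refine integral_congr_ae (Filter.Eventually.of_forall fun p => ?_)
      simp only [one_sub_spread_add]; ring
    have f2 : ∫ p : ℝ × ℝ, (spread p.1 + spread p.2) *
        ((1 - spread p.1) / (1 + spread p.1 * spread p.2)) * (1 - spread p.2) ∂(P.prod P) =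
        ∫ p : ℝ × ℝ, (spread p.1 + spread p.2) * (1 - spread (p.1 + p.2)) ∂(P.prod P) := by
      refine integral_congr_ae (Filter.Eventually.of_forall fun p => ?_)
      simp only [one_sub_spread_add']; ring
    have f3 : ∫ p : ℝ × ℝ, (spread p.1 - spread p.2) *
        ((1 - spread p.2) / (1 - spread p.1 * spread p.2)) * (1 - spread p.1) ∂(P.prod P) =
        ∫ p : ℝ × ℝ, (spread p.1 + -spread p.2) *
        ((1 - spread p.1) / (1 + spread p.1 * -spread p.2)) * (1 - spread p.2) ∂(P.prod P) := by
      refine integral_congr_ae (Filter.Eventually.of_forall fun p => ?_)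
      simp only [mul_neg]; ring
    rw [f1, f3, e2, f2] at e1
    have f4 : ∫ p : ℝ × ℝ, (spread p.1 + spread p.2) * (1 - spread (p.1 + p.2)) ∂(P.prod P) =
        2 * theta P - ∫ p : ℝ × ℝ, (spread p.1 + spread p.2) * spread (p.1 + p.2) ∂(P.prod P) := by
      rw [← m1, ← integral_sub i1 i2]
      refine integral_congr_ae (Filter.Eventually.of_forall fun p => ?_)
      simp only; ring
    linarith
  have m4 : theta (RecursiveRM.rep P) = ∫ p : ℝ × ℝ, spread (p.1 + p.2) ^ 2 ∂(P.prod P) := by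
    unfold theta RecursiveRM.rep
    rw [integral_map (by fun_prop) (by fun_prop)]
  -- Cauchy-Schwarz as a quadratic inequality in t, optimal at t = 1/(1 + θ); this form needs no
  -- division by θ.
  have key : ∀ t : ℝ, 2 * t * (2 * theta P) - t ^ 2 * (2 * theta P + 2 * theta P ^ 2) ≤
      theta (RecursiveRM.rep P) := by
    intro t
    rw [← m3, ← m2, m4, ← integral_const_mul, ← integral_const_mul,
      ← integral_sub (i2.const_mul _) (i3.const_mul _)]
    refine integral_mono ((i2.const_mul _).sub (i3.const_mul _)) i4 fun p => ?_
    simp only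
    nlinarith [sq_nonneg (spread (p.1 + p.2) - t * (spread p.1 + spread p.2))]
  have h1 : 0 < 1 + theta P := by linarith
  refine le_trans (le_of_eq ?_) (key (1 / (1 + theta P)))
  field_simp; ring

end flips

/-! ### Independent likelihoods -/

lemma prod_cube_succ {M : Type*} [CommMonoid M] {m : ℕ} (f : Cube (m + 1) → M) :
    ∏ y, f y = ∏ x : Cube m, (f (Fin.cons 0 x : Cube (m + 1)) *
      f (Fin.cons 1 x : Cube (m + 1))) := by
  rw [← (Fin.consEquiv fun _ : Fin (m + 1) => ZMod 2).prod_comp, Fintype.prod_prod_type,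
    Finset.prod_mul_distrib]
  exact Fin.prod_univ_two (fun i : ZMod 2 => ∏ x : Cube m, f (Fin.cons i x : Cube (m + 1)))

/-- Joins pairs of values at the points of a cube to the values at the points of the cube of the
next dimension. -/
def joinCube {m : ℕ} (q : Cube m → ℝ × ℝ) : Cube (m + 1) → ℝ := fun y =>
  if y 0 = 0 then (q (Fin.tail y)).1 else (q (Fin.tail y)).2

lemma measurable_joinCube {m : ℕ} : Measurable (joinCube (m := m)) := by
  refine measurable_pi_lambda _ fun y => ?_
  unfold joinCube
  split_ifs <;> fun_prop

lemma joinCube_cons_zero {m : ℕ} (q : Cube m → ℝ × ℝ) (x : Cube m) :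
    joinCube q (Fin.cons 0 x : Cube (m + 1)) = (q x).1 := by
  simp [joinCube]

lemma joinCube_cons_one {m : ℕ} (q : Cube m → ℝ × ℝ) (x : Cube m) :
    joinCube q (Fin.cons 1 x : Cube (m + 1)) = (q x).2 := by
  simp [joinCube]

lemma cube_succ_cases {m : ℕ} (y : Cube (m + 1)) :
    ∃ x : Cube m, y = (Fin.cons 0 x : Cube (m + 1)) ∨ y = (Fin.cons 1 x : Cube (m + 1)) := by
  refine ⟨Fin.tail y, ?_⟩
  rcases zmod_two_cases (y 0) with h | h
  · left; rw [← h, Fin.cons_self_tail]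
  · right; rw [← h, Fin.cons_self_tail]

lemma pi_map_joinCube (m : ℕ) (P : Measure ℝ) [IsProbabilityMeasure P] :
    (Measure.pi fun _ : Cube m => P.prod P).map joinCube = Measure.pi fun _ : Cube (m + 1) => P := by
  refine (Measure.pi_eq fun s hs => ?_).symm
  rw [Measure.map_apply measurable_joinCube (MeasurableSet.univ_pi hs), prod_cube_succ]
  have : joinCube ⁻¹' (Set.univ.pi s) = Set.univ.pi fun x : Cube m =>
      s (Fin.cons 0 x : Cube (m + 1)) ×ˢ s (Fin.cons 1 x : Cube (m + 1)) := by
    ext q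
    simp only [Set.mem_preimage, Set.mem_pi, Set.mem_univ, true_implies, Set.mem_prod]
    constructor
    · intro h x
      exact ⟨by simpa [joinCube_cons_zero] using h (Fin.cons 0 x : Cube (m + 1)),
        by simpa [joinCube_cons_one] using h (Fin.cons 1 x : Cube (m + 1))⟩
    · intro h y
      obtain ⟨x, rfl | rfl⟩ := cube_succ_cases y
      · rw [joinCube_cons_zero]; exact (h x).1
      · rw [joinCube_cons_one]; exact (h x).2
  rw [this, Measure.pi_pi]
  simp only [Measure.prod_prod]

lemma pi_map_pairs (m : ℕ) (P : Measure ℝ) [IsProbabilityMeasure P] {f : ℝ × ℝ → ℝ}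
    (hf : Measurable f) :
    (Measure.pi fun _ : Cube (m + 1) => P).map
      (fun e x => f (e (Fin.cons 0 x : Cube (m + 1)), e (Fin.cons 1 x : Cube (m + 1)))) =
    Measure.pi fun _ : Cube m => (P.prod P).map f := by
  have := fun _ : Cube m => Measure.isProbabilityMeasure_map (μ := P.prod P) hf.aemeasurable
  rw [← pi_map_joinCube, Measure.map_map (by fun_prop) measurable_joinCube,
    ← Measure.pi_map_pi fun _ => hf.aemeasurable]
  congr 1

/-- For a set that need not be measurable only this direction holds in general. All error events are
estimated through it, so the measurability of recursive decoding is never needed. -/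
lemma measureReal_preimage_le {α β : Type*} [MeasurableSpace α] [MeasurableSpace β]
    {μ : Measure α} [IsFiniteMeasure μ] {f : α → β} (hf : Measurable f) (s : Set β) :
    μ.real (f ⁻¹' s) ≤ (μ.map f).real s :=
  ENNReal.toReal_mono (measure_ne_top _ _) (Measure.le_map_apply hf.aemeasurable s)

/-- The probability that some maximum likelihood decoding goes wrong in the course of recursive
decoding from independent likelihoods with the law `P`. -/
def bad (m r : ℕ) (P : Measure ℝ) : ℝ := (Measure.pi fun _ : Cube m => P).real {e | ¬Good m r e}

/-- Each of the two new vectors of likelihoods is again independent with one law, since disjoint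
pairs of positions are combined. The two vectors depend on each other, but a union bound does not
mind. -/
lemma bad_succ_le {m r : ℕ} (hr : 2 ≤ r) (hm : r + 2 ≤ m + 1) (P : Measure ℝ)
    [IsProbabilityMeasure P] : bad (m + 1) r P ≤ bad m (r - 1) (chk P) + bad m r (rep P) := by
  have h1 : bad m (r - 1) (chk P) = ((Measure.pi fun _ : Cube (m + 1) => P).map
      (fun e x => (fun p : ℝ × ℝ => likelihood (spread p.1 * spread p.2))
        (e (Fin.cons 0 x : Cube (m + 1)), e (Fin.cons 1 x : Cube (m + 1))))).real
      {e | ¬Good m (r - 1) e} := by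
    rw [pi_map_pairs m P measurable_chk]; rfl
  have h2 : bad m r (rep P) = ((Measure.pi fun _ : Cube (m + 1) => P).map
      (fun e x => (fun p : ℝ × ℝ => p.1 + p.2)
        (e (Fin.cons 0 x : Cube (m + 1)), e (Fin.cons 1 x : Cube (m + 1))))).real
      {e | ¬Good m r e} := by
    rw [pi_map_pairs m P (f := fun p : ℝ × ℝ => p.1 + p.2) (by fun_prop)]; rfl
  rw [h1, h2]
  refine le_trans (le_trans (measureReal_mono ?_ (measure_ne_top _ _)) (measureReal_union_le _ _))
    (add_le_add (measureReal_preimage_le (by fun_prop) _) (measureReal_preimage_le (by fun_prop) _))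
  intro e he
  simp only [Set.mem_ofPred_eq, Good, if_pos (And.intro hr hm)] at he
  simp only [Set.mem_union, Set.mem_preimage, Set.mem_ofPred_eq]
  tauto

lemma good_iff_leafGood {m r : ℕ} (h : ¬(2 ≤ r ∧ r + 2 ≤ m)) (e : Cube m → ℝ) :
    Good m r e ↔ LeafGood m r e := by
  cases m with
  | zero => rw [Good]
  | succ m => rw [Good, if_neg h]

lemma measureReal_le_prod_ge {ι : Type*} [Fintype ι] (P : Measure ℝ) [IsProbabilityMeasure P]
    (f : ι → ℝ → ℝ) (hf0 : ∀ i x, 0 ≤ f i x) (hf : ∀ i, Integrable (f i) P) {c : ℝ} (hc : 0 < c) :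
    (Measure.pi fun _ : ι => P).real {e | c ≤ ∏ i, f i (e i)} ≤ (∏ i, ∫ x, f i x ∂P) / c := by
  rw [le_div_iff₀ hc, mul_comm, ← integral_fintype_prod_eq_prod]
  exact mul_meas_ge_le_integral_of_nonneg
    (Filter.Eventually.of_forall fun e => Finset.prod_nonneg fun i _ => hf0 i _)
    (Integrable.fintype_prod hf) c

/-- Chernoff's bound with exponent 1/2. -/
lemma SymLaw.measureReal_sum_le_zero {P : Measure ℝ} (hP : SymLaw P) {ι : Type*} [Fintype ι]
    (S : Finset ι) :
    (Measure.pi fun _ : ι => P).real {e | ∑ i ∈ S, e i ≤ 0} ≤ bhat P ^ S.card := by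
  classical
  have := hP.prob
  have h := measureReal_le_prod_ge (ι := ι) P
    (fun i x => if i ∈ S then Real.exp (-x / 2) else 1)
    (fun i x => by split_ifs <;> positivity)
    (fun i => by split_ifs; exacts [hP.integrable_exp_half, integrable_const _]) one_pos
  have h1 : ∏ i, ∫ x, (if i ∈ S then Real.exp (-x / 2) else 1) ∂P = bhat P ^ S.card := by
    rw [← Finset.prod_const, ← Finset.prod_subset (Finset.subset_univ S)
      (fun i _ hi => by simp [hi])]
    refine Finset.prod_congr rfl fun i hi => ?_
    simp only [hi, if_true, hP.integral_exp_half]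
  rw [h1, div_one] at h
  refine le_trans (measureReal_mono ?_ (measure_ne_top _ _)) h
  intro e he
  simp only [Set.mem_ofPred_eq] at he ⊢
  rw [← Finset.prod_subset (Finset.subset_univ S) (fun i _ hi => by simp [hi]),
    Finset.prod_congr rfl (fun i hi => if_pos hi), ← Real.exp_sum, Real.one_le_exp_iff,
    ← Finset.sum_div, Finset.sum_neg_distrib]
  linarith

lemma card_support_ge {m : ℕ} (w : InfoBlock m 1) (hw : w.1 ≠ 0) (hm : 1 ≤ m) :
    2 ^ (m - 1) ≤ (Finset.univ.filter fun x : Cube m => encode w.1 x ≠ 0).card := by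
  have h := sum_bpsk_encode_le w hw
  have h1 : ∀ x : Cube m, bpsk (encode w.1 x) =
      1 - 2 * (if encode w.1 x ≠ 0 then (1 : ℝ) else 0) := by
    intro x
    unfold bpsk
    split_ifs <;> simp_all; norm_num
  simp only [h1, Finset.sum_sub_distrib, ← Finset.mul_sum, Finset.sum_boole] at h
  simp only [Finset.sum_const, Finset.card_univ, Fintype.card_fun, ZMod.card, Fintype.card_fin,
    nsmul_eq_mul, mul_one, Nat.cast_pow, Nat.cast_ofNat] at h
  obtain ⟨k, rfl⟩ : ∃ k, m = k + 1 := ⟨m - 1, by omega⟩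
  have h2 : (2 : ℝ) ^ k ≤ (Finset.univ.filter fun x : Cube (k + 1) => encode w.1 x ≠ 0).card := by
    rw [pow_succ] at h; linarith
  simpa using (by exact_mod_cast h2 :
    2 ^ k ≤ (Finset.univ.filter fun x : Cube (k + 1) => encode w.1 x ≠ 0).card)

lemma SymLaw.bad_leaf_one_le {P : Measure ℝ} (hP : SymLaw P) {m : ℕ} (hm : 1 ≤ m) :
    bad m 1 P ≤ 4 ^ m * bhat P ^ 2 ^ (m - 1) := by
  have := hP.prob
  have hsub : {e : Cube m → ℝ | ¬Good m 1 e} ⊆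
      ⋃ w ∈ (Finset.univ.filter fun w : InfoBlock m 1 => w.1 ≠ 0),
        {e | ∑ x ∈ Finset.univ.filter (fun x : Cube m => encode w.1 x ≠ 0), e x ≤ 0} := by
    intro e he
    rw [Set.mem_ofPred_eq, good_iff_leafGood (by omega)] at he
    unfold LeafGood at he
    push Not at he
    obtain ⟨w, hw, hle⟩ := he
    simp only [Set.mem_iUnion, Set.mem_ofPred_eq]
    refine ⟨w, by simpa using hw, ?_⟩
    rwa [Finset.sum_filter]
  refine (measureReal_mono hsub (measure_ne_top _ _)).trans
    ((measureReal_biUnion_finset_le _ _).trans ?_)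
  refine (Finset.sum_le_sum (g := fun _ => bhat P ^ 2 ^ (m - 1)) fun w hw => ?_).trans ?_
  · refine (hP.measureReal_sum_le_zero _).trans ?_
    exact pow_le_pow_of_le_one hP.bhat_nonneg hP.bhat_le_one
      (card_support_ge w (by simpa using hw) hm)
  · rw [Finset.sum_const, nsmul_eq_mul]
    refine mul_le_mul_of_nonneg_right ?_ (pow_nonneg hP.bhat_nonneg _)
    have h1 : (Finset.univ.filter fun w : InfoBlock m 1 => w.1 ≠ 0).card ≤ 2 ^ (m + 1) :=
      (Finset.card_le_univ _).trans (card_infoBlock_one m)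
    have h2 : 2 ^ (m + 1) ≤ 4 ^ m := by
      rw [show 4 = 2 ^ 2 by norm_num, ← pow_mul]
      exact Nat.pow_le_pow_right (by norm_num) (by omega)
    exact_mod_cast h1.trans h2

/-- Summing e x + e y over ordered pairs of distinct points gives 2(|S| - 1) times the sum over S.
-/
lemma sum_pos_of_pairs {ι : Type*} [DecidableEq ι] (S : Finset ι) (hS : 2 ≤ S.card) (e : ι → ℝ)
    (h : ∀ x ∈ S, ∀ y ∈ S, x ≠ y → 0 < e x + e y) : 0 < ∑ x ∈ S, e x := by
  have h1 : ∀ x ∈ S, ∑ y ∈ S.erase x, (e x + e y) =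
      ((S.card : ℝ) - 2) * e x + ∑ y ∈ S, e y := by
    intro x hx
    rw [Finset.sum_add_distrib, Finset.sum_const, Finset.card_erase_of_mem hx, nsmul_eq_mul,
      ← Finset.add_sum_erase S e hx, Nat.cast_sub (by omega)]
    push_cast; ring
  have h2 : 0 < ∑ x ∈ S, ∑ y ∈ S.erase x, (e x + e y) := by
    refine Finset.sum_pos (fun x hx => Finset.sum_pos (fun y hy => ?_) ?_) ?_
    · exact h x hx y (Finset.mem_of_mem_erase hy) (Finset.ne_of_mem_erase hy).symm
    · rw [← Finset.card_pos, Finset.card_erase_of_mem hx]; omega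
    · rw [← Finset.card_pos]; omega
  rw [Finset.sum_congr rfl h1, Finset.sum_add_distrib, ← Finset.mul_sum, Finset.sum_const,
    nsmul_eq_mul] at h2
  have h3 : (2 : ℝ) ≤ S.card := by exact_mod_cast hS
  by_contra hneg
  nlinarith

/-- A union over all codewords would be too expensive here. As their weights are at least 2, it is
enough that all pairs of likelihoods have positive sums, and there are at most 4^m pairs. -/
lemma SymLaw.bad_leaf_parity_le {P : Measure ℝ} (hP : SymLaw P) {m r : ℕ} (hm : r < m)
    (hl : ¬(2 ≤ r ∧ r + 2 ≤ m)) : bad m r P ≤ 4 ^ m * bhat P ^ 2 := by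
  classical
  have := hP.prob
  have hsub : {e : Cube m → ℝ | ¬Good m r e} ⊆
      ⋃ p ∈ (Finset.univ.filter fun p : Cube m × Cube m => p.1 ≠ p.2),
        {e | ∑ x ∈ ({p.1, p.2} : Finset (Cube m)), e x ≤ 0} := by
    intro e he
    rw [Set.mem_ofPred_eq, good_iff_leafGood hl] at he
    by_contra hcon
    simp only [Set.mem_iUnion, Set.mem_ofPred_eq, not_exists, not_le] at hcon
    apply he
    intro w hw
    rw [← Finset.sum_filter]
    refine sum_pos_of_pairs _ (two_le_weight hm w hw) e fun x _ y _ hxy => ?_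
    have := hcon (x, y) (by simpa using hxy)
    rwa [Finset.sum_pair hxy] at this
  refine (measureReal_mono hsub (measure_ne_top _ _)).trans
    ((measureReal_biUnion_finset_le _ _).trans ?_)
  refine (Finset.sum_le_sum (g := fun _ => bhat P ^ 2) fun p hp => ?_).trans ?_
  · refine (hP.measureReal_sum_le_zero _).trans ?_
    rw [Finset.card_pair (by simpa using hp)]
  · rw [Finset.sum_const, nsmul_eq_mul]
    refine mul_le_mul_of_nonneg_right ?_ (pow_nonneg hP.bhat_nonneg _)
    have h1 : (Finset.univ.filter fun p : Cube m × Cube m => p.1 ≠ p.2).card ≤ 4 ^ m := by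
      refine (Finset.card_le_univ _).trans (le_of_eq ?_)
      simp only [Fintype.card_prod, Fintype.card_fun, ZMod.card, Fintype.card_fin]
      rw [← mul_pow]; norm_num
    exact_mod_cast h1

/-! ### Bounds in terms of the Bhattacharyya parameter -/

lemma two_le_one_add_pow_add {z : ℝ} (hz : 0 ≤ z) (hz1 : z ≤ 1) (M : ℕ) :
    2 ≤ (1 + z) ^ M + (1 - z) ^ M := by
  have h1 := one_add_mul_le_pow (show -2 ≤ z by linarith) M
  have h2 := one_add_mul_le_pow (show -2 ≤ -z by linarith) M
  rw [← sub_eq_add_neg] at h2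
  linarith

/-- On the erasure channel the order "sum first, then products" is at least as good as "products
first, then sum". The difference of the sides is A(A + B - 2) with A = (1 - z)^M and B = (1 + z)^M.
-/
lemma one_sub_pow_sq_le {z : ℝ} (hz : 0 ≤ z) (hz1 : z ≤ 1) (M : ℕ) :
    1 - (1 - z ^ 2) ^ M ≤ (1 - (1 - z) ^ M) ^ 2 := by
  have h1 : (1 - z ^ 2) ^ M = (1 - z) ^ M * (1 + z) ^ M := by rw [← mul_pow]; ring
  have h2 := two_le_one_add_pow_add hz hz1 M
  have h3 : 0 ≤ (1 - z) ^ M := pow_nonneg (by linarith) _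
  rw [h1]; nlinarith

/-- The bound of the error probability that holds for the binary erasure channel. -/
lemma SymLaw.bad_le : ∀ (m r : ℕ) (P : Measure ℝ), SymLaw P → 1 ≤ r → r < m →
    bad m r P ≤ 4 ^ m * (1 - (1 - bhat P) ^ 2 ^ (r - 1)) ^ 2 ^ (m - r)
  | 0, r, P, hP, hr, hm => by omega
  | m + 1, r, P, hP, hr, hm => by
    have hb0 := hP.bhat_nonneg
    have hb1 := hP.bhat_le_one
    have := hP.prob
    by_cases hl : 2 ≤ r ∧ r + 2 ≤ m + 1
    · obtain ⟨s, rfl⟩ : ∃ s, r = s + 2 := ⟨r - 2, by omega⟩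
      obtain ⟨d, rfl⟩ : ∃ d, m = s + 2 + d + 1 := ⟨m - (s + 2) - 1, by omega⟩
      have h1 := SymLaw.bad_le (s + 2 + d + 1) (s + 1) _ hP.chk (by omega) (by omega)
      have h2 := SymLaw.bad_le (s + 2 + d + 1) (s + 2) _ hP.rep (by omega) (by omega)
      rw [show s + 1 - 1 = s by omega, show s + 2 + d + 1 - (s + 1) = d + 2 by omega] at h1
      rw [show s + 2 - 1 = s + 1 by omega, show s + 2 + d + 1 - (s + 2) = d + 1 by omega,
        hP.bhat_rep] at h2
      rw [show s + 2 - 1 = s + 1 by omega, show s + 2 + d + 1 + 1 - (s + 2) = d + 2 by omega]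
      -- A product turns 1 - Z into at least (1 - Z)², so its bound is at most the claimed one.
      have h3 : (1 - bhat P) ^ 2 ^ (s + 1) ≤ (1 - bhat (RecursiveRM.chk P)) ^ 2 ^ s := by
        rw [pow_succ 2 s, mul_comm, pow_mul]
        refine pow_le_pow_left₀ (sq_nonneg _) ?_ _
        nlinarith [hP.bhat_chk_le]
      have h4 : (1 - (1 - bhat (RecursiveRM.chk P)) ^ 2 ^ s) ^ 2 ^ (d + 2) ≤
          (1 - (1 - bhat P) ^ 2 ^ (s + 1)) ^ 2 ^ (d + 2) := by
        refine pow_le_pow_left₀ (sub_nonneg.2 (pow_le_one₀ ?_ ?_)) (by linarith) _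
        · linarith [hP.chk.bhat_le_one]
        · linarith [hP.chk.bhat_nonneg]
      -- After a sum, the products still ahead are moved in front of it by `one_sub_pow_sq_le`.
      have h5 : (1 - (1 - bhat P ^ 2) ^ 2 ^ (s + 1)) ^ 2 ^ (d + 1) ≤
          (1 - (1 - bhat P) ^ 2 ^ (s + 1)) ^ 2 ^ (d + 2) := by
        rw [pow_succ 2 (d + 1), mul_comm, pow_mul]
        refine pow_le_pow_left₀ (sub_nonneg.2 (pow_le_one₀ ?_ ?_))
          (one_sub_pow_sq_le hb0 hb1 _) _
        · nlinarith
        · nlinarith [sq_nonneg (bhat P)]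
      have h6 : 0 ≤ (1 - (1 - bhat P) ^ 2 ^ (s + 1)) ^ 2 ^ (d + 2) :=
        pow_nonneg (sub_nonneg.2 (pow_le_one₀ (by linarith) (by linarith))) _
      have h7 := bad_succ_le hl.1 hl.2 P
      rw [show s + 2 - 1 = s + 1 by omega] at h7
      have h8 : (0 : ℝ) < 4 ^ (s + 2 + d + 1) := by positivity
      calc _ ≤ _ := h7
        _ ≤ 4 ^ (s + 2 + d + 1) * (1 - (1 - bhat P) ^ 2 ^ (s + 1)) ^ 2 ^ (d + 2) +
            4 ^ (s + 2 + d + 1) * (1 - (1 - bhat P) ^ 2 ^ (s + 1)) ^ 2 ^ (d + 2) :=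
          add_le_add (h1.trans (mul_le_mul_of_nonneg_left h4 h8.le))
            (h2.trans (mul_le_mul_of_nonneg_left h5 h8.le))
        -- Of the extra factor 4, a factor 2 is used up by the two branches.
        _ ≤ _ := by
          rw [pow_succ (4 : ℝ) (s + 2 + d + 1)]
          nlinarith [mul_nonneg h8.le h6]
    · have hM : bhat P ≤ 1 - (1 - bhat P) ^ 2 ^ (r - 1) := by
        have := pow_le_of_le_one (show 0 ≤ 1 - bhat P by linarith) (by linarith)
          (show 2 ^ (r - 1) ≠ 0 by positivity)
        linarith
      have hlast : bad (m + 1) r P ≤ 4 ^ (m + 1) * bhat P ^ 2 ^ (m + 1 - r) := by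
        by_cases hr1 : r = 1
        · subst hr1; exact hP.bad_leaf_one_le (by omega)
        · rw [show m + 1 - r = 1 by omega, pow_one]
          exact hP.bad_leaf_parity_le (by omega) hl
      exact hlast.trans (mul_le_mul_of_nonneg_left (pow_le_pow_left₀ hb0 hM _) (by positivity))

/-! ### Maximum likelihood decoding of the code of order one close to capacity -/

/-- With a = log (1 - h) and b = log (1 + h), the right side is exp (-l(a + b)/2) · 2 sinh (l(b -
a)/2). Now a + b ≤ 0, b - a ≥ 2h and sinh x ≥ x for x ≥ 0. -/
lemma rpow_deriv_ineq {l h : ℝ} (hl : 0 < l) (h0 : 0 ≤ h) (h1 : h < 1) :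
    2 * l * h ≤ (1 - h) ^ (-l) - (1 + h) ^ (-l) := by
  have hp : 0 < 1 - h := by linarith
  have hq : 0 < 1 + h := by linarith
  rw [Real.rpow_def_of_pos hp, Real.rpow_def_of_pos hq]
  set a := Real.log (1 - h)
  set b := Real.log (1 + h)
  have h2 : 2 * h ≤ b - a := by
    have := Real.hasSum_log_sub_log_of_abs_lt_one (abs_lt.2 ⟨by linarith, h1⟩ : |h| < 1)
    have h3 := this.summable.sum_le_tsum (Finset.range 1) (fun i _ => by positivity)
    rw [this.tsum_eq] at h3
    simpa using h3
  have h3 : a + b ≤ 0 := by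
    rw [← Real.log_mul hp.ne' hq.ne']
    exact Real.log_nonpos (by positivity) (by nlinarith)
  have e1 : Real.exp (a * -l) = Real.exp (-(l * (a + b)) / 2) * Real.exp (l * (b - a) / 2) := by
    rw [← Real.exp_add]; congr 1; ring
  have e2 : Real.exp (b * -l) = Real.exp (-(l * (a + b)) / 2) * Real.exp (-(l * (b - a) / 2)) := by
    rw [← Real.exp_add]; congr 1; ring
  have h4 : 1 ≤ Real.exp (-(l * (a + b)) / 2) := by
    rw [Real.one_le_exp_iff]; nlinarith
  have h5 : 0 ≤ l * (b - a) / 2 := by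
    have : 0 ≤ b - a := by linarith
    positivity
  have h6 : 2 * (l * (b - a) / 2) ≤
      Real.exp (l * (b - a) / 2) - Real.exp (-(l * (b - a) / 2)) := by
    have := Real.self_le_sinh_iff.2 h5
    rw [Real.sinh_eq] at this
    linarith
  rw [e1, e2, ← mul_sub]
  nlinarith

/-- The difference F of the two sides vanishes at 0, and by `rpow_deriv_ineq` it increases. -/
lemma rpow_add_rpow_le_of_nonneg {l h : ℝ} (hl0 : 0 < l) (hl1 : l < 1) (h0 : 0 ≤ h)
    (h1 : h < 1) :
    ((1 + h) ^ (1 - l) + (1 - h) ^ (1 - l)) / 2 ≤ 1 - l * (1 - l) * h ^ 2 / 2 := by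
  let F : ℝ → ℝ := fun x =>
    1 - l * (1 - l) * x ^ 2 / 2 - ((1 + x) ^ (1 - l) + (1 - x) ^ (1 - l)) / 2
  have hd : ∀ x ∈ Set.Ico (0 : ℝ) 1, HasDerivAt F (-(l * (1 - l) * x) -
      ((1 - l) * (1 + x) ^ (-l) - (1 - l) * (1 - x) ^ (-l)) / 2) x := by
    intro x hx
    have g1 : HasDerivAt (fun x : ℝ => (1 + x) ^ (1 - l)) ((1 - l) * (1 + x) ^ (-l)) x :=
      (((hasDerivAt_id' x).const_add 1).rpow_const (p := 1 - l)
        (Or.inl (by linarith [hx.1]))).congr_deriv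
        (by rw [show 1 - l - 1 = -l by ring]; ring)
    have g2 : HasDerivAt (fun x : ℝ => (1 - x) ^ (1 - l)) (-((1 - l) * (1 - x) ^ (-l))) x :=
      (((hasDerivAt_id' x).const_sub 1).rpow_const (p := 1 - l)
        (Or.inl (by linarith [hx.2]))).congr_deriv
        (by rw [show 1 - l - 1 = -l by ring]; ring)
    have g3 : HasDerivAt (fun x : ℝ => 1 - l * (1 - l) * x ^ 2 / 2) (-(l * (1 - l) * x)) x :=
      ((((hasDerivAt_pow 2 x).const_mul (l * (1 - l))).div_const 2).const_sub 1).congr_deriv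
        (by norm_num; ring)
    exact (g3.sub ((g1.add g2).div_const 2)).congr_deriv (by ring)
  have hmono : MonotoneOn F (Set.Ico 0 1) := by
    refine monotoneOn_of_deriv_nonneg (convex_Ico 0 1)
      (fun x hx => (hd x hx).continuousAt.continuousWithinAt)
      (fun x hx => (hd x (interior_subset hx)).differentiableAt.differentiableWithinAt) ?_
    intro x hx
    have hx' := interior_subset hx
    rw [(hd x hx').deriv]
    have := rpow_deriv_ineq hl0 hx'.1 hx'.2
    nlinarith
  have h2 := hmono (Set.left_mem_Ico.2 one_pos) ⟨h0, h1⟩ h0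
  simp only [F] at h2
  norm_num at h2
  linarith

lemma rpow_add_rpow_le {l h : ℝ} (hl0 : 0 < l) (hl1 : l < 1) (hh : |h| < 1) :
    ((1 + h) ^ (1 - l) + (1 - h) ^ (1 - l)) / 2 ≤ 1 - l * (1 - l) * h ^ 2 / 2 := by
  rw [abs_lt] at hh
  rcases le_total 0 h with h0 | h0
  · exact rpow_add_rpow_le_of_nonneg hl0 hl1 h0 hh.2
  · have := rpow_add_rpow_le_of_nonneg hl0 hl1 (show 0 ≤ -h by linarith) (by linarith)
    rw [neg_sq, sub_neg_eq_add, ← sub_eq_add_neg] at this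
    linarith

lemma SymLaw.lintegral_rpow_le {P : Measure ℝ} (hP : SymLaw P) {l : ℝ} (hl0 : 0 < l)
    (hl1 : l < 1) : ∫⁻ e, ENNReal.ofReal ((1 + spread e) ^ (-l)) ∂P ≤
      ENNReal.ofReal (1 - l * (1 - l) * theta P / 2) := by
  have := hP.prob
  have hi : Integrable (fun e => 1 - l * (1 - l) * spread e ^ 2 / 2) P :=
    (integrable_const _).sub (((hP.integrable_pow 2).const_mul _).div_const _)
  have hint : ∫ e, (1 - l * (1 - l) * spread e ^ 2 / 2) ∂P = 1 - l * (1 - l) * theta P / 2 := by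
    rw [integral_sub (integrable_const _) (((hP.integrable_pow 2).const_mul _).div_const _),
      integral_div, integral_const_mul]
    simp [theta]
  have hpos : ∀ e, 0 ≤ 1 - l * (1 - l) * spread e ^ 2 / 2 := by
    intro e
    have := spread_sq_lt_one e
    nlinarith [mul_pos hl0 (sub_pos.2 hl1), sq_nonneg (spread e), sq_nonneg (l - 1 / 2)]
  rw [hP.lintegral_mix (by fun_prop), ← hint,
    ofReal_integral_eq_lintegral_ofReal hi (Filter.Eventually.of_forall hpos)]
  refine lintegral_mono fun e => ?_
  have h1 : 0 < 1 + spread e := by linarith [neg_one_lt_spread e]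
  have h2 : 0 < 1 - spread e := by linarith [spread_lt_one e]
  have h3 : 0 < 1 + spread (-e) := by rw [spread_neg]; linarith
  rw [← ENNReal.ofReal_mul (by positivity), ← ENNReal.ofReal_mul (by positivity),
    ← ENNReal.ofReal_add (by positivity) (by positivity), spread_neg, ← sub_eq_add_neg]
  refine ENNReal.ofReal_le_ofReal ?_
  refine le_trans (le_of_eq ?_) (rpow_add_rpow_le hl0 hl1 (abs_spread_lt_one e))
  have e1 : ∀ x : ℝ, 0 < x → x ^ (1 - l) = x ^ (-l) * x := by
    intro x hx
    rw [show 1 - l = -l + 1 by ring, Real.rpow_add_one hx.ne']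
  rw [e1 _ h1, e1 _ h2]; ring

lemma SymLaw.integrable_rpow {P : Measure ℝ} (hP : SymLaw P) {l : ℝ} (hl0 : 0 < l)
    (hl1 : l < 1) : Integrable (fun e => (1 + spread e) ^ (-l)) P := by
  refine ⟨(by fun_prop : Measurable fun e => (1 + spread e) ^ (-l)).aestronglyMeasurable, ?_⟩
  have h1 : ∀ e, 0 < 1 + spread e := fun e => by linarith [neg_one_lt_spread e]
  rw [hasFiniteIntegral_iff_ofReal (Filter.Eventually.of_forall fun e =>
    (Real.rpow_pos_of_pos (h1 e) _).le)]
  exact (hP.lintegral_rpow_le hl0 hl1).trans_lt ENNReal.ofReal_lt_top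

lemma SymLaw.integral_rpow_le {P : Measure ℝ} (hP : SymLaw P) {l : ℝ} (hl0 : 0 < l)
    (hl1 : l < 1) : ∫ e, (1 + spread e) ^ (-l) ∂P ≤ 1 - l * (1 - l) * theta P / 2 := by
  have h1 : ∀ e, 0 < 1 + spread e := fun e => by linarith [neg_one_lt_spread e]
  have h2 := hP.theta_le_one
  rw [integral_eq_lintegral_of_nonneg_ae (Filter.Eventually.of_forall fun e =>
    (Real.rpow_pos_of_pos (h1 e) _).le)
    (by fun_prop : Measurable fun e => (1 + spread e) ^ (-l)).aestronglyMeasurable]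
  refine ENNReal.toReal_le_of_le_ofReal ?_ (hP.lintegral_rpow_le hl0 hl1)
  nlinarith [mul_pos hl0 (sub_pos.2 hl1), sq_nonneg (l - 1 / 2), hP.theta_nonneg]

lemma one_add_bpsk_mul_spread_pos (a : ZMod 2) (e : ℝ) : 0 < 1 + bpsk a * spread e := by
  have h1 := neg_one_lt_spread e
  have h2 := spread_lt_one e
  rcases bpsk_eq a with h | h <;> rw [h] <;> linarith

/-- Threshold decoding on the density ∏ (1 ± h) of a codeword relative to uniformly random symbols.
The first term bounds the event that the density of the sent word is below T, by a moment of order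
-l. The second bounds the event that another word reaches T: its density has mean at most 1, because
its signs sum to at most 0. For small l and θ the exponent approaches the capacity θ/2 per symbol.
-/
lemma SymLaw.bad_one_le {P : Measure ℝ} (hP : SymLaw P) (m : ℕ) {l T : ℝ} (hl0 : 0 < l)
    (hl1 : l < 1) (hT : 0 < T) :
    bad m 1 P ≤ T ^ l * Real.exp (-(l * (1 - l) * (2 ^ m * theta P) / 2)) + 2 ^ (m + 1) / T := by
  have := hP.prob
  have hpos : ∀ e, 0 < 1 + spread e := fun e => by linarith [neg_one_lt_spread e]
  have hcard : Fintype.card (Cube m) = 2 ^ m := by simp [ZMod.card]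
  have hsub : {e : Cube m → ℝ | ¬Good m 1 e} ⊆
      {e | T ^ (-l) ≤ ∏ x, (1 + spread (e x)) ^ (-l)} ∪
      ⋃ w ∈ (Finset.univ.filter fun w : InfoBlock m 1 => w.1 ≠ 0),
        {e | T ≤ ∏ x, (1 + bpsk (encode w.1 x) * spread (e x))} := by
    intro e he
    rw [Set.mem_ofPred_eq, good_iff_leafGood (by omega)] at he
    unfold LeafGood at he
    push Not at he
    obtain ⟨w, hw, hle⟩ := he
    rcases lt_or_ge (∏ x, (1 + spread (e x))) T with hlt | hge
    · left
      simp only [Set.mem_ofPred_eq]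
      rw [Real.finsetProd_rpow _ _ (fun x _ => (hpos _).le)]
      exact Real.rpow_le_rpow_of_nonpos (Finset.prod_pos fun x _ => hpos _) hlt.le (by linarith)
    · right
      simp only [Set.mem_iUnion, Set.mem_ofPred_eq]
      refine ⟨w, by simpa using hw, hge.trans ?_⟩
      -- Changing a sign multiplies the factor by exp (-e), so a codeword that is at least as likely
      -- as the sent one has at least its density.
      have h1 : ∀ x, 1 + bpsk (encode w.1 x) * spread (e x) = (1 + spread (e x)) *
          Real.exp (-if encode w.1 x ≠ 0 then e x else 0) := by
        intro x
        rcases zmod_two_cases (encode w.1 x) with h | h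
        · simp [h]
        · simp only [h, bpsk_one]
          rw [if_pos one_ne_zero, ← one_sub_spread]; ring
      simp only [h1]
      rw [Finset.prod_mul_distrib, ← Real.exp_sum, Finset.sum_neg_distrib]
      refine le_mul_of_one_le_right (Finset.prod_nonneg fun x _ => (hpos _).le) ?_
      rw [Real.one_le_exp_iff]; linarith
  refine (measureReal_mono hsub (measure_ne_top _ _)).trans
    ((measureReal_union_le _ _).trans (add_le_add ?_ ((measureReal_biUnion_finset_le _ _).trans ?_)))
  · refine (measureReal_le_prod_ge P (fun _ x => (1 + spread x) ^ (-l))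
      (fun _ x => (Real.rpow_pos_of_pos (hpos x) _).le) (fun _ => hP.integrable_rpow hl0 hl1)
      (Real.rpow_pos_of_pos hT _)).trans ?_
    rw [Finset.prod_const, Finset.card_univ, hcard, Real.rpow_neg hT.le, div_inv_eq_mul, mul_comm]
    refine mul_le_mul_of_nonneg_left ?_ (Real.rpow_nonneg hT.le _)
    have h1 : ∫ e, (1 + spread e) ^ (-l) ∂P ≤ Real.exp (-(l * (1 - l) * theta P / 2)) :=
      (hP.integral_rpow_le hl0 hl1).trans (by
        have := Real.add_one_le_exp (-(l * (1 - l) * theta P / 2)); linarith)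
    refine (pow_le_pow_left₀ (integral_nonneg fun e => (Real.rpow_pos_of_pos (hpos e) _).le)
      h1 _).trans (le_of_eq ?_)
    rw [← Real.exp_nat_mul]; congr 1; push_cast; ring
  · refine (Finset.sum_le_sum (g := fun _ => 1 / T) fun w hw => ?_).trans ?_
    · refine (measureReal_le_prod_ge P (fun x e => 1 + bpsk (encode w.1 x) * spread e)
        (fun x e => (one_add_bpsk_mul_spread_pos _ _).le) (fun x => ?_) hT).trans ?_
      · exact (integrable_const _).add
          ((by simpa using hP.integrable_pow 1 : Integrable spread P).const_mul _)
      refine div_le_div_of_nonneg_right ?_ hT.le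
      have h1 : ∀ x, ∫ e, (1 + bpsk (encode w.1 x) * spread e) ∂P =
          1 + bpsk (encode w.1 x) * theta P := by
        intro x
        rw [integral_add (integrable_const _)
          ((by simpa using hP.integrable_pow 1 : Integrable spread P).const_mul _),
          integral_const_mul, hP.integral_spread]
        simp
      simp only [h1]
      calc ∏ x, (1 + bpsk (encode w.1 x) * theta P)
          ≤ ∏ x, Real.exp (bpsk (encode w.1 x) * theta P) := by
            refine Finset.prod_le_prod (fun x _ => ?_) fun x _ => ?_
            · have h2 := hP.theta_nonneg
              have h3 := hP.theta_le_one
              rcases bpsk_eq (encode w.1 x) with h | h <;> rw [h] <;> linarith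
            · have := Real.add_one_le_exp (bpsk (encode w.1 x) * theta P); linarith
        _ ≤ 1 := by
            rw [← Real.exp_sum, ← Finset.sum_mul, Real.exp_le_one_iff]
            exact mul_nonpos_of_nonpos_of_nonneg (sum_bpsk_encode_le w (by simpa using hw))
              hP.theta_nonneg
    · rw [Finset.sum_const, nsmul_eq_mul, mul_one_div]
      refine div_le_div_of_nonneg_right ?_ hT.le
      have h1 : (Finset.univ.filter fun w : InfoBlock m 1 => w.1 ≠ 0).card ≤ 2 ^ (m + 1) :=
        (Finset.card_le_univ _).trans (card_infoBlock_one m)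
      exact_mod_cast h1

/-! ### Bounds along the decoding paths -/

/-- It suffices to bound the error probabilities of the decodings at which the paths of the
recursion reach the order `1` or a given difference `d` of the parameters. -/
lemma bad_le_of_frontier {Inv : ℕ → ℕ → Measure ℝ → Prop} {d : ℕ} (hd : 1 ≤ d) {η : ℝ}
    (hsym : ∀ m r P, Inv m r P → SymLaw P)
    (hchk : ∀ m r P, Inv (m + 1) (r + 1) P → 1 ≤ r → r < m → Inv m r (chk P))
    (hrep : ∀ m r P, Inv (m + 1) r P → 1 ≤ r → r < m → Inv m r (rep P))
    (hfr : ∀ m r P, Inv m r P → 1 ≤ r → r + d ≤ m → (r = 1 ∨ m = r + d) → bad m r P ≤ η) :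
    ∀ m r P, Inv m r P → 1 ≤ r → r + d ≤ m → bad m r P ≤ ((m : ℝ) + 1) ^ (r - 1) * η := by
  intro m
  induction m with
  | zero => intro r P _ hr hm; omega
  | succ m ih =>
    intro r P hI hr hm
    have := (hsym _ _ _ hI).prob
    have hη : bad (m + 1) r P ≤ η → bad (m + 1) r P ≤ (((m + 1 : ℕ) : ℝ) + 1) ^ (r - 1) * η := by
      intro h
      have h0 : 0 ≤ η := le_trans measureReal_nonneg h
      refine h.trans (le_mul_of_one_le_left h0 (one_le_pow₀ ?_))
      push_cast; linarith [(Nat.cast_nonneg m : (0 : ℝ) ≤ m)]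
    by_cases hl : r = 1 ∨ m + 1 = r + d
    · exact hη (hfr _ _ _ hI hr hm hl)
    · obtain ⟨s, rfl⟩ : ∃ s, r = s + 2 := ⟨r - 2, by omega⟩
      have h1 := ih (s + 1) _ (hchk _ _ _ hI (by omega) (by omega)) (by omega) (by omega)
      have h2 := ih (s + 2) _ (hrep _ _ _ hI (by omega) (by omega)) (by omega) (by omega)
      have h3 := bad_succ_le (m := m) (r := s + 2) (by omega) (by omega) P
      rw [show s + 2 - 1 = s + 1 by omega] at h2 h3 ⊢
      rw [show s + 1 - 1 = s by omega] at h1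
      have hm0 : (0 : ℝ) < (m : ℝ) + 1 := by positivity
      have h0 : 0 ≤ η := by
        have : 0 ≤ ((m : ℝ) + 1) ^ s * η := le_trans measureReal_nonneg h1
        exact nonneg_of_mul_nonneg_right this (by positivity)
      -- The number of frontier nodes obeys Pascal's recursion, and (m + 1)^(r - 1) dominates it.
      have h4 : ((m : ℝ) + 1) ^ s + ((m : ℝ) + 1) ^ (s + 1) ≤ ((m : ℝ) + 1 + 1) ^ (s + 1) := by
        have := pow_le_pow_left₀ hm0.le (show (m : ℝ) + 1 ≤ m + 1 + 1 by linarith) s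
        rw [pow_succ, pow_succ]
        nlinarith
      push_cast
      nlinarith [mul_le_mul_of_nonneg_right h4 h0]

/-- A lower bound of `theta P` after some of the transformations. -/
def ThetaBound (X : ℝ) (D m r : ℕ) (P : Measure ℝ) : Prop :=
  1 ≤ theta P * (1 + (Real.exp (X / 2 ^ (r - 1)) - 1) * (1 / 2) ^ (D - (m - r)))

/-- The invariant reads 1/θ - 1 ≤ (exp (X/2^(r-1)) - 1)/2^j, with j = D - (m - r) the number of sums
taken so far. A product squares θ and y = exp (X/2^(r-1)) alike, and (1 + (y - 1)c)² ≤ 1 + (y² - 1)c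
for 0 ≤ c ≤ 1, the difference being c(1 - c)(y - 1)². -/
lemma ThetaBound.chk {X : ℝ} (hX : 0 ≤ X) {D m r : ℕ} {P : Measure ℝ} (hP : SymLaw P)
    (h : ThetaBound X D (m + 1) (r + 1) P) (hr : 1 ≤ r) :
    ThetaBound X D m r (RecursiveRM.chk P) := by
  unfold ThetaBound at h ⊢
  obtain ⟨s, rfl⟩ : ∃ s, r = s + 1 := ⟨r - 1, by omega⟩
  rw [show m + 1 - (s + 1 + 1) = m - (s + 1) by omega] at h
  simp only [Nat.add_sub_cancel] at h ⊢
  rw [hP.theta_chk]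
  set c : ℝ := (1 / 2) ^ (D - (m - (s + 1)))
  have hc0 : 0 ≤ c := by positivity
  have hc1 : c ≤ 1 := pow_le_one₀ (by norm_num) (by norm_num)
  have hy : Real.exp (X / 2 ^ s) = Real.exp (X / 2 ^ (s + 1)) ^ 2 := by
    rw [← Real.exp_nat_mul]; congr 1; rw [pow_succ]; push_cast; field_simp
  have hy1 : 1 ≤ Real.exp (X / 2 ^ (s + 1)) := Real.one_le_exp (by positivity)
  rw [hy]
  set y := Real.exp (X / 2 ^ (s + 1))
  have h0 := hP.theta_nonneg
  calc 1 ≤ (theta P * (1 + (y - 1) * c)) ^ 2 := one_le_pow₀ h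
    _ = theta P ^ 2 * (1 + (y - 1) * c) ^ 2 := by ring
    _ ≤ _ := by
      refine mul_le_mul_of_nonneg_left ?_ (sq_nonneg _)
      nlinarith [mul_nonneg (mul_nonneg hc0 (sub_nonneg.2 hc1)) (sq_nonneg (y - 1))]

/-- A sum halves 1/θ - 1, and j grows by one. -/
lemma ThetaBound.rep {X : ℝ} {D m r : ℕ} {P : Measure ℝ} (hP : SymLaw P)
    (h : ThetaBound X D (m + 1) r P) (hr : r < m) (hD : m + 1 - r ≤ D) :
    ThetaBound X D m r (RecursiveRM.rep P) := by
  unfold ThetaBound at h ⊢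
  rw [show D - (m - r) = D - (m + 1 - r) + 1 by omega, pow_succ]
  set c : ℝ := (1 / 2) ^ (D - (m + 1 - r))
  set y := Real.exp (X / 2 ^ (r - 1))
  have h0 := hP.theta_nonneg
  have h1 := hP.theta_rep_ge
  have hB : 0 ≤ 1 + (y - 1) * c := by
    by_contra hneg
    nlinarith
  have h2 : 0 ≤ 1 + (y - 1) * (c * (1 / 2)) := by linarith
  refine le_trans ?_ (mul_le_mul_of_nonneg_right h1 h2)
  rw [div_mul_eq_mul_div, le_div_iff₀ (by linarith)]
  linarith

/-- The erasure bound with 1 - Z ≥ θ/2. The invariant gives θ ≥ min 1 (c/y)/2 with y^(2^(r-1)) = exp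
X, so the products still ahead raise the gain c = 2^j of the sums to the power 2^(r-1), while exp X
enters only once. -/
lemma SymLaw.bad_le_exp {P : Measure ℝ} (hP : SymLaw P) {X : ℝ} {D m r : ℕ}
    (h : ThetaBound X D m r P) (hr : 1 ≤ r) (hm : r < m) :
    bad m r P ≤ 4 ^ m * Real.exp (-((1 / 4) ^ 2 ^ (r - 1) *
      min 1 (Real.exp (-X) * (2 ^ (D - (m - r))) ^ 2 ^ (r - 1)) * 2 ^ (m - r))) := by
  refine (hP.bad_le m r P hr hm).trans (mul_le_mul_of_nonneg_left ?_ (by positivity))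
  have hb0 := hP.bhat_nonneg
  have hb1 := hP.bhat_le_one
  have hθ := hP.theta_nonneg
  set M := 2 ^ (r - 1) with hM
  set c : ℝ := 2 ^ (D - (m - r)) with hc
  have hc0 : 0 < c := by positivity
  unfold ThetaBound at h
  rw [one_div, inv_pow, ← hc] at h
  have hMR : (M : ℝ) = 2 ^ (r - 1) := by rw [hM]; push_cast; rfl
  rw [← hMR] at h
  have hM0 : (0 : ℝ) < M := by rw [hMR]; positivity
  set y := Real.exp (X / M)
  have hy0 : 0 < y := Real.exp_pos _
  have hyM : y ^ M = Real.exp X := by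
    rw [← Real.exp_nat_mul]; congr 1; field_simp
  have hkey : (1 / 4) ^ M * min 1 (Real.exp (-X) * c ^ M) ≤ (1 - bhat P) ^ M := by
    have h1 : 1 ≤ theta P * (1 + y * c⁻¹) := by
      refine h.trans (mul_le_mul_of_nonneg_left ?_ hθ)
      have : 0 < c⁻¹ := by positivity
      nlinarith
    have h2 : 1 / 4 * min 1 (y⁻¹ * c) ≤ 1 - bhat P := by
      have h3 := hP.bhat_le
      have h4 : 1 / 2 * min 1 (y⁻¹ * c) ≤ theta P := by
        have h5 : min 1 (y⁻¹ * c) * (1 + y * c⁻¹) ≤ 2 := by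
          have h6 : min 1 (y⁻¹ * c) * (y * c⁻¹) ≤ (y⁻¹ * c) * (y * c⁻¹) :=
            mul_le_mul_of_nonneg_right (min_le_right _ _) (by positivity)
          have h7 : (y⁻¹ * c) * (y * c⁻¹) = 1 := by field_simp
          have h8 := min_le_left 1 (y⁻¹ * c)
          nlinarith
        have h6 : 0 < 1 + y * c⁻¹ := by positivity
        by_contra hneg
        push Not at hneg
        nlinarith
      linarith
    have h3 : min 1 (Real.exp (-X) * c ^ M) ≤ (min 1 (y⁻¹ * c)) ^ M := by
      rcases le_total 1 (y⁻¹ * c) with h4 | h4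
      · rw [min_eq_left h4, one_pow]; exact min_le_left _ _
      · rw [min_eq_right h4, mul_pow, inv_pow, hyM, Real.exp_neg]; exact min_le_right _ _
    calc _ ≤ (1 / 4) ^ M * (min 1 (y⁻¹ * c)) ^ M := mul_le_mul_of_nonneg_left h3 (by positivity)
      _ = (1 / 4 * min 1 (y⁻¹ * c)) ^ M := by rw [mul_pow]
      _ ≤ _ := pow_le_pow_left₀ (by positivity) h2 _
  have h5 : (1 - bhat P) ^ M ≤ 1 := pow_le_one₀ (by linarith) (by linarith)
  have h6 : 1 - (1 - bhat P) ^ M ≤ Real.exp (-((1 / 4) ^ M * min 1 (Real.exp (-X) * c ^ M))) := by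
    have := Real.add_one_le_exp (-((1 / 4) ^ M * min 1 (Real.exp (-X) * c ^ M)))
    linarith
  refine (pow_le_pow_left₀ (by linarith) h6 _).trans (le_of_eq ?_)
  rw [← Real.exp_nat_mul]; congr 1; push_cast; ring

/-! ### Growth comparisons -/

lemma two_pow_eq_exp (n : ℕ) : (2 : ℝ) ^ n = Real.exp (n * Real.log 2) := by
  rw [Real.exp_nat_mul, Real.exp_log two_pos]

lemma four_pow_eq_exp (n : ℕ) : (4 : ℝ) ^ n = Real.exp (n * (2 * Real.log 2)) := by
  rw [Real.exp_nat_mul]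
  congr 1
  rw [mul_comm, Real.exp_mul, Real.exp_log two_pos]; norm_num

lemma tendsto_succ_pow_mul_exp_neg (k : ℕ) {c : ℝ} (hc : 0 < c) :
    Filter.Tendsto (fun m : ℕ => ((m : ℝ) + 1) ^ k * Real.exp (-(c * m))) Filter.atTop (nhds 0) := by
  have h1 : Filter.Tendsto (fun m : ℕ => c * ((m : ℝ) + 1)) Filter.atTop Filter.atTop :=
    (Filter.tendsto_atTop_add_const_right _ _ tendsto_natCast_atTop_atTop).const_mul_atTop hc
  have h2 := ((Real.tendsto_pow_mul_exp_neg_atTop_nhds_zero k).comp h1).const_mul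
    (Real.exp c / c ^ k)
  rw [mul_zero] at h2
  refine h2.congr fun m => ?_
  simp only [Function.comp_apply]
  rw [mul_pow, show -(c * ((m : ℝ) + 1)) = -c + -(c * m) by ring, Real.exp_add, Real.exp_neg c]
  have := Real.exp_pos c
  field_simp

lemma eventually_pow_le_exp (k : ℕ) {c : ℝ} (hc : 0 < c) (K : ℝ) :
    ∀ᶠ m : ℕ in Filter.atTop, K * ((m : ℝ) + 1) ^ k ≤ Real.exp (c * m) := by
  have h := (tendsto_succ_pow_mul_exp_neg k hc).const_mul K
  rw [mul_zero] at h
  filter_upwards [h.eventually (gt_mem_nhds one_pos)] with m hm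
  rw [← mul_assoc, Real.exp_neg, ← div_eq_mul_inv, div_lt_one (Real.exp_pos _)] at hm
  exact hm.le

/-! ### Codes of fixed order -/

/-- No sums have been taken at the root. The hypothesis says that all r - 1 products together would
leave a second moment of at least exp (-X). -/
lemma thetaBound_root {X : ℝ} {m r : ℕ} {P : Measure ℝ}
    (h : Real.exp (-X) ≤ theta P ^ 2 ^ (r - 1)) (hP : SymLaw P) : ThetaBound X (m - r) m r P := by
  unfold ThetaBound
  rw [Nat.sub_self, pow_zero, mul_one, add_sub_cancel]
  have h0 := hP.theta_nonneg
  rw [← one_le_pow_iff_of_nonneg (by positivity) (show 2 ^ (r - 1) ≠ 0 by positivity), mul_pow,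
    ← Real.exp_nat_mul]
  have h1 : ((2 ^ (r - 1) : ℕ) : ℝ) * (X / 2 ^ (r - 1)) = X := by push_cast; field_simp
  rw [h1]
  have h2 := mul_le_mul_of_nonneg_right h (Real.exp_pos X).le
  rwa [← Real.exp_add, neg_add_cancel, Real.exp_zero] at h2

/-- Paths are followed until q = (m - r)/3 sums have been taken or the order is one. Leaves of order
one reached by then have 2^m' θ ≥ 2^(D+1)/(2^q + exp X), which the sharp bound `SymLaw.bad_one_le`
needs. At the other nodes the order is at least 2, so that pending products at least square the gain
2^q of the sums, and the crude bound is doubly exponentially small. -/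
lemma SymLaw.bad_le_fixed {P : Measure ℝ} (hP : SymLaw P) {m r : ℕ} (hr : 1 ≤ r)
    (hm : r + 6 ≤ m) {X l T : ℝ} (hX : 0 ≤ X) (hX2 : Real.exp X ≤ 2 ^ (m - r + 1))
    (hl0 : 0 < l) (hl1 : l < 1) (hT : 0 < T)
    (h : Real.exp (-X) ≤ theta P ^ 2 ^ (r - 1)) :
    bad m r P ≤ ((m : ℝ) + 1) ^ (r - 1) *
      (4 ^ m * Real.exp (-((1 / 4) ^ 2 ^ r * 2 ^ ((m - r) / 3 - 1))) +
        (T ^ l * Real.exp (-(l * (1 - l) *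
          (2 ^ (m - r + 1) / (2 ^ ((m - r) / 3) + Real.exp X)) / 2)) +
          2 ^ (m - r + 2) / T)) := by
  obtain ⟨D, rfl⟩ : ∃ D, m = r + D := ⟨m - r, by omega⟩
  rw [Nat.add_sub_cancel_left] at *
  set q := D / 3 with hq
  let Inv : ℕ → ℕ → Measure ℝ → Prop := fun m' r' P' =>
    SymLaw P' ∧ ThetaBound X D m' r' P' ∧ m' - r' ≤ D ∧ m' ≤ r + D ∧ r' ≤ r
  refine bad_le_of_frontier (Inv := Inv) (d := D - q) (by omega) (fun m' r' P' h => h.1) ?_ ?_ ?_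
    (r + D) r P ⟨hP, ?_, by omega, le_rfl, le_rfl⟩ hr (by omega)
  · rintro m' r' P' ⟨h1, h2, h3, h4, h5⟩ h6 h7
    exact ⟨h1.chk, h2.chk hX h1 h6, by omega, by omega, by omega⟩
  · rintro m' r' P' ⟨h1, h2, h3, h4, h5⟩ h6 h7
    exact ⟨h1.rep, h2.rep h1 h7 h3, by omega, by omega, by omega⟩
  · rintro m' r' P' ⟨h1, h2, h3, h4, h5⟩ h6 h7 h8
    have hA : 0 ≤ 4 ^ (r + D) * Real.exp (-((1 / 4) ^ 2 ^ r * 2 ^ (q - 1))) := by positivity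
    have hB : 0 ≤ T ^ l * Real.exp (-(l * (1 - l) *
          (2 ^ (D + 1) / (2 ^ q + Real.exp X)) / 2)) + 2 ^ (D + 2) / T := by positivity
    by_cases hr1 : r' = 1
    · subst hr1
      refine le_trans ?_ (le_add_of_nonneg_left hA)
      refine (h1.bad_one_le m' hl0 hl1 hT).trans (add_le_add ?_ ?_)
      · refine mul_le_mul_of_nonneg_left ?_ (Real.rpow_nonneg hT.le _)
        rw [Real.exp_le_exp, neg_le_neg_iff]
        refine div_le_div_of_nonneg_right (mul_le_mul_of_nonneg_left ?_
          (mul_nonneg hl0.le (by linarith))) two_pos.le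
        unfold ThetaBound at h2
        simp only [le_refl, tsub_eq_zero_of_le, pow_zero, div_one] at h2
        set b := D - (m' - 1) with hb
        have h9 : (2 : ℝ) ^ (D + 1) = 2 ^ m' * 2 ^ b := by
          rw [← pow_add]; congr 1; omega
        have h10 : 1 ≤ theta P' * (1 + Real.exp X * (1 / 2) ^ b) := by
          refine h2.trans (mul_le_mul_of_nonneg_left ?_ h1.theta_nonneg)
          have : (0 : ℝ) < (1 / 2) ^ b := by positivity
          nlinarith
        rw [div_le_iff₀ (by positivity), h9, mul_assoc]
        refine mul_le_mul_of_nonneg_left ?_ (by positivity)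
        have h11 : (2 : ℝ) ^ b ≤ 2 ^ q := pow_le_pow_right₀ (by norm_num) (by omega)
        calc (2 : ℝ) ^ b ≤ 2 ^ b * (theta P' * (1 + Real.exp X * (1 / 2) ^ b)) :=
              le_mul_of_one_le_right (by positivity) h10
          _ = theta P' * (2 ^ b + Real.exp X) := by
              rw [one_div, inv_pow]; field_simp
          _ ≤ _ := mul_le_mul_of_nonneg_left (by linarith) h1.theta_nonneg
      · refine div_le_div_of_nonneg_right ?_ hT.le
        exact pow_le_pow_right₀ (by norm_num) (by omega)
    · refine le_trans ?_ (le_add_of_nonneg_right hB)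
      have hm' : m' - r' = D - q := by omega
      refine (h1.bad_le_exp h2 h6 (by omega)).trans (mul_le_mul ?_ ?_ (by positivity)
        (by positivity))
      · exact pow_le_pow_right₀ (by norm_num) h4
      · rw [Real.exp_le_exp, neg_le_neg_iff, hm', show D - (D - q) = q by omega, mul_assoc]
        refine mul_le_mul ?_ ?_ (by positivity) (by positivity)
        · exact pow_le_pow_of_le_one (by norm_num) (by norm_num)
            (Nat.pow_le_pow_right (by norm_num) (by omega))
        · have e1 : (2 : ℝ) ^ (q - 1) ≤ 1 * 2 ^ (D - q) := by
            rw [one_mul]; exact pow_le_pow_right₀ (by norm_num) (by omega)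
          have e2 : (2 : ℝ) ^ (q - 1) ≤ (Real.exp (-X) * (2 ^ q) ^ 2 ^ (r' - 1)) * 2 ^ (D - q) := by
            -- This uses order at least 2. The surplus 2^(2q) compensates exp (-X) ≥ 2^(-(D+1)) and
            -- the length 2^(D-q), leaving 2^(q-1).
            have e3 : (2 : ℝ) ^ (2 * q) ≤ (2 ^ q) ^ 2 ^ (r' - 1) := by
              rw [← pow_mul]
              refine pow_le_pow_right₀ (by norm_num) ?_
              rw [mul_comm]
              refine Nat.mul_le_mul_left _ ?_
              calc 2 = 2 ^ 1 := rfl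
                _ ≤ 2 ^ (r' - 1) := Nat.pow_le_pow_right (by norm_num) (by omega)
            have e4 : (2 : ℝ) ^ (q - 1) * 2 ^ (D + 1) = 2 ^ (2 * q) * 2 ^ (D - q) := by
              rw [← pow_add, ← pow_add]; congr 1; omega
            rw [Real.exp_neg, mul_assoc, ← div_eq_inv_mul, le_div_iff₀ (Real.exp_pos _)]
            calc (2 : ℝ) ^ (q - 1) * Real.exp X ≤ 2 ^ (q - 1) * 2 ^ (D + 1) :=
                  mul_le_mul_of_nonneg_left hX2 (by positivity)
              _ = 2 ^ (2 * q) * 2 ^ (D - q) := e4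
              _ ≤ _ := mul_le_mul_of_nonneg_right e3 (by positivity)
          rcases le_total 1 (Real.exp (-X) * (2 ^ q) ^ 2 ^ (r' - 1)) with h9 | h9
          · rwa [min_eq_left h9]
          · rwa [min_eq_right h9]
  · have := thetaBound_root (m := r + D) h hP
    rwa [Nat.add_sub_cancel_left] at this

lemma eventually_two_pow_third (r k : ℕ) (K : ℝ) :
    ∀ᶠ m : ℕ in Filter.atTop, K * ((m : ℝ) + 1) ^ k ≤ 2 ^ ((m - r) / 3 - 1) := by
  have hlog := Real.log_pos one_lt_two
  filter_upwards [eventually_pow_le_exp k (c := Real.log 2 / 3) (by positivity)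
    (K * Real.exp ((r + 6) / 3 * Real.log 2)), Filter.eventually_ge_atTop (r + 6)] with m hm hm2
  have h1 : (m : ℝ) / 3 - (r + 6) / 3 ≤ (((m - r) / 3 - 1 : ℕ) : ℝ) := by
    have : m ≤ 3 * ((m - r) / 3 - 1) + r + 6 := by omega
    have h2 : (m : ℝ) ≤ 3 * (((m - r) / 3 - 1 : ℕ) : ℝ) + r + 6 := by exact_mod_cast this
    linarith
  rw [two_pow_eq_exp]
  have h2 : Real.exp ((r + 6) / 3 * Real.log 2) * (K * ((m : ℝ) + 1) ^ k) ≤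
      Real.exp ((r + 6) / 3 * Real.log 2) *
        Real.exp ((((m - r) / 3 - 1 : ℕ) : ℝ) * Real.log 2) := by
    rw [← Real.exp_add]
    refine le_trans (by linarith) (hm.trans (Real.exp_le_exp.2 ?_))
    nlinarith
  exact le_of_mul_le_mul_left h2 (Real.exp_pos _)

/-- Here E = exp L = 2^(D+1), Q = 2^(D/3) and E/(2(1 + ε)L) = exp X. The right side is half the
lower bound of 2^m' θ at a leaf of order one, the available information; it still exceeds the rate L
by the factor 1 + ε/2, since Q is negligible. -/
lemma capacity_margin {ε L E Q : ℝ} (hε : 0 < ε) (hε1 : ε ≤ 1) (hL : 0 < L) (hE : 0 < E)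
    (hQ : 0 ≤ Q) (h : 16 / ε * L * Q ≤ E) :
    (1 + ε / 2) * L ≤ E / (Q + E / (2 * (1 + ε) * L)) / 2 := by
  rw [div_div, le_div_iff₀ (by positivity)]
  have e1 : (1 + ε / 2) * L * (E / (2 * (1 + ε) * L) * 2) =
      E * ((1 + ε / 2) / (1 + ε)) := by field_simp
  have e2 : (1 + ε / 2) / (1 + ε) ≤ 1 - ε / 4 := by
    rw [div_le_iff₀ (by linarith)]; nlinarith
  have e4 : 4 * (L * Q) ≤ E * (ε / 4) := by
    have := mul_le_mul_of_nonneg_right h (show 0 ≤ ε / 4 by positivity)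
    refine le_trans (le_of_eq ?_) this
    field_simp; ring
  have e5 : 0 ≤ L * Q := by positivity
  have e3 : (1 + ε / 2) * L * Q * 2 ≤ E * (ε / 4) := by nlinarith
  have e6 := mul_le_mul_of_nonneg_left e2 hE.le
  calc (1 + ε / 2) * L * ((Q + E / (2 * (1 + ε) * L)) * 2)
      = (1 + ε / 2) * L * Q * 2 + (1 + ε / 2) * L * (E / (2 * (1 + ε) * L) * 2) := by ring
    _ ≤ E := by rw [e1]; linarith

/-- The exponent of the first term of `SymLaw.bad_one_le` for T = exp ((1 + ε/4)L) and l = ε/8. The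
threshold lies between the rate L and the information Y ≥ (1 + ε/2)L. -/
lemma chernoff_margin {ε L Y : ℝ} (hε : 0 < ε) (hε1 : ε ≤ 1) (hL : 0 < L)
    (hY : (1 + ε / 2) * L ≤ Y) :
    (1 + ε / 4) * L * (ε / 8) - ε / 8 * (1 - ε / 8) * Y ≤ -(ε ^ 2 / 128 * L) := by
  have e1 := mul_le_mul_of_nonneg_left hY
    (show 0 ≤ ε / 8 * (1 - ε / 8) from mul_nonneg (by positivity) (by linarith))
  have e2 : (1 + ε / 4) * L * (ε / 8) - ε / 8 * (1 - ε / 8) * ((1 + ε / 2) * L) =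
    -(ε ^ 2 / 64) * (1 - ε / 2) * L := by ring
  have : 0 ≤ ε ^ 2 * L := by positivity
  nlinarith

lemma SymLaw.bad_le_fixed_of_margin {P : Measure ℝ} (hP : SymLaw P) {D r : ℕ} (hr : 1 ≤ r)
    (hD : 6 ≤ D) {ε L : ℝ} (hε : 0 < ε) (hε1 : ε ≤ 1) (hL : 1 ≤ L)
    (hn : (2 : ℝ) ^ (D + 1) = Real.exp L)
    (hsmall : (16 / ε) * L ≤ 2 ^ (D / 3 - 1))
    (h : 2 * (1 + ε) * L ≤ Real.exp L * theta P ^ 2 ^ (r - 1)) :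
    bad (r + D) r P ≤ (((r + D : ℕ) : ℝ) + 1) ^ (r - 1) *
      (4 ^ (r + D) * Real.exp (-((1 / 4) ^ 2 ^ r * 2 ^ (D / 3 - 1))) +
        (Real.exp (-(ε ^ 2 / 128 * L)) + 2 * Real.exp (-(ε / 4 * L)))) := by
  have hc : 0 < 2 * (1 + ε) * L := by positivity
  have hL0 : 0 < L := by linarith
  obtain ⟨X, hX⟩ : ∃ X, X = L - Real.log (2 * (1 + ε) * L) := ⟨_, rfl⟩
  have heX : Real.exp X = Real.exp L / (2 * (1 + ε) * L) := by
    rw [hX, Real.exp_sub, Real.exp_log hc]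
  have hsmall' : (16 / ε) * L * 2 ^ (D / 3) ≤ Real.exp L := by
    calc (16 / ε) * L * 2 ^ (D / 3) ≤ 2 ^ (D / 3 - 1) * 2 ^ (D / 3) :=
          mul_le_mul_of_nonneg_right hsmall (by positivity)
      _ = 2 ^ (D / 3 - 1 + D / 3) := by rw [pow_add]
      _ ≤ 2 ^ (D + 1) := pow_le_pow_right₀ (by norm_num) (by omega)
      _ = _ := hn
  have hX0 : 0 ≤ X := by
    rw [← Real.one_le_exp_iff, heX, le_div_iff₀ hc, one_mul]
    refine le_trans ?_ hsmall'
    have e1 : 2 * (1 + ε) ≤ 16 / ε := by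
      rw [le_div_iff₀ hε]; nlinarith
    have e2 : (1 : ℝ) ≤ 2 ^ (D / 3) := one_le_pow₀ (by norm_num)
    exact (mul_le_mul_of_nonneg_right e1 hL0.le).trans
      (le_mul_of_one_le_right (by positivity) e2)
  have hX2 : Real.exp X ≤ 2 ^ (D + 1) := by
    rw [hn, heX]
    refine div_le_self (Real.exp_pos _).le ?_
    nlinarith
  have hθ' : Real.exp (-X) ≤ theta P ^ 2 ^ (r - 1) := by
    rw [Real.exp_neg, heX, inv_div, div_le_iff₀ (Real.exp_pos _), mul_comm (theta P ^ _)]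
    exact h
  have key := hP.bad_le_fixed hr (show r + 6 ≤ r + D by omega) (X := X) (l := ε / 8)
    (T := Real.exp ((1 + ε / 4) * L)) hX0 (by rwa [Nat.add_sub_cancel_left]) (by positivity)
    (by linarith) (Real.exp_pos _) hθ'
  rw [Nat.add_sub_cancel_left] at key
  refine key.trans (mul_le_mul_of_nonneg_left (add_le_add le_rfl (add_le_add ?_ (le_of_eq ?_)))
    (by positivity))
  · rw [← Real.exp_mul, ← Real.exp_add, Real.exp_le_exp, hn, heX, mul_div_assoc, ← sub_eq_add_neg]
    exact chernoff_margin hε hε1 hL0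
      (capacity_margin hε hε1 hL0 (Real.exp_pos _) (by positivity) hsmall')
  · rw [pow_succ, hn, mul_comm, mul_div_assoc, ← Real.exp_sub]
    congr 2; ring

/-- The number of nodes is polynomial in m, while the leaf errors are at most exponentially small
powers 2^(-cm) with c of order ε². The hypothesis is the capacity condition, with margin ε, for the
first code of order one. -/
theorem eventually_bad_le_fixed {r : ℕ} (hr : 1 ≤ r) {ε η : ℝ} (hε : 0 < ε) (hε1 : ε ≤ 1)
    (hη : 0 < η) : ∀ᶠ m : ℕ in Filter.atTop, ∀ P : Measure ℝ, SymLaw P →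
      2 * (1 + ε) * ((m - r + 1 : ℕ) * Real.log 2) ≤
        2 ^ (m - r + 1) * theta P ^ 2 ^ (r - 1) → bad m r P ≤ η := by
  have hlog := Real.log_pos one_lt_two
  have hlog1 := Real.log_two_lt_d9
  have hlog2 := Real.log_two_gt_d9
  have hc0 : 0 < ε ^ 2 / 128 * Real.log 2 := by positivity
  have hc1 : 0 < ε / 4 * Real.log 2 := by positivity
  have lim1 := (tendsto_succ_pow_mul_exp_neg (r - 1) one_pos)
  have lim2 := (tendsto_succ_pow_mul_exp_neg (r - 1) hc0).const_mul
    (Real.exp (ε ^ 2 / 128 * Real.log 2 * r))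
  have lim3 := (tendsto_succ_pow_mul_exp_neg (r - 1) hc1).const_mul
    (2 * Real.exp (ε / 4 * Real.log 2 * r))
  rw [mul_zero] at lim2 lim3
  have hη3 : 0 < η / 3 := by positivity
  filter_upwards [lim1.eventually (gt_mem_nhds hη3), lim2.eventually (gt_mem_nhds hη3),
    lim3.eventually (gt_mem_nhds hη3), Filter.eventually_ge_atTop (r + 6),
    eventually_two_pow_third r 1 (4 ^ 2 ^ r * 3),
    eventually_two_pow_third r 1 (16 / ε)] with m h1 h2 h3 hm h4 h5 P hP hθ
  obtain ⟨D, rfl⟩ : ∃ D, m = r + D := ⟨m - r, by omega⟩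
  rw [Nat.add_sub_cancel_left] at h4 h5 hθ
  have hDL : ((D + 1 : ℕ) : ℝ) = D + 1 := by push_cast; ring
  have hD6 : (6 : ℝ) ≤ D := by exact_mod_cast (show 6 ≤ D by omega)
  have hr0 : (0 : ℝ) ≤ r := Nat.cast_nonneg r
  have hrD : ((r + D : ℕ) : ℝ) = r + D := by push_cast; ring
  have key := hP.bad_le_fixed_of_margin hr (show 6 ≤ D by omega) hε hε1
    (L := (D + 1 : ℕ) * Real.log 2) (by rw [hDL]; nlinarith) (two_pow_eq_exp _)
    (by
      refine le_trans ?_ h5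
      rw [pow_one, hDL, hrD]
      exact mul_le_mul_of_nonneg_left (by nlinarith) (by positivity))
    (by rw [← two_pow_eq_exp]; exact hθ)
  have b2 : Real.exp (-(ε ^ 2 / 128 * ((D + 1 : ℕ) * Real.log 2))) ≤
      Real.exp (ε ^ 2 / 128 * Real.log 2 * r) *
        Real.exp (-(ε ^ 2 / 128 * Real.log 2 * (r + D : ℕ))) := by
    rw [← Real.exp_add, Real.exp_le_exp, hDL, hrD]
    linarith
  have b3 : 2 * Real.exp (-(ε / 4 * ((D + 1 : ℕ) * Real.log 2))) ≤
      2 * Real.exp (ε / 4 * Real.log 2 * r) *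
        Real.exp (-(ε / 4 * Real.log 2 * (r + D : ℕ))) := by
    rw [mul_assoc, ← Real.exp_add, hDL, hrD]
    refine mul_le_mul_of_nonneg_left (Real.exp_le_exp.2 ?_) two_pos.le
    linarith
  have b1 : 4 ^ (r + D) * Real.exp (-((1 / 4) ^ 2 ^ r * 2 ^ (D / 3 - 1))) ≤
      Real.exp (-(1 * (r + D : ℕ))) := by
    rw [four_pow_eq_exp, ← Real.exp_add, Real.exp_le_exp]
    have e1 : 3 * (((r + D : ℕ) : ℝ) + 1) ≤ (1 / 4) ^ 2 ^ r * 2 ^ (D / 3 - 1) := by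
      have := mul_le_mul_of_nonneg_left h4 (show (0 : ℝ) ≤ (1 / 4) ^ 2 ^ r by positivity)
      refine le_trans (le_of_eq ?_) this
      have h6 : (1 / 4 : ℝ) ^ 2 ^ r * 4 ^ 2 ^ r = 1 := by rw [← mul_pow]; norm_num
      calc 3 * (((r + D : ℕ) : ℝ) + 1) =
            ((1 / 4 : ℝ) ^ 2 ^ r * 4 ^ 2 ^ r) * (3 * (((r + D : ℕ) : ℝ) + 1)) := by rw [h6, one_mul]
        _ = _ := by ring
    have : (0 : ℝ) ≤ ((r + D : ℕ) : ℝ) := Nat.cast_nonneg _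
    nlinarith
  refine key.trans ?_
  have hp : (0 : ℝ) ≤ (((r + D : ℕ) : ℝ) + 1) ^ (r - 1) := by positivity
  have := mul_le_mul_of_nonneg_left (add_le_add b1 (add_le_add b2 b3)) hp
  refine this.trans ?_
  rw [mul_add, mul_add]
  linarith

/-! ### Codes of fixed rate -/

lemma half_pow_eq_exp (n : ℕ) : (1 / 2 : ℝ) ^ n = Real.exp (-(n * Real.log 2)) := by
  rw [one_div, inv_pow, two_pow_eq_exp, Real.exp_neg]

/-- Bernoulli's inequality gives (1 - Z)^K ≥ 1 - KZ ≥ 1/2. -/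
lemma SymLaw.bad_le_of_small {P : Measure ℝ} (hP : SymLaw P) {m r : ℕ} (hr : 1 ≤ r) (hm : r < m)
    (h : (2 : ℝ) ^ (r - 1) * bhat P ≤ 1 / 2) : bad m r P ≤ 4 ^ m * (1 / 2) ^ 2 ^ (m - r) := by
  refine (hP.bad_le m r P hr hm).trans (mul_le_mul_of_nonneg_left ?_ (by positivity))
  refine pow_le_pow_left₀ (sub_nonneg.2 (pow_le_one₀ ?_ ?_)) ?_ _
  · linarith [hP.bhat_le_one]
  · linarith [hP.bhat_nonneg]
  · have h1 := one_add_mul_le_pow (show -2 ≤ -bhat P by linarith [hP.bhat_le_one]) (2 ^ (r - 1))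
    push_cast at h1
    rw [← sub_eq_add_neg] at h1
    linarith

/-- The Bhattacharyya parameter is small after `D - (m - r)` doublings of the likelihoods. -/
def BhatBound (z : ℝ) (D r₀ m r : ℕ) (P : Measure ℝ) : Prop :=
  bhat P ≤ (2 ^ (r₀ - r) * z) ^ 2 ^ (D - (m - r))

/-- A product at most doubles Z, and the factor 2 may be put inside the power 2^j. Unlike
`ThetaBound`, this records how fast Z falls once it is small compared with the products taken. -/
lemma BhatBound.chk {z : ℝ} (hz : 0 ≤ z) {D r₀ m r : ℕ} {P : Measure ℝ} (hP : SymLaw P)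
    (h : BhatBound z D r₀ (m + 1) (r + 1) P) (hr : r + 1 ≤ r₀) :
    BhatBound z D r₀ m r (RecursiveRM.chk P) := by
  unfold BhatBound at h ⊢
  rw [show m + 1 - (r + 1) = m - r by omega] at h
  rw [show r₀ - r = r₀ - (r + 1) + 1 by omega, pow_succ, mul_right_comm, mul_pow]
  have h1 : (2 : ℝ) ≤ 2 ^ 2 ^ (D - (m - r)) := by
    calc (2 : ℝ) = 2 ^ 1 := (pow_one _).symm
      _ ≤ _ := pow_le_pow_right₀ (by norm_num) Nat.one_le_two_pow
  have h2 : 0 ≤ (2 ^ (r₀ - (r + 1)) * z) ^ 2 ^ (D - (m - r)) := by positivity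
  nlinarith [hP.bhat_chk_le, sq_nonneg (bhat P)]

lemma BhatBound.rep {z : ℝ} {D r₀ m r : ℕ} {P : Measure ℝ} (hP : SymLaw P)
    (h : BhatBound z D r₀ (m + 1) r P) (hr : r < m) (hD : m + 1 - r ≤ D) :
    BhatBound z D r₀ m r (RecursiveRM.rep P) := by
  unfold BhatBound at h ⊢
  rw [show D - (m - r) = D - (m + 1 - r) + 1 by omega, pow_succ, pow_mul, hP.bhat_rep]
  exact pow_le_pow_left₀ hP.bhat_nonneg h 2

lemma ThetaBound.one_sub_theta_le {X : ℝ} {D m r : ℕ} {P : Measure ℝ}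
    (hX : 0 ≤ X) (h : ThetaBound X D m r P) :
    1 - theta P ≤ (X / 2 ^ (r - 1)) * Real.exp (X / 2 ^ (r - 1)) * (1 / 2) ^ (D - (m - r)) := by
  unfold ThetaBound at h
  set t := X / 2 ^ (r - 1)
  set c : ℝ := (1 / 2) ^ (D - (m - r))
  have ht : 0 ≤ t := by positivity
  have hc : 0 ≤ c := by positivity
  have h1 : Real.exp t - 1 ≤ t * Real.exp t := by
    have h2 := Real.add_one_le_exp (-t)
    have h3 : Real.exp (-t) * Real.exp t = 1 := by rw [← Real.exp_add]; simp
    nlinarith [Real.exp_pos t]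
  have h2 : 0 ≤ Real.exp t - 1 := by linarith [Real.one_le_exp ht]
  have h3 := mul_le_mul_of_nonneg_right h1 hc
  have h4 := mul_nonneg h2 hc
  nlinarith

/-- Error bound for the decodings that have few of the products of spreads ahead. -/
lemma SymLaw.bad_le_of_few {P : Measure ℝ} (hP : SymLaw P) {δ : ℝ} {D m r : ℕ} (hδ : 0 < δ)
    (hδ1 : δ ≤ 1 / 4) (hr : 1 ≤ r) (hm : r < m) (hD : m - r ≤ D) (hD4 : D / 4 ≤ m - r)
    (h : ThetaBound ((1 - δ) * ((D + 1) * Real.log 2)) D m r P)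
    (hk : (2 : ℝ) ^ (r - 1) ≤ δ * (D + 1) / 4) :
    bad m r P ≤ 4 ^ m * Real.exp (-(1 / 4 * Real.exp (δ * (D + 1) / 2 * Real.log 2))) := by
  have hlog := Real.log_pos one_lt_two
  refine (hP.bad_le_exp h hr hm).trans (mul_le_mul_of_nonneg_left ?_ (by positivity))
  rw [Real.exp_le_exp, neg_le_neg_iff, mul_assoc]
  -- Since K = 2^(r-1) is at most δ(D + 1)/4, the loss 4^(-K) costs only half of the margin
  -- 2^(δ(D+1)).
  have e1 : Real.exp (-(δ * (D + 1) / 2 * Real.log 2)) ≤ (1 / 4 : ℝ) ^ 2 ^ (r - 1) := by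
    rw [one_div, inv_pow, four_pow_eq_exp, ← Real.exp_neg, Real.exp_le_exp]
    push_cast
    nlinarith
  have e2 : 1 / 4 * Real.exp (δ * (D + 1) * Real.log 2) ≤
      min 1 (Real.exp (-((1 - δ) * ((D + 1) * Real.log 2))) *
        (2 ^ (D - (m - r))) ^ 2 ^ (r - 1)) * 2 ^ (m - r) := by
    have hq : (1 / 4 : ℝ) = Real.exp (-(2 * Real.log 2)) := by
      have := half_pow_eq_exp 2
      push_cast at this
      rw [← this]; norm_num
    have hDm : (D : ℝ) / 4 - 3 / 4 ≤ ((m - r : ℕ) : ℝ) := by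
      have : D ≤ 4 * (m - r) + 3 := by omega
      have : (D : ℝ) ≤ 4 * ((m - r : ℕ) : ℝ) + 3 := by exact_mod_cast this
      linarith
    have f1 : 1 / 4 * Real.exp (δ * (D + 1) * Real.log 2) ≤ 1 * 2 ^ (m - r) := by
      rw [hq, ← Real.exp_add, one_mul, two_pow_eq_exp, Real.exp_le_exp]
      have : δ * (D + 1) ≤ 1 / 4 * (D + 1) := mul_le_mul_of_nonneg_right hδ1 (by positivity)
      nlinarith
    have f2 : 1 / 4 * Real.exp (δ * (D + 1) * Real.log 2) ≤
        Real.exp (-((1 - δ) * ((D + 1) * Real.log 2))) *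
        (2 ^ (D - (m - r))) ^ 2 ^ (r - 1) * 2 ^ (m - r) := by
      -- The power is not needed: the gain 2^j of the sums and the remaining 2^(m-r) already restore
      -- 2^D.
      have f3 : (2 : ℝ) ^ (D - (m - r)) ≤ (2 ^ (D - (m - r))) ^ 2 ^ (r - 1) :=
        le_self_pow₀ (one_le_pow₀ (by norm_num)) (by positivity)
      have f4 : (2 : ℝ) ^ (D - (m - r)) * 2 ^ (m - r) = 2 ^ D := by
        rw [← pow_add]; congr 1; omega
      calc _ ≤ Real.exp (-((1 - δ) * ((D + 1) * Real.log 2))) * 2 ^ D := by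
            rw [hq, two_pow_eq_exp, ← Real.exp_add, ← Real.exp_add, Real.exp_le_exp]
            nlinarith
        _ = Real.exp (-((1 - δ) * ((D + 1) * Real.log 2))) *
            (2 ^ (D - (m - r)) * 2 ^ (m - r)) := by rw [f4]
        _ ≤ _ := by
            rw [mul_assoc]
            exact mul_le_mul_of_nonneg_left (mul_le_mul_of_nonneg_right f3 (by positivity))
              (Real.exp_pos _).le
    rcases le_total 1 (Real.exp (-((1 - δ) * ((D + 1) * Real.log 2))) *
        (2 ^ (D - (m - r))) ^ 2 ^ (r - 1)) with h9 | h9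
    · rwa [min_eq_left h9]
    · rwa [min_eq_right h9]
  refine le_trans (le_of_eq ?_) (mul_le_mul e1 e2 (by positivity) (by positivity))
  rw [mul_left_comm, ← Real.exp_add]
  congr 2; ring

/-- Error bound for the decodings whose likelihoods are reliable since few products of spreads
are left, compared with the number of sums of likelihoods that have been taken. -/
lemma SymLaw.bad_le_of_medium {P : Measure ℝ} (hP : SymLaw P) {δ : ℝ} {D m r : ℕ} (hδ : 0 < δ)
    (hδ1 : δ ≤ 1 / 4) (hr : 1 ≤ r) (hm : r < m) (hD4 : m - r = D / 4)
    (h : ThetaBound ((1 - δ) * ((D + 1) * Real.log 2)) D m r P)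
    (hk : δ * (D + 1) / 4 < 2 ^ (r - 1)) (hk2 : ((r - 1 : ℕ) : ℝ) ≤ 5 * D / 8)
    (hbig : 4 * Real.exp (4 / δ) * (D + 1) ≤ Real.exp (Real.log 2 / 8 * D)) :
    bad m r P ≤ 4 ^ m * (1 / 2) ^ 2 ^ (D / 4) := by
  have hlog := Real.log_pos one_lt_two
  have hlog1 := Real.log_two_lt_d9
  have hlog2 : Real.log 2 ≤ 1 := by linarith
  rw [← hD4]
  refine hP.bad_le_of_small hr hm ?_
  set X := (1 - δ) * ((D + 1) * Real.log 2) with hX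
  have hX0 : 0 ≤ X := mul_nonneg (by linarith) (by positivity)
  have hX1 : X ≤ D + 1 := by
    have h1 : (D + 1 : ℝ) * Real.log 2 ≤ D + 1 := mul_le_of_le_one_right (by positivity) hlog2
    have h2 : 0 ≤ (D + 1 : ℝ) * Real.log 2 := by positivity
    nlinarith
  have h1 := h.one_sub_theta_le hX0
  set K : ℝ := 2 ^ (r - 1) with hK
  have hK0 : 0 < K := by positivity
  have ht : X / K ≤ 4 / δ := by
    rw [div_le_div_iff₀ hK0 hδ]
    nlinarith
  -- With Z² ≤ 1 - θ ≤ (X/K) exp (X/K) 2^(-j), one factor K cancels. The other is at most 2^(5D/8),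
  -- against 2^(-j) ≤ 2^(-3D/4); what remains is 2^(-D/8) times a factor linear in D, as K > δ(D +
  -- 1)/4 bounds X/K by 4/δ.
  have h2 : (K * bhat P) ^ 2 ≤ 1 / 4 := by
    calc (K * bhat P) ^ 2 = K ^ 2 * bhat P ^ 2 := by ring
      _ ≤ K ^ 2 * (X / K * Real.exp (X / K) * (1 / 2) ^ (D - (m - r))) :=
          mul_le_mul_of_nonneg_left (hP.bhat_sq_le.trans h1) (sq_nonneg _)
      _ = (X * Real.exp (X / K)) * (K * (1 / 2) ^ (D - (m - r))) := by field_simp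
      _ ≤ ((D + 1) * Real.exp (4 / δ)) * Real.exp (-(Real.log 2 / 8 * D)) := by
          refine mul_le_mul (mul_le_mul hX1 (Real.exp_le_exp.2 ht) (Real.exp_pos _).le
            (by positivity)) ?_ (by positivity) (by positivity)
          rw [hK, two_pow_eq_exp, half_pow_eq_exp, ← Real.exp_add, Real.exp_le_exp]
          have : 3 * (D : ℝ) / 4 ≤ ((D - (m - r) : ℕ) : ℝ) := by
            have : 3 * D ≤ 4 * (D - (m - r)) := by omega
            have : (3 : ℝ) * D ≤ 4 * ((D - (m - r) : ℕ) : ℝ) := by exact_mod_cast this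
            linarith
          nlinarith
      _ ≤ 1 / 4 := by
          rw [Real.exp_neg, ← div_eq_mul_inv, div_le_iff₀ (Real.exp_pos _)]
          linarith
  nlinarith [mul_nonneg hK0.le hP.bhat_nonneg]

/-- Error bound for the decodings whose likelihoods are reliable since few products of spreads
have been taken. -/
lemma SymLaw.bad_le_of_many {P : Measure ℝ} (hP : SymLaw P) {z X : ℝ} {D r₀ m r : ℕ} (hz : 0 ≤ z)
    (hr : 1 ≤ r) (hm : r < m) (hr0 : r ≤ r₀) (hD4 : m - r = D / 4)
    (h : BhatBound z D r₀ m r P) (hzX : z ^ 2 ≤ X / 2 ^ (r₀ - 1)) (hX : X ≤ D + 1)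
    (hs : ((r₀ - 1 : ℕ) : ℝ) ≤ 9 * D / 8) (hk : 5 * (D : ℝ) / 8 < ((r - 1 : ℕ) : ℝ))
    (hbig : 4 * ((D : ℝ) + 1) ≤ Real.exp (Real.log 2 / 8 * D))
    (hbig2 : (m : ℝ) + 1 ≤ 2 ^ (D - D / 4)) :
    bad m r P ≤ 4 ^ m * (1 / 2) ^ 2 ^ (D / 4) := by
  have hlog := Real.log_pos one_lt_two
  rw [← hD4]
  refine hP.bad_le_of_small hr hm ?_
  -- The exponent of 2 is 2(r₀ - r) - (r₀ - 1) = (r₀ - 1) - 2(r - 1) ≤ 9D/8 - 10D/8 = -D/8. Once the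
  -- base is at most 1/2, the 3D/4 or more sums make Z doubly exponentially small.
  have h1 : (2 ^ (r₀ - r) * z) ^ 2 ≤ 1 / 4 := by
    calc (2 ^ (r₀ - r) * z) ^ 2 = (2 ^ (r₀ - r)) ^ 2 * z ^ 2 := by ring
      _ ≤ (2 ^ (r₀ - r)) ^ 2 * (X / 2 ^ (r₀ - 1)) :=
          mul_le_mul_of_nonneg_left hzX (by positivity)
      _ = X * ((2 ^ (r₀ - r)) ^ 2 * (1 / 2) ^ (r₀ - 1)) := by
          rw [one_div, inv_pow, div_eq_mul_inv]; ring
      _ ≤ (D + 1) * Real.exp (-(Real.log 2 / 8 * D)) := by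
          refine mul_le_mul hX ?_ (by positivity) (by positivity)
          rw [← pow_mul, two_pow_eq_exp, half_pow_eq_exp, ← Real.exp_add, Real.exp_le_exp]
          have : ((r₀ - r : ℕ) : ℝ) = ((r₀ - 1 : ℕ) : ℝ) - ((r - 1 : ℕ) : ℝ) := by
            rw [eq_sub_iff_add_eq]; norm_cast; omega
          rw [Nat.cast_mul, this]
          push_cast
          nlinarith
      _ ≤ 1 / 4 := by
          rw [Real.exp_neg, ← div_eq_mul_inv, div_le_iff₀ (Real.exp_pos _)]
          linarith
  have h2 : 2 ^ (r₀ - r) * z ≤ 1 / 2 := by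
    have : 0 ≤ 2 ^ (r₀ - r) * z := by positivity
    nlinarith
  have h3 : bhat P ≤ (1 / 2) ^ 2 ^ (D - D / 4) := by
    refine le_trans h ?_
    rw [hD4]
    exact pow_le_pow_left₀ (by positivity) h2 _
  calc (2 : ℝ) ^ (r - 1) * bhat P ≤ 2 ^ m * (1 / 2) ^ 2 ^ (D - D / 4) :=
        mul_le_mul (pow_le_pow_right₀ (by norm_num) (by omega)) h3 hP.bhat_nonneg (by positivity)
    _ ≤ 2 ^ m * (1 / 2) ^ (m + 1) := by
        refine mul_le_mul_of_nonneg_left ?_ (by positivity)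
        refine pow_le_pow_of_le_one (by norm_num) (by norm_num) ?_
        exact_mod_cast hbig2
    _ = 1 / 2 := by
        rw [pow_succ, ← mul_assoc, ← mul_pow]; norm_num

/-- Paths stop at order one or at m' - r' = D/4. The bounds are chosen by the number r' - 1 of
products still ahead: logarithmic in D, up to 5D/8, or more. No single invariant covers the whole
range. -/
lemma SymLaw.bad_le_rate {P : Measure ℝ} (hP : SymLaw P) {δ : ℝ} {D r : ℕ} (hδ : 0 < δ)
    (hδ1 : δ ≤ 1 / 4) (hr : 1 ≤ r) (hD : 4 ≤ D) (hs : ((r - 1 : ℕ) : ℝ) ≤ 9 * D / 8)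
    (hbig : 4 * Real.exp (4 / δ) * (D + 1) ≤ Real.exp (Real.log 2 / 8 * D))
    (hbig2 : ((r + D : ℕ) : ℝ) + 1 ≤ 2 ^ (D - D / 4))
    (h : Real.exp (-((1 - δ) * ((D + 1) * Real.log 2))) ≤ theta P ^ 2 ^ (r - 1)) :
    bad (r + D) r P ≤ (((r + D : ℕ) : ℝ) + 1) ^ (r - 1) *
      (4 ^ (r + D) * Real.exp (-(1 / 4 * Real.exp (δ * (D + 1) / 2 * Real.log 2))) +
        4 ^ (r + D) * (1 / 2) ^ 2 ^ (D / 4)) := by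
  have hlog := Real.log_pos one_lt_two
  have hlog1 := Real.log_two_lt_d9
  have hlog2 : Real.log 2 ≤ 1 := by linarith
  obtain ⟨X, hX⟩ : ∃ X, X = (1 - δ) * ((D + 1) * Real.log 2) := ⟨_, rfl⟩
  have hX0 : 0 ≤ X := by rw [hX]; exact mul_nonneg (by linarith) (by positivity)
  have hX1 : X ≤ D + 1 := by
    have h1 : (D + 1 : ℝ) * Real.log 2 ≤ D + 1 := mul_le_of_le_one_right (by positivity) hlog2
    have h2 : 0 ≤ (D + 1 : ℝ) * Real.log 2 := by positivity
    rw [hX]; nlinarith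
  rw [← hX] at h
  have hroot := thetaBound_root (m := r + D) h hP
  rw [Nat.add_sub_cancel_left] at hroot
  have hz : bhat P ^ 2 ≤ X / 2 ^ (r - 1) := by
    have h1 : Real.exp (-(X / 2 ^ (r - 1))) ≤ theta P := by
      have h2 : Real.exp (-(X / 2 ^ (r - 1))) ^ 2 ^ (r - 1) ≤ theta P ^ 2 ^ (r - 1) := by
        rw [← Real.exp_nat_mul]
        refine le_trans (le_of_eq ?_) h
        congr 1; push_cast; field_simp
      exact le_of_pow_le_pow_left₀ (by positivity) hP.theta_nonneg h2
    linarith [hP.bhat_sq_le, Real.add_one_le_exp (-(X / 2 ^ (r - 1)))]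
  let Inv : ℕ → ℕ → Measure ℝ → Prop := fun m' r' P' =>
    SymLaw P' ∧ ThetaBound X D m' r' P' ∧ BhatBound (bhat P) D r m' r' P' ∧
      m' - r' ≤ D ∧ m' ≤ r + D ∧ r' ≤ r
  refine bad_le_of_frontier (Inv := Inv) (d := D / 4) (by omega) (fun m' r' P' h => h.1) ?_ ?_ ?_
    (r + D) r P ⟨hP, hroot, ?_, by omega, le_rfl, le_rfl⟩ hr (by omega)
  · rintro m' r' P' ⟨h1, h2, h3, h4, h5, h6⟩ h7 h8
    exact ⟨h1.chk, h2.chk hX0 h1 h7, h3.chk hP.bhat_nonneg h1 h6, by omega, by omega, by omega⟩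
  · rintro m' r' P' ⟨h1, h2, h3, h4, h5, h6⟩ h7 h8
    exact ⟨h1.rep, h2.rep h1 h8 h4, h3.rep h1 h8 h4, by omega, by omega, by omega⟩
  · rintro m' r' P' ⟨h1, h2, h3, h4, h5, h6⟩ h7 h8 h9
    have h4m : (4 : ℝ) ^ m' ≤ 4 ^ (r + D) := pow_le_pow_right₀ (by norm_num) h5
    by_cases hk : (2 : ℝ) ^ (r' - 1) ≤ δ * (D + 1) / 4
    · refine le_trans ?_ (le_add_of_nonneg_right (by positivity))
      refine (h1.bad_le_of_few hδ hδ1 h7 (by omega) h4 (by omega) (hX ▸ h2) hk).trans ?_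
      exact mul_le_mul_of_nonneg_right h4m (by positivity)
    · push Not at hk
      -- A leaf of order one would have 2^(r'-1) = 1 > δ(D + 1)/4, which contradicts the size of D
      -- in `hbig`.
      have hm' : m' - r' = D / 4 := by
        rcases h9 with rfl | h9
        · exfalso
          simp only [le_refl, tsub_eq_zero_of_le, pow_zero] at hk
          have : 4 * (D + 1 : ℝ) ≤ 4 * Real.exp (4 / δ) * (D + 1) := by
            have := Real.one_le_exp (show 0 ≤ 4 / δ by positivity)
            nlinarith [show (0 : ℝ) ≤ D from Nat.cast_nonneg D]
          have h10 : 4 / δ ≤ Real.exp (4 / δ) := by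
            linarith [Real.add_one_le_exp (4 / δ)]
          have h11 : (D + 1 : ℝ) < 4 / δ := by rw [lt_div_iff₀ hδ]; linarith
          have h12 : Real.exp (Real.log 2 / 8 * D) ≤ Real.exp (4 / δ) := by
            rw [Real.exp_le_exp]
            have : (0 : ℝ) ≤ D := Nat.cast_nonneg D
            nlinarith
          have h13 : (0 : ℝ) ≤ D := Nat.cast_nonneg D
          nlinarith [Real.exp_pos (4 / δ)]
        · omega
      refine le_trans ?_ (le_add_of_nonneg_left (by positivity))
      rcases le_or_gt ((r' - 1 : ℕ) : ℝ) (5 * D / 8) with hk2 | hk2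
      · refine (h1.bad_le_of_medium hδ hδ1 h7 (by omega) hm' (hX ▸ h2) hk hk2 hbig).trans ?_
        exact mul_le_mul_of_nonneg_right h4m (by positivity)
      · refine (h1.bad_le_of_many hP.bhat_nonneg h7 (by omega) h6 hm' h3 hz hX1 hs hk2
          ?_ ?_).trans ?_
        · refine le_trans ?_ hbig
          have := Real.one_le_exp (show 0 ≤ 4 / δ by positivity)
          nlinarith [show (0 : ℝ) ≤ D from Nat.cast_nonneg D]
        · refine le_trans ?_ hbig2
          have : (m' : ℝ) ≤ ((r + D : ℕ) : ℝ) := by exact_mod_cast h5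
          linarith
        · exact mul_le_mul_of_nonneg_right h4m (by positivity)
  · unfold BhatBound
    simp

/-- With r of order m the bound on the number of nodes is no longer polynomial, but exp (m²) is
harmless against doubly exponentially small errors. -/
lemma succ_pow_le_exp_sq (m k : ℕ) (hk : k ≤ m) : ((m : ℝ) + 1) ^ k ≤ Real.exp (m ^ 2) := by
  have h1 := Real.add_one_le_exp (m : ℝ)
  calc ((m : ℝ) + 1) ^ k ≤ ((m : ℝ) + 1) ^ m :=
        pow_le_pow_right₀ (by linarith [(Nat.cast_nonneg m : (0 : ℝ) ≤ m)]) hk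
    _ ≤ Real.exp m ^ m := pow_le_pow_left₀ (by positivity) h1 m
    _ = _ := by rw [← Real.exp_nat_mul]; congr 1; ring

theorem eventually_bad_le_rate {δ η : ℝ} (hδ : 0 < δ) (hδ1 : δ ≤ 1 / 4) (hη : 0 < η) :
    ∀ᶠ m : ℕ in Filter.atTop, ∀ r : ℕ, |(r : ℝ) - m / 2| ≤ m / 100 → ∀ P : Measure ℝ, SymLaw P →
      Real.exp (-((1 - δ) * ((m - r + 1 : ℕ) * Real.log 2))) ≤ theta P ^ 2 ^ (r - 1) →
      bad m r P ≤ η := by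
  have hlog := Real.log_pos one_lt_two
  have hlog1 := Real.log_two_lt_d9
  have hlog2 := Real.log_two_gt_d9
  have lim := (tendsto_succ_pow_mul_exp_neg 0 one_pos)
  filter_upwards [lim.eventually (gt_mem_nhds (show 0 < η / 2 by positivity)),
    eventually_pow_le_exp 1 (c := Real.log 2 / 8 * (49 / 100)) (by positivity)
      (4 * Real.exp (4 / δ)),
    eventually_pow_le_exp 1 (c := Real.log 2 / 3) (by positivity) 1,
    eventually_pow_le_exp 2 (c := δ * (49 / 100) / 2 * Real.log 2) (by positivity) 16,
    eventually_pow_le_exp 2 (c := Real.log 2 / 9) (by positivity) (8 * Real.exp 1),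
    Filter.eventually_ge_atTop 100] with m hm0 h1 h2 h3 h4 hm r hr P hP hθ
  have hm' : (100 : ℝ) ≤ m := by exact_mod_cast hm
  rw [abs_le] at hr
  have hrm : r ≤ m := by
    have : (r : ℝ) ≤ m := by linarith
    exact_mod_cast this
  have hr1 : 1 ≤ r := by
    have : (1 : ℝ) ≤ r := by linarith
    exact_mod_cast this
  obtain ⟨D, rfl⟩ : ∃ D, m = r + D := ⟨m - r, by omega⟩
  rw [Nat.add_sub_cancel_left] at hθ
  have hrD : ((r + D : ℕ) : ℝ) = r + D := by push_cast; ring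
  set M : ℝ := ((r + D : ℕ) : ℝ) with hM
  have hDl : 49 / 100 * M ≤ D := by linarith
  have hDu : (D : ℝ) ≤ 51 / 100 * M := by linarith
  have hD4 : 4 ≤ D := by
    have : (4 : ℝ) ≤ D := by linarith
    exact_mod_cast this
  have hrr : ((r - 1 : ℕ) : ℝ) = r - 1 := by push_cast [Nat.cast_sub hr1]; ring
  have hDq : (D : ℝ) / 4 - 3 / 4 ≤ ((D / 4 : ℕ) : ℝ) := by
    have : D ≤ 4 * (D / 4) + 3 := by omega
    have : (D : ℝ) ≤ 4 * ((D / 4 : ℕ) : ℝ) + 3 := by exact_mod_cast this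
    linarith
  have pa := mul_le_mul_of_nonneg_right hDl hlog.le
  have pb := mul_le_mul_of_nonneg_right hDq hlog.le
  have pM : 0 ≤ M * Real.log 2 := by positivity
  have pM1 : M * Real.log 2 ≤ M := mul_le_of_le_one_right (by linarith) (by linarith)
  have c1 : 4 * Real.exp (4 / δ) * (D + 1) ≤ Real.exp (Real.log 2 / 8 * D) := by
    refine le_trans ?_ (h1.trans (Real.exp_le_exp.2 (by linarith)))
    rw [pow_one]
    exact mul_le_mul_of_nonneg_left (by linarith) (by positivity)
  have c2 : M + 1 ≤ 2 ^ (D - D / 4) := by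
    rw [pow_one, one_mul] at h2
    refine h2.trans ?_
    rw [two_pow_eq_exp, Real.exp_le_exp]
    have : 3 * (D : ℝ) / 4 ≤ ((D - D / 4 : ℕ) : ℝ) := by
      have : 3 * D ≤ 4 * (D - D / 4) := by omega
      have : (3 : ℝ) * D ≤ 4 * ((D - D / 4 : ℕ) : ℝ) := by exact_mod_cast this
      linarith
    have := mul_le_mul_of_nonneg_right this hlog.le
    linarith
  have c3 : Real.exp (-((1 - δ) * ((D + 1) * Real.log 2))) ≤ theta P ^ 2 ^ (r - 1) := by
    push_cast at hθ; exact hθ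
  have key := hP.bad_le_rate hδ hδ1 hr1 hD4 (by rw [hrr]; linarith) c1 c2 c3
  have hp : (M + 1) ^ (r - 1) ≤ Real.exp (M ^ 2) := succ_pow_le_exp_sq (r + D) (r - 1) (by omega)
  have h4p : (4 : ℝ) ^ (r + D) ≤ Real.exp (2 * M) := by
    rw [four_pow_eq_exp, Real.exp_le_exp]
    linarith
  have hA : ∀ E : ℝ, M ^ 2 + 3 * M ≤ E →
      Real.exp (M ^ 2) * (Real.exp (2 * M) * Real.exp (-E)) ≤ Real.exp (-(1 * M)) := by
    intro E hE
    rw [← Real.exp_add, ← Real.exp_add, Real.exp_le_exp]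
    linarith
  have hM2 : M ^ 2 + 3 * M ≤ 4 * (M + 1) ^ 2 := by
    have : 0 ≤ M ^ 2 := sq_nonneg _
    have e : 4 * (M + 1) ^ 2 = 4 * M ^ 2 + 8 * M + 4 := by ring
    linarith
  have hE1 : M ^ 2 + 3 * M ≤ 1 / 4 * Real.exp (δ * (D + 1) / 2 * Real.log 2) := by
    have : Real.exp (δ * (49 / 100) / 2 * Real.log 2 * M) ≤
        Real.exp (δ * (D + 1) / 2 * Real.log 2) := by
      rw [Real.exp_le_exp]
      have e0 : 0 < δ * Real.log 2 := by positivity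
      have e1 := mul_le_mul_of_nonneg_left (show 49 / 100 * M ≤ D + 1 by linarith) e0.le
      linarith
    linarith
  have hE2 : M ^ 2 + 3 * M ≤ ((2 ^ (D / 4) : ℕ) : ℝ) * Real.log 2 := by
    push_cast
    rw [two_pow_eq_exp]
    have e1 : Real.exp (Real.log 2 / 9 * M) ≤
        Real.exp 1 * Real.exp (((D / 4 : ℕ) : ℝ) * Real.log 2) := by
      rw [← Real.exp_add, Real.exp_le_exp]
      linarith
    have e2 : 8 * (M + 1) ^ 2 ≤ Real.exp (((D / 4 : ℕ) : ℝ) * Real.log 2) := by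
      refine le_of_mul_le_mul_left ?_ (Real.exp_pos 1)
      linarith
    have e3 := mul_le_mul_of_nonneg_right e2 hlog.le
    have e4 := mul_le_mul_of_nonneg_left (show 1 / 2 ≤ Real.log 2 by linarith)
      (show 0 ≤ 8 * (M + 1) ^ 2 by positivity)
    linarith
  rw [half_pow_eq_exp] at key
  have k1 := hA _ hE1
  have k2 := hA _ hE2
  simp only [pow_zero, one_mul] at hm0
  rw [one_mul] at k1 k2
  refine key.trans ?_
  rw [mul_add]
  have k3 : ∀ E : ℝ, (M + 1) ^ (r - 1) * (4 ^ (r + D) * Real.exp (-E)) ≤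
      Real.exp (M ^ 2) * (Real.exp (2 * M) * Real.exp (-E)) := fun E =>
    mul_le_mul hp (mul_le_mul_of_nonneg_right h4p (Real.exp_pos _).le) (by positivity)
      (Real.exp_pos _).le
  have k4 := k3 (1 / 4 * Real.exp (δ * (D + 1) / 2 * Real.log 2))
  have k5 := k3 (((2 ^ (D / 4) : ℕ) : ℝ) * Real.log 2)
  linarith

/-! ### Converse: change of measure -/

lemma pi_eq_withDensity {ι : Type*} [Fintype ι] {ν : Measure ℝ} [IsProbabilityMeasure ν]
    {P : ι → Measure ℝ} [∀ i, IsProbabilityMeasure (P i)] {d : ι → ℝ → ℝ} {C : ℝ}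
    (hd : ∀ i, Measurable (d i)) (hd0 : ∀ i x, 0 ≤ d i x) (hdC : ∀ i x, d i x ≤ C)
    (h : ∀ i, P i = ν.withDensity fun x => ENNReal.ofReal (d i x)) :
    Measure.pi P =
      (Measure.pi fun _ : ι => ν).withDensity fun e => ENNReal.ofReal (∏ i, d i (e i)) := by
  refine Measure.pi_eq fun s hs => ?_
  have hmeas : ∀ i, Measurable ((s i).indicator (d i)) := fun i => (hd i).indicator (hs i)
  have h0 : ∀ i x, 0 ≤ (s i).indicator (d i) x := fun i x =>
    Set.indicator_nonneg (fun x _ => hd0 i x) x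
  have hint : ∀ i, Integrable ((s i).indicator (d i)) ν := fun i =>
    integrable_of_abs_le (hmeas i) |C| fun x => by
      rw [abs_of_nonneg (h0 i x)]
      unfold Set.indicator
      split_ifs
      · exact (hdC i x).trans (le_abs_self C)
      · exact abs_nonneg _
  have hP : ∀ i, P i (s i) = ENNReal.ofReal (∫ x, (s i).indicator (d i) x ∂ν) := by
    intro i
    rw [h i, withDensity_apply _ (hs i), ← lintegral_indicator (hs i),
      ofReal_integral_eq_lintegral_ofReal (hint i) (Filter.Eventually.of_forall (h0 i))]
    refine lintegral_congr fun x => ?_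
    unfold Set.indicator
    split_ifs <;> simp
  simp only [hP]
  rw [← ENNReal.ofReal_prod_of_nonneg fun i _ => integral_nonneg (h0 i),
    ← integral_fintype_prod_eq_prod,
    ofReal_integral_eq_lintegral_ofReal (Integrable.fintype_prod hint)
      (Filter.Eventually.of_forall fun e => Finset.prod_nonneg fun i _ => h0 i _),
    withDensity_apply _ (MeasurableSet.univ_pi hs),
    ← lintegral_indicator (MeasurableSet.univ_pi hs)]
  refine lintegral_congr fun e => ?_
  by_cases he : e ∈ Set.univ.pi s
  · rw [Set.indicator_of_mem he]
    congr 1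
    exact Finset.prod_congr rfl fun i _ => (Set.indicator_of_mem (he i trivial) _).symm
  · rw [Set.indicator_of_notMem he]
    have : ∃ i, e i ∉ s i := by
      by_contra! hcon
      exact he fun i _ => hcon i
    obtain ⟨i, hi⟩ := this
    rw [Finset.prod_eq_zero (Finset.mem_univ i) (Set.indicator_of_notMem hi _), ENNReal.ofReal_zero]

/-- The law of the likelihood of a uniformly random symbol. -/
def mixLaw (P : Measure ℝ) : Measure ℝ := P.withDensity fun e => ENNReal.ofReal (1 + spread e)⁻¹

lemma one_add_spread_pos (e : ℝ) : 0 < 1 + spread e := by linarith [neg_one_lt_spread e]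

lemma one_sub_spread_pos (e : ℝ) : 0 < 1 - spread e := by linarith [spread_lt_one e]

lemma one_add_bpsk_mul_spread_nonneg (b : ZMod 2) (e : ℝ) : 0 ≤ 1 + bpsk b * spread e := by
  rcases bpsk_eq b with h | h <;> rw [h]
  · linarith [one_add_spread_pos e]
  · linarith [one_sub_spread_pos e]

lemma one_add_bpsk_mul_spread_le (b : ZMod 2) (e : ℝ) : 1 + bpsk b * spread e ≤ 2 := by
  rcases bpsk_eq b with h | h <;> rw [h]
  · linarith [spread_lt_one e]
  · linarith [neg_one_lt_spread e]

section mix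

variable {P : Measure ℝ}

lemma lintegral_mixLaw {f : ℝ → ℝ≥0∞} (hf : Measurable f) :
    ∫⁻ e, f e ∂(mixLaw P) = ∫⁻ e, ENNReal.ofReal (1 + spread e)⁻¹ * f e ∂P := by
  rw [mixLaw, lintegral_withDensity_eq_lintegral_mul _ (by fun_prop) hf]
  rfl

/-- Relative to the law for a random symbol, the laws for the symbols 0 and 1 have the densities 1 +
h and 1 - h. Bounded densities are what makes second moments usable. -/
lemma SymLaw.map_bpsk (hP : SymLaw P) (b : ZMod 2) :
    P.map (fun e => bpsk b * e) =
      (mixLaw P).withDensity fun e => ENNReal.ofReal (1 + bpsk b * spread e) := by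
  refine Measure.ext_of_lintegral _ fun f hf => ?_
  rw [lintegral_map hf (by fun_prop),
    lintegral_withDensity_eq_lintegral_mul _ (by fun_prop) hf, lintegral_mixLaw (by fun_prop)]
  simp only [Pi.mul_apply, ← mul_assoc]
  rcases zmod_two_cases b with rfl | rfl
  · refine lintegral_congr fun e => ?_
    have h := one_add_spread_pos e
    rw [bpsk_zero, ← ENNReal.ofReal_mul (by positivity), one_mul, one_mul, inv_mul_cancel₀ h.ne',
      ENNReal.ofReal_one, one_mul]
  · have h := hP.flip (fun e => f e * ENNReal.ofReal (1 + spread e)⁻¹) (by fun_prop)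
    calc _ = _ := ?_
      _ = _ := h
      _ = _ := ?_
    · refine lintegral_congr fun e => ?_
      have h1 := one_sub_spread_pos e
      rw [mul_assoc, ← ENNReal.ofReal_mul (by rw [spread_neg]; positivity), spread_neg,
        ← sub_eq_add_neg, inv_mul_cancel₀ h1.ne']
      simp
    · refine lintegral_congr fun e => ?_
      rw [bpsk_one, neg_one_mul, ← sub_eq_add_neg]
      ring

lemma SymLaw.integral_mixLaw_mul (hP : SymLaw P) (b : ZMod 2) {f : ℝ → ℝ} (hf : Measurable f) :
    ∫ e, f e * (1 + bpsk b * spread e) ∂(mixLaw P) = ∫ e, f (bpsk b * e) ∂P := by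
  rw [← integral_map (φ := fun e => bpsk b * e) (by fun_prop) hf.aestronglyMeasurable,
    hP.map_bpsk b, integral_withDensity_eq_integral_toReal_smul (by fun_prop) (by simp)]
  refine integral_congr_ae (Filter.Eventually.of_forall fun e => ?_)
  simp [ENNReal.toReal_ofReal (one_add_bpsk_mul_spread_nonneg b e), mul_comm]

lemma SymLaw.isProbabilityMeasure_mixLaw (hP : SymLaw P) : IsProbabilityMeasure (mixLaw P) := by
  have := hP.prob
  have h : ∀ b : ZMod 2,
      ∫⁻ e, ENNReal.ofReal (1 + bpsk b * spread e) ∂(mixLaw P) = 1 := by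
    intro b
    have h1 : (P.map fun e => bpsk b * e) Set.univ = 1 := by
      rw [Measure.map_apply (by fun_prop) MeasurableSet.univ]; simp
    rw [hP.map_bpsk b, withDensity_apply _ MeasurableSet.univ, Measure.restrict_univ] at h1
    exact h1
  constructor
  have h2 : ∫⁻ e, ENNReal.ofReal (1 + bpsk 0 * spread e) +
      ENNReal.ofReal (1 + bpsk 1 * spread e) ∂(mixLaw P) = 2 := by
    rw [lintegral_add_left (by fun_prop), h, h]; norm_num
  have h3 : ∀ e, ENNReal.ofReal (1 + bpsk 0 * spread e) +
      ENNReal.ofReal (1 + bpsk 1 * spread e) = 2 := by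
    intro e
    rw [← ENNReal.ofReal_add (one_add_bpsk_mul_spread_nonneg 0 e)
      (one_add_bpsk_mul_spread_nonneg 1 e)]
    rw [bpsk_zero, bpsk_one, show (1 + 1 * spread e + (1 + -1 * spread e)) = 2 by ring]
    simp
  simp only [h3, lintegral_const] at h2
  have h4 : (2 : ℝ≥0∞) * mixLaw P Set.univ = 2 * 1 := by rw [h2, mul_one]
  exact (ENNReal.mul_right_inj (by norm_num) (by norm_num)).1 h4

lemma SymLaw.integral_mixLaw_mul_mul (hP : SymLaw P) (a b : ZMod 2) :
    ∫ e, (1 + bpsk a * spread e) * (1 + bpsk b * spread e) ∂(mixLaw P) =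
      1 + bpsk a * bpsk b * theta P := by
  have := hP.prob
  rw [hP.integral_mixLaw_mul b (f := fun e => 1 + bpsk a * spread e) (by fun_prop)]
  simp only [spread_bpsk_mul]
  have i1 : Integrable (fun e => spread e) P := by simpa using hP.integrable_pow 1
  rw [integral_add (integrable_const _) ((i1.const_mul _).const_mul _), integral_const_mul,
    integral_const_mul, hP.integral_spread]
  simp [mul_assoc]

end mix

/-- The density of the law of the likelihoods when the codeword `z` is transmitted, with respect to
the law for uniformly random symbols. -/
def density {ι : Type*} [Fintype ι] (z : ι → ZMod 2) (e : ι → ℝ) : ℝ :=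
  ∏ i, (1 + bpsk (z i) * spread (e i))

section density

variable {P : Measure ℝ} {ι : Type*} [Fintype ι]

lemma density_nonneg (z : ι → ZMod 2) (e : ι → ℝ) : 0 ≤ density z e :=
  Finset.prod_nonneg fun _ _ => one_add_bpsk_mul_spread_nonneg _ _

lemma density_le (z : ι → ZMod 2) (e : ι → ℝ) : density z e ≤ 2 ^ Fintype.card ι := by
  rw [← Finset.card_univ, ← Finset.prod_const]
  exact Finset.prod_le_prod (fun i _ => one_add_bpsk_mul_spread_nonneg _ _)
    fun i _ => one_add_bpsk_mul_spread_le _ _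

lemma measurable_density (z : ι → ZMod 2) : Measurable (density z) := by
  unfold density; fun_prop

lemma SymLaw.pi_map_bpsk (hP : SymLaw P) (z : ι → ZMod 2) :
    (Measure.pi fun _ : ι => P).map (fun e i => bpsk (z i) * e i) =
      (Measure.pi fun _ : ι => mixLaw P).withDensity fun e => ENNReal.ofReal (density z e) := by
  have := hP.prob
  have := hP.isProbabilityMeasure_mixLaw
  have : ∀ i, IsProbabilityMeasure (P.map fun e => bpsk (z i) * e) := fun i =>
    Measure.isProbabilityMeasure_map (by fun_prop)
  rw [Measure.pi_map_pi (f := fun i e => bpsk (z i) * e) fun i => by fun_prop]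
  exact pi_eq_withDensity (d := fun i e => 1 + bpsk (z i) * spread e) (C := 2)
    (fun i => by fun_prop) (fun i x => one_add_bpsk_mul_spread_nonneg _ _)
    (fun i x => one_add_bpsk_mul_spread_le _ _) fun i => hP.map_bpsk (z i)

lemma SymLaw.setIntegral_density (hP : SymLaw P) (z : ι → ZMod 2) {A : Set (ι → ℝ)}
    (hA : MeasurableSet A) :
    ∫ e in A, density z e ∂(Measure.pi fun _ : ι => mixLaw P) =
      (Measure.pi fun _ : ι => P).real {e | (fun i => bpsk (z i) * e i) ∈ A} := by
  have h := Measure.map_apply (μ := Measure.pi fun _ : ι => P)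
    (f := fun e i => bpsk (z i) * e i) (by fun_prop) hA
  rw [hP.pi_map_bpsk z, withDensity_apply _ hA] at h
  rw [integral_eq_lintegral_of_nonneg_ae
    (Filter.Eventually.of_forall fun e => density_nonneg z e)
    (measurable_density z).aestronglyMeasurable, h]
  rfl

lemma SymLaw.integral_density_mul (hP : SymLaw P) (z z' : ι → ZMod 2) :
    ∫ e, density z e * density z' e ∂(Measure.pi fun _ : ι => mixLaw P) =
      ∏ i, (1 + bpsk (z i) * bpsk (z' i) * theta P) := by
  have := hP.isProbabilityMeasure_mixLaw
  simp only [density, ← Finset.prod_mul_distrib]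
  rw [integral_fintype_prod_eq_prod
    (fun i x => (1 + bpsk (z i) * spread x) * (1 + bpsk (z' i) * spread x))]
  exact Finset.prod_congr rfl fun i _ => hP.integral_mixLaw_mul_mul _ _

/-- The correlation factors as ∏ (1 ± θ), which is at most exp (θ ∑ ±1). Hence words at distance at
least half the length are not positively correlated. -/
lemma SymLaw.integral_density_mul_le (hP : SymLaw P) (z z' : ι → ZMod 2)
    (h : ∑ i, bpsk (z i) * bpsk (z' i) ≤ 0) :
    ∫ e, density z e * density z' e ∂(Measure.pi fun _ : ι => mixLaw P) ≤ 1 := by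
  rw [hP.integral_density_mul]
  have h0 := hP.theta_nonneg
  have h1 := hP.theta_le_one
  calc _ ≤ ∏ i, Real.exp (bpsk (z i) * bpsk (z' i) * theta P) := by
        refine Finset.prod_le_prod (fun i _ => ?_) fun i _ => ?_
        · rcases bpsk_eq (z i) with h | h <;> rcases bpsk_eq (z' i) with h' | h' <;>
            rw [h, h'] <;> linarith
        · linarith [Real.add_one_le_exp (bpsk (z i) * bpsk (z' i) * theta P)]
    _ = Real.exp ((∑ i, bpsk (z i) * bpsk (z' i)) * theta P) := by
        rw [← Real.exp_sum, Finset.sum_mul]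
    _ ≤ 1 := by
        rw [Real.exp_le_one_iff]
        exact mul_nonpos_of_nonpos_of_nonneg h h0

end density

/-! ### Converse: the truncated second moment -/

section secondMoment

variable {Ω : Type*} [MeasurableSpace Ω] {N : Measure Ω} [IsProbabilityMeasure N]

lemma integral_abs_le_sqrt {f : Ω → ℝ} (hf : Measurable f) {C : ℝ} (hC : ∀ x, |f x| ≤ C) :
    ∫ x, |f x| ∂N ≤ Real.sqrt (∫ x, f x ^ 2 ∂N) := by
  have i1 : Integrable (fun x => |f x|) N := integrable_of_abs_le (by fun_prop) C (by simpa using hC)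
  have i2 : Integrable (fun x => f x ^ 2) N := integrable_of_abs_le (by fun_prop) (C ^ 2) fun x => by
    rw [abs_pow]; exact pow_le_pow_left₀ (abs_nonneg _) (hC x) 2
  refine Real.le_sqrt_of_sq_le ?_
  have h : ∫ x, 2 * (∫ y, |f y| ∂N) * |f x| ∂N ≤ ∫ x, (f x ^ 2 + (∫ y, |f y| ∂N) ^ 2) ∂N := by
    refine integral_mono (i1.const_mul _) (i2.add (integrable_const _)) fun x => ?_
    have := sq_nonneg (|f x| - ∫ y, |f y| ∂N)
    simp only
    rw [← sq_abs (f x)]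
    linarith
  rw [integral_const_mul, integral_add i2 (integrable_const _)] at h
  simp at h
  nlinarith

/-- Soft covering. The densities are cut off where they exceed T, at the cost η; the average X of
the truncated ones has mean at least 1 - η and second moment at most 1 + T/M. Hence E |X - 1| ≤
√(T/M + 2η), and the average of the laws nearly has the reference probability of A. Without
truncation the diagonal of the second moment would be too large. -/
lemma setIntegral_average_le {W : Type*} [Fintype W] [Nonempty W] [DecidableEq W] {L : W → Ω → ℝ}
    (hL : ∀ w, Measurable (L w)) (hL0 : ∀ w x, 0 ≤ L w x) {C : ℝ} (hLC : ∀ w x, L w x ≤ C)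
    (h1 : ∀ w, ∫ x, L w x ∂N = 1) (h2 : ∀ w w', w ≠ w' → ∫ x, L w x * L w' x ∂N ≤ 1)
    {T η : ℝ} (hT : 0 ≤ T) (hη : ∀ w, ∫ x in {x | T < L w x}, L w x ∂N ≤ η)
    (A : Set Ω) :
    (∑ w, ∫ x in A, L w x ∂N) / Fintype.card W ≤
      N.real A + η + Real.sqrt (T / Fintype.card W + 2 * η) := by
  set M : ℝ := (Fintype.card W : ℝ) with hM
  have hMpos : 0 < M := Nat.cast_pos.2 Fintype.card_pos
  set K : W → Ω → ℝ := fun w => {x | T < L w x}ᶜ.indicator (L w) with hK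
  have hset : ∀ w, MeasurableSet {x | T < L w x} := fun w => measurableSet_lt (by fun_prop) (hL w)
  have hKm : ∀ w, Measurable (K w) := fun w => (hL w).indicator (hset w).compl
  have hK0 : ∀ w x, 0 ≤ K w x := fun w x => Set.indicator_nonneg (fun x _ => hL0 w x) x
  have hKL : ∀ w x, K w x ≤ L w x := fun w x => Set.indicator_le_self' (fun x _ => hL0 w x) x
  have hKT : ∀ w x, K w x ≤ T := by
    intro w x
    by_cases hx : T < L w x
    · simp only [hK]; rw [Set.indicator_of_notMem (by simpa using hx)]; exact hT
    · exact (hKL w x).trans (not_lt.1 hx)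
  have iL : ∀ w, Integrable (L w) N := fun w => integrable_of_abs_le (hL w) C fun x => by
    rw [abs_of_nonneg (hL0 w x)]; exact hLC w x
  have iK : ∀ w, Integrable (K w) N := fun w => (iL w).indicator (hset w).compl
  have iKK : ∀ w w', Integrable (fun x => K w x * K w' x) N := fun w w' =>
    integrable_of_abs_le ((hKm w).mul (hKm w')) (T * T) fun x => by
      rw [abs_of_nonneg (mul_nonneg (hK0 w x) (hK0 w' x))]
      exact mul_le_mul (hKT w x) (hKT w' x) (hK0 w' x) hT
  have hKint : ∀ w, 1 - η ≤ ∫ x, K w x ∂N := by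
    intro w
    have := integral_add_compl (hset w) (iL w)
    rw [h1, ← integral_indicator (hset w).compl] at this
    have h3 := hη w
    simp only [hK]; linarith
  have hKint1 : ∀ w, ∫ x, K w x ∂N ≤ 1 := fun w =>
    (integral_mono (iK w) (iL w) (hKL w)).trans (h1 w).le
  have hAK : ∀ w, ∫ x in A, L w x ∂N ≤ ∫ x in A, K w x ∂N + η := by
    intro w
    have hs := hKint w
    have h3 : ∫ x in A, (L w x - K w x) ∂N ≤ ∫ x, (L w x - K w x) ∂N :=
      setIntegral_le_integral ((iL w).sub (iK w))
        (Filter.Eventually.of_forall fun x => sub_nonneg.2 (hKL w x))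
    rw [integral_sub (iL w).integrableOn (iK w).integrableOn, integral_sub (iL w) (iK w), h1] at h3
    linarith
  set X : Ω → ℝ := fun x => (∑ w, K w x) / M with hX
  have hXm : Measurable X := (Finset.measurable_sum _ fun w _ => hKm w).div_const _
  have hX0 : ∀ x, 0 ≤ X x := fun x => div_nonneg (Finset.sum_nonneg fun w _ => hK0 w x) hMpos.le
  have hXT : ∀ x, X x ≤ T := by
    intro x
    rw [hX]; simp only
    rw [div_le_iff₀ hMpos]
    calc ∑ w, K w x ≤ ∑ _w : W, T := Finset.sum_le_sum fun w _ => hKT w x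
      _ = T * M := by rw [Finset.sum_const, Finset.card_univ, nsmul_eq_mul, mul_comm]
  have iX : Integrable X N := (integrable_finsetSum _ fun w _ => iK w).div_const _
  have hXint : 1 - η ≤ ∫ x, X x ∂N := by
    rw [hX, integral_div, integral_finsetSum _ fun w _ => iK w, le_div_iff₀ hMpos]
    calc (1 - η) * M = ∑ _w : W, (1 - η) := by
          rw [Finset.sum_const, Finset.card_univ, nsmul_eq_mul, mul_comm]
      _ ≤ _ := Finset.sum_le_sum fun w _ => hKint w
  have iX2 : Integrable (fun x => X x ^ 2) N := integrable_of_abs_le (by fun_prop) (T ^ 2) fun x => by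
    rw [abs_of_nonneg (sq_nonneg _)]; exact pow_le_pow_left₀ (hX0 x) (hXT x) 2
  -- Each diagonal term is at most T; each other term at most 1, by the pairwise hypothesis.
  have hX2 : ∫ x, X x ^ 2 ∂N ≤ T / M + 1 := by
    have e1 : ∀ x, X x ^ 2 = (∑ w, ∑ w', K w x * K w' x) / M ^ 2 := by
      intro x
      rw [hX]; simp only
      rw [div_pow, sq (∑ w, K w x), Finset.sum_mul_sum]
    simp only [e1]
    rw [integral_div, integral_finsetSum _ fun w _ => integrable_finsetSum _ fun w' _ => iKK w w']
    have e2 : ∀ w, ∫ x, ∑ w', K w x * K w' x ∂N ≤ T + M := by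
      intro w
      rw [integral_finsetSum _ fun w' _ => iKK w w',
        ← Finset.add_sum_erase _ _ (Finset.mem_univ w)]
      refine add_le_add ?_ ?_
      · calc ∫ x, K w x * K w x ∂N ≤ ∫ x, T * K w x ∂N :=
              integral_mono (iKK w w) ((iK w).const_mul T) fun x =>
                mul_le_mul_of_nonneg_right (hKT w x) (hK0 w x)
          _ ≤ T := by
            rw [integral_const_mul]
            exact mul_le_of_le_one_right hT (hKint1 w)
      · calc ∑ w' ∈ Finset.univ.erase w, ∫ x, K w x * K w' x ∂N
            ≤ ∑ _w' ∈ Finset.univ.erase w, (1 : ℝ) := by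
              refine Finset.sum_le_sum fun w' hw' => ?_
              refine le_trans (integral_mono (iKK w w') ?_ fun x => ?_)
                (h2 w w' (Finset.ne_of_mem_erase hw').symm)
              · refine integrable_of_abs_le ((hL w).mul (hL w')) (C * C) fun x => ?_
                rw [abs_of_nonneg (mul_nonneg (hL0 w x) (hL0 w' x))]
                exact mul_le_mul (hLC w x) (hLC w' x) (hL0 w' x) ((hL0 w x).trans (hLC w x))
              · exact mul_le_mul (hKL w x) (hKL w' x) (hK0 w' x) (hL0 w x)
          _ ≤ M := by
            rw [Finset.sum_const, nsmul_eq_mul, mul_one, hM]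
            exact_mod_cast (Finset.card_le_univ _)
    rw [div_le_iff₀ (by positivity)]
    calc _ ≤ ∑ _w : W, (T + M) := Finset.sum_le_sum fun w _ => e2 w
      _ = M * (T + M) := by rw [Finset.sum_const, Finset.card_univ, nsmul_eq_mul]
      _ = _ := by field_simp
  have iX1 : Integrable (fun x => X x - 1) N := iX.sub (integrable_const _)
  have hvar : ∫ x, (X x - 1) ^ 2 ∂N ≤ T / M + 2 * η := by
    have e1 : ∀ x, (X x - 1) ^ 2 = (X x ^ 2 - 2 * X x) + 1 := fun x => by ring
    simp only [e1]
    have i3 : Integrable (fun x => X x ^ 2 - 2 * X x) N := iX2.sub (iX.const_mul 2)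
    rw [integral_add i3 (integrable_const _), integral_sub iX2 (iX.const_mul 2),
      integral_const_mul]
    simp
    linarith
  have hfin : ∫ x in A, X x ∂N ≤ N.real A + Real.sqrt (T / M + 2 * η) := by
    have e1 : ∫ x in A, (X x - 1) ∂N ≤ ∫ x, |X x - 1| ∂N :=
      (integral_mono iX1.integrableOn iX1.abs.integrableOn fun x => le_abs_self _).trans
        (setIntegral_le_integral iX1.abs (Filter.Eventually.of_forall fun x => abs_nonneg _))
    rw [integral_sub iX.integrableOn (integrable_const _).integrableOn] at e1
    have e2 := integral_abs_le_sqrt (N := N) (f := fun x => X x - 1) (hXm.sub_const 1)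
      (C := T + 1) fun x => by
        rw [abs_le]; constructor <;> linarith [hX0 x, hXT x]
    have e3 := Real.sqrt_le_sqrt hvar
    simp at e1
    linarith
  calc (∑ w, ∫ x in A, L w x ∂N) / M ≤ (∑ w, (∫ x in A, K w x ∂N + η)) / M :=
        div_le_div_of_nonneg_right (Finset.sum_le_sum fun w _ => hAK w) hMpos.le
    _ = ∫ x in A, X x ∂N + η := by
        rw [hX, integral_div, integral_finsetSum _ fun w _ => (iK w).integrableOn,
          Finset.sum_add_distrib, Finset.sum_const, Finset.card_univ, nsmul_eq_mul, ← hM]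
        field_simp
    _ ≤ _ := by linarith

end secondMoment

/-! ### Converse: information bits at the code of order one -/

/-- The probability that the information bit `S` of a uniformly random information block is decoded
correctly, where the likelihoods for the symbol `0` are independent with the law `P`. -/
def corr (m r : ℕ) (P : Measure ℝ) (S : Finset (Fin m)) : ℝ :=
  (∑ w : InfoBlock m r, (Measure.pi fun _ : Cube m => P).real
    {e | recDecode m r (fun x => bpsk (encode w.1 x) * e x) S = w.1 S}) /
    Fintype.card (InfoBlock m r)

/-- Information blocks are pairs of information blocks for the two parts of the Plotkin
construction. -/
def infoBlockEquiv (m r : ℕ) :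
    InfoBlock (m + 1) (r + 1) ≃ InfoBlock m (r + 1) × InfoBlock m r where
  toFun w := (w.u, w.v)
  invFun p := ⟨plotkin p.1.1 p.2.1, fun S hS => by
    obtain ⟨T, rfl | rfl⟩ : ∃ T : Finset (Fin m), S = T.map (Fin.succEmb m) ∨
        S = insert 0 (T.map (Fin.succEmb m)) := by
      refine ⟨Finset.univ.filter fun i => i.succ ∈ S, ?_⟩
      by_cases h : 0 ∈ S
      · right; ext i; refine Fin.cases (by simp [h]) (fun j => by simp [Fin.succ_ne_zero]) i
      · left; ext i; refine Fin.cases (by simp [h]) (fun j => by simp) i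
    · rw [plotkin_map]; exact p.1.2 _ (by simpa using hS)
    · rw [plotkin_insert]; exact p.2.2 _ (by rw [card_insert_map] at hS; omega)⟩
  left_inv w := Subtype.ext (plotkin_parts w.1)
  right_inv p := by
    refine Prod.ext (Subtype.ext ?_) (Subtype.ext ?_)
    · funext T; exact plotkin_map _ _ T
    · funext T; exact plotkin_insert _ _ T

instance (m r : ℕ) : Nonempty (InfoBlock m r) := ⟨⟨0, fun _ _ => rfl⟩⟩

lemma average_v (m r : ℕ) (F : InfoBlock m r → ℝ) :
    (∑ w : InfoBlock (m + 1) (r + 1), F w.v) / Fintype.card (InfoBlock (m + 1) (r + 1)) =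
      (∑ w, F w) / Fintype.card (InfoBlock m r) := by
  have h1 : ∑ w : InfoBlock (m + 1) (r + 1), F w.v =
      Fintype.card (InfoBlock m (r + 1)) * ∑ w, F w := by
    rw [← (infoBlockEquiv m r).symm.sum_comp, Fintype.sum_prod_type]
    have : ∀ u v, F ((infoBlockEquiv m r).symm (u, v)).v = F v := by
      intro u v
      exact congrArg (fun p => F p.2) ((infoBlockEquiv m r).apply_symm_apply (u, v))
    simp only [this, Finset.sum_const, Finset.card_univ, nsmul_eq_mul]
  rw [h1, Fintype.card_congr (infoBlockEquiv m r), Fintype.card_prod, Nat.cast_mul]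
  have : (0 : ℝ) < Fintype.card (InfoBlock m (r + 1)) := Nat.cast_pos.2 Fintype.card_pos
  rw [mul_div_mul_left _ _ this.ne']

lemma measureReal_recDecode_insert_le {m r : ℕ} (hr : 1 ≤ r) (hm : r + 3 ≤ m + 1) (P : Measure ℝ)
    [IsProbabilityMeasure P] (S : Finset (Fin m)) (w : InfoBlock (m + 1) (r + 1)) :
    (Measure.pi fun _ : Cube (m + 1) => P).real
      {e | recDecode (m + 1) (r + 1) (fun x => bpsk (encode w.1 x) * e x)
        (insert 0 (S.map (Fin.succEmb m))) = w.1 (insert 0 (S.map (Fin.succEmb m)))} ≤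
    (Measure.pi fun _ : Cube m => chk P).real
      {e | recDecode m r (fun x => bpsk (encode w.v.1 x) * e x) S = w.v.1 S} := by
  have h1 := measureReal_preimage_le (μ := Measure.pi fun _ : Cube (m + 1) => P)
    (f := fun e x => (fun p : ℝ × ℝ => likelihood (spread p.1 * spread p.2))
      (e (Fin.cons 0 x : Cube (m + 1)), e (Fin.cons 1 x : Cube (m + 1)))) (by fun_prop)
    {e : Cube m → ℝ | recDecode m r (fun x => bpsk (encode w.v.1 x) * e x) S = w.v.1 S}
  rw [pi_map_pairs m P measurable_chk] at h1
  refine le_trans (measureReal_mono (fun e he => ?_) (measure_ne_top _ _)) h1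
  simp only [Set.mem_preimage, Set.mem_ofPred_eq] at he ⊢
  rw [recDecode, if_pos ⟨by omega, by omega⟩] at he
  simp only [plotkin_insert, Nat.add_sub_cancel, likelihood_mul_encode] at he
  exact he

/-- The bits of v are decoded before those of u, from the products alone, and a uniformly random
block has a uniformly random v-part. -/
lemma corr_succ_le {m r : ℕ} (hr : 1 ≤ r) (hm : r + 3 ≤ m + 1) (P : Measure ℝ)
    [IsProbabilityMeasure P] (S : Finset (Fin m)) :
    corr (m + 1) (r + 1) P (insert 0 (S.map (Fin.succEmb m))) ≤ corr m r (chk P) S := by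
  refine le_trans ?_ (average_v m r fun w => (Measure.pi fun _ : Cube m => chk P).real
    {e | recDecode m r (fun x => bpsk (encode w.1 x) * e x) S = w.1 S}).le
  exact div_le_div_of_nonneg_right (Finset.sum_le_sum fun w _ =>
    measureReal_recDecode_insert_le hr hm P S w) (Nat.cast_nonneg _)

/-- The information bit that is decoded first. -/
def firstBit : (r m : ℕ) → Finset (Fin m)
  | 0, _ => ∅
  | _ + 1, 0 => ∅
  | r + 1, m + 1 => insert 0 ((firstBit r m).map (Fin.succEmb m))

lemma card_firstBit_le : ∀ r m : ℕ, (firstBit r m).card ≤ r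
  | 0, _ => by simp [firstBit]
  | _ + 1, 0 => by simp [firstBit]
  | r + 1, m + 1 => by
    rw [firstBit, card_insert_map]
    exact Nat.add_le_add_right (card_firstBit_le r m) 1

/-- Along the path of products alone no earlier decision intervenes and both moments are squared
exactly, so the converse for the code of order one transfers without loss. -/
lemma SymLaw.corr_firstBit_le {α : ℝ} {n : ℕ} (hn : 3 ≤ n) {c : ℝ}
    (h : ∀ P, SymLaw P → 2 ^ n * (theta P / 2 + kappa P / 3) ≤ c → corr n 1 P ∅ ≤ α) :
    ∀ (r : ℕ) (P : Measure ℝ), SymLaw P →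
      2 ^ n * (theta P ^ 2 ^ r / 2 + kappa P ^ 2 ^ r / 3) ≤ c →
      corr (n + r) (r + 1) P (firstBit r (n + r)) ≤ α
  | 0, P, hP, hc => h P hP (by simpa using hc)
  | r + 1, P, hP, hc => by
    have := hP.prob
    refine (corr_succ_le (m := n + r) (by omega) (by omega) P _).trans
      (SymLaw.corr_firstBit_le hn h r _ hP.chk ?_)
    rwa [hP.theta_chk, hP.kappa_chk, ← pow_mul, ← pow_mul, ← pow_succ']

/-! ### Converse: maximum likelihood decoding of the code of order one -/

lemma measurable_mlCost {m : ℕ} (z : Cube m → ZMod 2) : Measurable fun g => mlCost g z := by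
  unfold mlCost
  refine Finset.measurable_sum _ fun x _ => ?_
  have hd : Measurable fun g : Cube m → ℝ => hardDecision (g x) := by
    unfold hardDecision
    exact Measurable.ite (measurableSet_le measurable_const (by fun_prop)) measurable_const
      measurable_const
  refine Measurable.ite ?_ (by fun_prop) measurable_const
  exact (hd (measurableSet_singleton (z x))).compl.congr (by ext g; simp [eq_comm])

lemma choose_congr {α : Type*} {p q : α → Prop} (h : p = q) (hp : ∃ x, p x) (hq : ∃ x, q x) :
    Classical.choose hp = Classical.choose hq := by
  subst h; rfl

/-- The choice among minimizers is made from the predicate "is a minimizer", so equal sets of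
minimizers give equal choices. There are finitely many such sets, which makes the decision regions
measurable. -/
lemma mlDecode_congr {m r : ℕ} {g g' : Cube m → ℝ}
    (h : ∀ w : InfoBlock m r, (∀ w' : InfoBlock m r, mlCost g (encode w.1) ≤ mlCost g (encode w'.1)) ↔
      ∀ w' : InfoBlock m r, mlCost g' (encode w.1) ≤ mlCost g' (encode w'.1)) :
    mlDecode m r g = mlDecode m r g' := by
  exact choose_congr (funext fun w => propext (h w)) _ _

lemma measurableSet_mlDecode {m r : ℕ} (p : InfoBlock m r → Prop) :
    MeasurableSet {g | p (mlDecode m r g)} := by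
  classical
  let B : (Cube m → ℝ) → Set (InfoBlock m r) := fun g =>
    {w | ∀ w' : InfoBlock m r, mlCost g (encode w.1) ≤ mlCost g (encode w'.1)}
  have hB : ∀ w : InfoBlock m r, MeasurableSet {g | w ∈ B g} := fun w => by
    have : {g | w ∈ B g} = ⋂ w' : InfoBlock m r,
        {g | mlCost g (encode w.1) ≤ mlCost g (encode w'.1)} := by
      ext g; simp [B]
    rw [this]
    exact MeasurableSet.iInter fun w' =>
      measurableSet_le (measurable_mlCost _) (measurable_mlCost _)
  have hBS : ∀ S : Set (InfoBlock m r), MeasurableSet {g | B g = S} := fun S => by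
    have : {g | B g = S} = ⋂ w : InfoBlock m r, {g | w ∈ B g ↔ w ∈ S} := by
      ext g; simp [Set.ext_iff]
    rw [this]
    refine MeasurableSet.iInter fun w => ?_
    by_cases hw : w ∈ S
    · simpa [hw] using hB w
    · convert (hB w).compl using 1
      ext g; simp [hw]
  have : {g | p (mlDecode m r g)} = ⋃ S ∈ {S | ∃ g, B g = S ∧ p (mlDecode m r g)},
      {g | B g = S} := by
    ext g
    simp only [Set.mem_iUnion, Set.mem_ofPred_eq, exists_prop]
    constructor
    · intro hg; exact ⟨B g, ⟨g, rfl, hg⟩, rfl⟩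
    · rintro ⟨S, ⟨g', hg', hp⟩, hg⟩
      rwa [mlDecode_congr (g := g) (g' := g') fun w => by
        rw [← hg'] at hg; exact Set.ext_iff.1 hg w]
  rw [this]
  exact MeasurableSet.biUnion (Set.to_countable _) fun S _ => hBS S

/-- The codewords of the code of order one are affine functions. -/
def affineBlock (m : ℕ) (p : ZMod 2 × (Fin m → ZMod 2)) : InfoBlock m 1 :=
  ⟨fun S => if S.card = 0 then p.1 else if S.card ≤ 1 then ∑ i ∈ S, p.2 i else 0,
    fun S hS => by simp only; rw [if_neg (by omega), if_neg (by omega)]⟩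

lemma affineBlock_empty (m : ℕ) (p : ZMod 2 × (Fin m → ZMod 2)) : (affineBlock m p).1 ∅ = p.1 := by
  simp [affineBlock]

lemma affineBlock_bijective (m : ℕ) : Function.Bijective (affineBlock m) := by
  constructor
  · intro p q h
    have h1 : ∀ S, (affineBlock m p).1 S = (affineBlock m q).1 S := fun S => by rw [h]
    refine Prod.ext (by simpa [affineBlock] using h1 ∅) (funext fun i => ?_)
    simpa [affineBlock] using h1 {i}
  · intro w
    refine ⟨(w.1 ∅, fun i => w.1 {i}), Subtype.ext (funext fun S => ?_)⟩
    simp only [affineBlock]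
    split_ifs with h1 h2
    · rw [Finset.card_eq_zero.1 h1]
    · obtain ⟨i, rfl⟩ := Finset.card_eq_one.1 (show S.card = 1 by omega)
      simp
    · rw [w.2 S (by omega)]

lemma sum_infoBlock_one (m : ℕ) (F : InfoBlock m 1 → ℝ) :
    (∑ w, F w) / Fintype.card (InfoBlock m 1) =
      ((∑ f, F (affineBlock m (0, f))) / Fintype.card (Fin m → ZMod 2) +
        (∑ f, F (affineBlock m (1, f))) / Fintype.card (Fin m → ZMod 2)) / 2 := by
  rw [← Fintype.card_congr (Equiv.ofBijective _ (affineBlock_bijective m)),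
    ← (Equiv.ofBijective _ (affineBlock_bijective m)).sum_comp, Fintype.sum_prod_type,
    Fintype.card_prod, ZMod.card]
  have : ∑ x : ZMod 2, ∑ y, F ((Equiv.ofBijective _ (affineBlock_bijective m)) (x, y)) =
      ∑ f, F (affineBlock m (0, f)) + ∑ f, F (affineBlock m (1, f)) :=
    Fin.sum_univ_two (fun x : ZMod 2 => ∑ y, F (affineBlock m (x, y)))
  rw [this]
  push_cast
  have h : (0 : ℝ) < 2 ^ m := by positivity
  simp
  field_simp

/-- The probability that the density of the transmitted codeword exceeds `T`. -/
def densityTail (m : ℕ) (P : Measure ℝ) (T : ℝ) : ℝ :=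
  (Measure.pi fun _ : Cube m => P).real {e | T < ∏ x, (1 + spread (e x))}

/-- For each value b of the constant coefficient, the 2^m words with that coefficient satisfy the
hypotheses of `setIntegral_average_le`. So the probability of deciding b when b is sent is close to
that under the reference measure. The latter probabilities add up to 1 over the two values of b,
hence the 1/2. -/
lemma SymLaw.corr_one_le {P : Measure ℝ} (hP : SymLaw P) {m : ℕ} {T : ℝ} (hT : 0 ≤ T) :
    corr m 1 P ∅ ≤
      1 / 2 + densityTail m P T + Real.sqrt (T / 2 ^ m + 2 * densityTail m P T) := by
  classical
  have := hP.prob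
  have := hP.isProbabilityMeasure_mixLaw
  set N := Measure.pi fun _ : Cube m => mixLaw P with hN
  have hdec : ∀ g : Cube m → ℝ, recDecode m 1 g = (mlDecode m 1 g).1 := by
    intro g
    cases m with
    | zero => rw [recDecode]
    | succ m => rw [recDecode, if_neg (by omega)]
  have hA : ∀ b : ZMod 2, MeasurableSet {g : Cube m → ℝ | (mlDecode m 1 g).1 ∅ = b} := fun b =>
    measurableSet_mlDecode fun w => w.1 ∅ = b
  have hcard : (Fintype.card (Fin m → ZMod 2) : ℝ) = 2 ^ m := by simp [ZMod.card]
  have key : ∀ b : ZMod 2, (∑ f, (Measure.pi fun _ : Cube m => P).real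
      {e | recDecode m 1 (fun x => bpsk (encode (affineBlock m (b, f)).1 x) * e x) ∅ =
        (affineBlock m (b, f)).1 ∅}) / Fintype.card (Fin m → ZMod 2) ≤
      N.real {g | (mlDecode m 1 g).1 ∅ = b} + densityTail m P T +
        Real.sqrt (T / 2 ^ m + 2 * densityTail m P T) := by
    intro b
    have h1 : ∀ f, (Measure.pi fun _ : Cube m => P).real
        {e | recDecode m 1 (fun x => bpsk (encode (affineBlock m (b, f)).1 x) * e x) ∅ =
          (affineBlock m (b, f)).1 ∅} =
        ∫ e in {g | (mlDecode m 1 g).1 ∅ = b}, density (encode (affineBlock m (b, f)).1) e ∂N := by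
      intro f
      rw [hN, hP.setIntegral_density _ (hA b)]
      simp only [hdec, affineBlock_empty, Set.mem_ofPred_eq]
    simp only [h1]
    rw [← hcard]
    refine setIntegral_average_le (fun f => measurable_density _) (fun f => density_nonneg _)
      (fun f => density_le _) (fun f => ?_) (fun f f' hf => ?_) hT (fun f => ?_) _
    · have := hP.setIntegral_density (encode (affineBlock m (b, f)).1) MeasurableSet.univ
      rw [Measure.restrict_univ] at this
      rw [hN, this]; simp
    -- Two words with different linear parts differ by a nonzero affine function, whose signs have
    -- nonpositive sum.
    · refine hP.integral_density_mul_le _ _ ?_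
      have h2 := sum_bpsk_encode_le (⟨(affineBlock m (b, f)).1 - (affineBlock m (b, f')).1,
        fun S hS => by
          simp [(affineBlock m (b, f)).2 S hS, (affineBlock m (b, f')).2 S hS]⟩ : InfoBlock m 1)
        (fun h => hf (by
          have h3 := (affineBlock_bijective m).1 (Subtype.ext (sub_eq_zero.1 h))
          exact (Prod.ext_iff.1 h3).2))
      simp only [encode_sub] at h2
      convert h2 using 2 with x
      rw [CharTwo.sub_eq_add, bpsk_add]
    · rw [hN, hP.setIntegral_density _ (measurableSet_lt measurable_const (measurable_density _))]
      refine le_of_eq ?_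
      unfold densityTail density
      congr 1
      ext e
      simp only [Set.mem_ofPred_eq, spread_bpsk_mul, ← mul_assoc, bpsk_mul_self, one_mul]
  have h0 := key 0
  have h1 := key 1
  have h2 : N.real {g | (mlDecode m 1 g).1 ∅ = 0} + N.real {g | (mlDecode m 1 g).1 ∅ = 1} = 1 := by
    have h3 : {g : Cube m → ℝ | (mlDecode m 1 g).1 ∅ = 1} = {g | (mlDecode m 1 g).1 ∅ = 0}ᶜ := by
      ext g
      have h4 : (1 : ZMod 2) ≠ 0 := by decide
      have h5 := zmod_two_cases ((mlDecode m 1 g).1 ∅)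
      simp only [Set.mem_ofPred_eq, Set.mem_compl_iff]
      constructor
      · intro h; rw [h]; exact h4
      · intro h; exact h5.resolve_left h
    rw [h3, measureReal_add_measureReal_compl (hA 0)]
    simp
  unfold corr
  rw [sum_infoBlock_one]
  linarith

/-! ### Converse: noise beyond capacity -/

/-- The difference of the two sides has derivative x³/(1 + x) and a minimum at 0. The cubic term is
kept because its mean is κ, of lower order than θ. -/
lemma log_one_add_le {h : ℝ} (hh : -1 < h) : Real.log (1 + h) ≤ h - h ^ 2 / 2 + h ^ 3 / 3 := by
  have hd : ∀ x : ℝ, -1 < x → HasDerivAt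
      (fun x => x - x ^ 2 / 2 + x ^ 3 / 3 - Real.log (1 + x)) (x ^ 3 / (1 + x)) x := by
    intro x hx
    have hx' : 1 + x ≠ 0 := by linarith
    have h1 := (((hasDerivAt_id x).sub (((hasDerivAt_id x).pow 2).div_const 2)).add
      (((hasDerivAt_id x).pow 3).div_const 3)).sub
      (((hasDerivAt_id x).const_add 1).log hx')
    refine h1.congr_deriv ?_
    simp only [id]
    field_simp
    ring
  have h0 : (0 : ℝ) - 0 ^ 2 / 2 + 0 ^ 3 / 3 - Real.log (1 + 0) = 0 := by simp
  rcases le_total 0 h with hpos | hneg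
  · have hm : MonotoneOn (fun x : ℝ => x - x ^ 2 / 2 + x ^ 3 / 3 - Real.log (1 + x))
        (Set.Ici 0) := by
      refine monotoneOn_of_deriv_nonneg (convex_Ici 0) (fun x hx => ?_) (fun x hx => ?_)
        fun x hx => ?_
      · exact (hd x (by linarith [Set.mem_Ici.1 hx])).continuousAt.continuousWithinAt
      · rw [interior_Ici, Set.mem_Ioi] at hx
        exact (hd x (by linarith)).differentiableAt.differentiableWithinAt
      · rw [interior_Ici, Set.mem_Ioi] at hx
        rw [(hd x (by linarith)).deriv]
        positivity
    have := hm Set.self_mem_Ici hpos hpos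
    simp only [h0] at this
    linarith
  · have hm : AntitoneOn (fun x : ℝ => x - x ^ 2 / 2 + x ^ 3 / 3 - Real.log (1 + x))
        (Set.Ioc (-1) 0) := by
      refine antitoneOn_of_deriv_nonpos (convex_Ioc _ _) (fun x hx => ?_) (fun x hx => ?_)
        fun x hx => ?_
      · exact (hd x hx.1).continuousAt.continuousWithinAt
      · rw [interior_Ioc] at hx
        exact (hd x hx.1).differentiableAt.differentiableWithinAt
      · rw [interior_Ioc] at hx
        rw [(hd x hx.1).deriv]
        refine div_nonpos_of_nonpos_of_nonneg ?_ (by linarith [hx.1])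
        have h2 := sq_nonneg x
        nlinarith [hx.2]
    have := hm ⟨hh, hneg⟩ ⟨by norm_num, le_refl (0 : ℝ)⟩ hneg
    simp only [h0] at this
    linarith

/-- From exp u ≤ 1 + u + u² for |u| ≤ 1, where u = l h (1 - h/2 + h²/3) and the bracket is at most 2
in modulus. -/
lemma one_add_rpow_le {l h : ℝ} (hl0 : 0 ≤ l) (hl : l ≤ 1 / 4) (hh : |h| < 1) :
    (1 + h) ^ l ≤ 1 + l * (h - h ^ 2 / 2 + h ^ 3 / 3) + 4 * l ^ 2 * h ^ 2 := by
  obtain ⟨h1, h2⟩ := abs_lt.1 hh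
  have hp : 0 < 1 + h := by linarith
  have hsq : h ^ 2 ≤ 1 := by nlinarith
  have hψ : |1 - h / 2 + h ^ 2 / 3| ≤ 2 := by
    rw [abs_le]; constructor <;> nlinarith [sq_nonneg h]
  have e1 : h - h ^ 2 / 2 + h ^ 3 / 3 = h * (1 - h / 2 + h ^ 2 / 3) := by ring
  have hψ2 : |l * (h - h ^ 2 / 2 + h ^ 3 / 3)| ≤ 1 := by
    rw [e1, abs_mul, abs_mul, abs_of_nonneg hl0]
    have := mul_le_mul hh.le hψ (abs_nonneg _) zero_le_one
    have := mul_le_mul hl this (mul_nonneg (abs_nonneg _) (abs_nonneg _)) (by norm_num)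
    linarith
  have h3 := (abs_le.1 (Real.abs_exp_sub_one_sub_id_le hψ2)).2
  have h4 : (1 + h) ^ l ≤ Real.exp (l * (h - h ^ 2 / 2 + h ^ 3 / 3)) := by
    rw [Real.rpow_def_of_pos hp, mul_comm]
    exact Real.exp_le_exp.2 (mul_le_mul_of_nonneg_left (log_one_add_le h1) hl0)
  have h5 : (l * (h - h ^ 2 / 2 + h ^ 3 / 3)) ^ 2 ≤ 4 * l ^ 2 * h ^ 2 := by
    rw [e1]
    have : (1 - h / 2 + h ^ 2 / 3) ^ 2 ≤ 4 := by
      rw [← sq_abs]; nlinarith [abs_nonneg (1 - h / 2 + h ^ 2 / 3)]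
    calc (l * (h * (1 - h / 2 + h ^ 2 / 3))) ^ 2 =
          (l * h) ^ 2 * (1 - h / 2 + h ^ 2 / 3) ^ 2 := by ring
      _ ≤ (l * h) ^ 2 * 4 := mul_le_mul_of_nonneg_left this (sq_nonneg _)
      _ = _ := by ring
  linarith

section tail

variable {P : Measure ℝ}

lemma SymLaw.integrable_one_add_rpow (hP : SymLaw P) {l : ℝ} (hl0 : 0 ≤ l) :
    Integrable (fun e => (1 + spread e) ^ l) P := by
  have := hP.prob
  refine integrable_of_abs_le (by fun_prop) (2 ^ l) fun e => ?_
  rw [abs_of_nonneg (Real.rpow_nonneg (one_add_spread_pos e).le _)]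
  exact Real.rpow_le_rpow (one_add_spread_pos e).le (by linarith [spread_lt_one e]) hl0

/-- By symmetry the mean of h - h²/2 + h³/3 is θ/2 + κ/3, an upper bound for the information of a
symbol in nats. -/
lemma SymLaw.integral_one_add_rpow_le (hP : SymLaw P) {l : ℝ} (hl0 : 0 ≤ l) (hl : l ≤ 1 / 4) :
    ∫ e, (1 + spread e) ^ l ∂P ≤
      Real.exp (l * (theta P / 2 + kappa P / 3) + 4 * l ^ 2 * theta P) := by
  have := hP.prob
  have i1 : Integrable (fun e => spread e) P := by simpa using hP.integrable_pow 1
  have i2 := hP.integrable_pow 2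
  have i3 := hP.integrable_pow 3
  have j1 : Integrable (fun e => spread e - spread e ^ 2 / 2) P := i1.sub (i2.div_const 2)
  have j2 : Integrable (fun e => spread e - spread e ^ 2 / 2 + spread e ^ 3 / 3) P :=
    j1.add (i3.div_const 3)
  have j3 : Integrable (fun e => 1 + l * (spread e - spread e ^ 2 / 2 + spread e ^ 3 / 3)) P :=
    (integrable_const _).add (j2.const_mul l)
  have j4 : Integrable (fun e => 1 + l * (spread e - spread e ^ 2 / 2 + spread e ^ 3 / 3) +
      4 * l ^ 2 * spread e ^ 2) P := j3.add (i2.const_mul _)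
  have h3 : ∫ e, spread e ^ 3 ∂P = kappa P := hP.integral_odd (k := 3) (by decide)
  calc _ ≤ ∫ e, (1 + l * (spread e - spread e ^ 2 / 2 + spread e ^ 3 / 3) +
        4 * l ^ 2 * spread e ^ 2) ∂P :=
        integral_mono (hP.integrable_one_add_rpow hl0) j4 fun e =>
          one_add_rpow_le hl0 hl (abs_spread_lt_one e)
    _ = 1 + l * (theta P / 2 + kappa P / 3) + 4 * l ^ 2 * theta P := by
        rw [integral_add j3 (i2.const_mul _), integral_add (integrable_const _) (j2.const_mul l),
          integral_const_mul, integral_add j1 (i3.div_const 3), integral_sub i1 (i2.div_const 2),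
          integral_div, integral_div, integral_const_mul, h3, hP.integral_spread]
        simp only [theta, integral_const, probReal_univ, smul_eq_mul, mul_one]
        ring
    _ ≤ _ := by
        have := Real.add_one_le_exp (l * (theta P / 2 + kappa P / 3) + 4 * l ^ 2 * theta P)
        linarith

lemma SymLaw.densityTail_le (hP : SymLaw P) (m : ℕ) {l : ℝ} (hl0 : 0 ≤ l) (hl : l ≤ 1 / 4)
    (t : ℝ) : densityTail m P (Real.exp t) ≤
      Real.exp (2 ^ m * (l * (theta P / 2 + kappa P / 3) + 4 * l ^ 2 * theta P) - l * t) := by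
  have := hP.prob
  have h := measureReal_le_prod_ge (ι := Cube m) P (fun _ e => (1 + spread e) ^ l)
    (fun _ e => Real.rpow_nonneg (one_add_spread_pos e).le _)
    (fun _ => hP.integrable_one_add_rpow hl0) (Real.exp_pos (l * t))
  refine (measureReal_mono (fun e he => ?_) (measure_ne_top _ _)).trans (h.trans ?_)
  · simp only [Set.mem_ofPred_eq] at he ⊢
    rw [Real.finsetProd_rpow _ _ fun i _ => (one_add_spread_pos _).le, mul_comm, Real.exp_mul]
    exact Real.rpow_le_rpow (Real.exp_nonneg _) he.le hl0
  · rw [Finset.prod_const, Real.exp_sub]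
    refine div_le_div_of_nonneg_right ?_ (Real.exp_nonneg _)
    have hc : (Finset.univ : Finset (Cube m)).card = 2 ^ m := by
      simp [ZMod.card]
    rw [hc, mul_comm (2 ^ m : ℝ), Real.exp_mul]
    refine (pow_le_pow_left₀ (integral_nonneg fun e =>
      Real.rpow_nonneg (one_add_spread_pos e).le _) (hP.integral_one_add_rpow_le hl0 hl) _).trans ?_
    rw [← Real.rpow_natCast]; push_cast; exact le_rfl

lemma SymLaw.corr_one_le_exp (hP : SymLaw P) {m : ℕ} {ε : ℝ} (hε : 0 < ε) (hε1 : ε ≤ 1)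
    (h : 2 ^ m * (theta P / 2 + kappa P / 3) ≤ (1 - ε) * (m * Real.log 2)) :
    corr m 1 P ∅ ≤ 1 / 2 + Real.exp (-(ε ^ 2 / 128 * Real.log 2 * m)) +
      Real.sqrt (3 * Real.exp (-(ε ^ 2 / 128 * Real.log 2 * m))) := by
  set L : ℝ := m * Real.log 2 with hL
  have hL0 : 0 ≤ L := mul_nonneg (Nat.cast_nonneg _) (Real.log_nonneg (by norm_num))
  have hn : (0 : ℝ) < 2 ^ m := by positivity
  have hκ := mul_nonneg hn.le hP.kappa_nonneg
  have h1 : 2 ^ m * theta P ≤ 2 * L := by nlinarith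
  -- The threshold exp ((1 - ε/2)L) lies between the typical density, at most exp ((1 - ε)L), and
  -- the number exp L of words. With l = ε/32 the exponent becomes (-ε²/64 + ε²/128)L.
  have ht := hP.densityTail_le m (l := ε / 32) (by positivity) (by linarith) ((1 - ε / 2) * L)
  have h2 : densityTail m P (Real.exp ((1 - ε / 2) * L)) ≤
      Real.exp (-(ε ^ 2 / 128 * Real.log 2 * m)) := by
    refine ht.trans (Real.exp_le_exp.2 ?_)
    have h3 : -(ε ^ 2 / 128 * Real.log 2 * m) = -(ε ^ 2 / 128 * L) := by rw [hL]; ring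
    rw [h3]
    have h4 := mul_le_mul_of_nonneg_left h (show 0 ≤ ε / 32 by positivity)
    have h5 := mul_le_mul_of_nonneg_left h1 (show 0 ≤ 4 * (ε / 32) ^ 2 by positivity)
    linarith
  have h6 : Real.exp ((1 - ε / 2) * L) / 2 ^ m ≤ Real.exp (-(ε ^ 2 / 128 * Real.log 2 * m)) := by
    have : (2 : ℝ) ^ m = Real.exp L := by
      rw [hL, mul_comm, Real.exp_mul, Real.exp_log (by norm_num), Real.rpow_natCast]
    rw [this, ← Real.exp_sub]
    refine Real.exp_le_exp.2 ?_
    have h3 : -(ε ^ 2 / 128 * Real.log 2 * m) = -(ε ^ 2 / 128 * L) := by rw [hL]; ring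
    rw [h3]
    have h7 : ε ^ 2 / 128 ≤ ε / 2 := by nlinarith
    have h8 := mul_le_mul_of_nonneg_right h7 hL0
    linarith
  have h9 := hP.corr_one_le (m := m) (Real.exp_nonneg ((1 - ε / 2) * L))
  have h10 := Real.sqrt_le_sqrt (add_le_add h6 (mul_le_mul_of_nonneg_left h2 (zero_le_two (α := ℝ))))
  rw [show Real.exp (-(ε ^ 2 / 128 * Real.log 2 * m)) +
    2 * Real.exp (-(ε ^ 2 / 128 * Real.log 2 * m)) =
    3 * Real.exp (-(ε ^ 2 / 128 * Real.log 2 * m)) by ring] at h10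
  linarith

end tail

/-- If the second and fourth moments of the spreads at the first code of order one are too small
for its rate, then its information bits are decoded almost as badly as by guessing. -/
theorem eventually_corr_le {ε β : ℝ} (hε : 0 < ε) (hε1 : ε ≤ 1) (hβ : 1 / 2 < β) :
    ∀ᶠ n : ℕ in Filter.atTop, ∀ (r : ℕ) (P : Measure ℝ), SymLaw P →
      2 ^ n * (theta P ^ 2 ^ r / 2 + kappa P ^ 2 ^ r / 3) ≤ (1 - ε) * (n * Real.log 2) →
      corr (n + r) (r + 1) P (firstBit r (n + r)) ≤ β := by
  have hc : 0 < ε ^ 2 / 128 * Real.log 2 := by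
    have := Real.log_pos (show (1 : ℝ) < 2 by norm_num); positivity
  have h1 : Filter.Tendsto (fun n : ℕ => Real.exp (-(ε ^ 2 / 128 * Real.log 2 * n))) Filter.atTop
      (nhds 0) := by
    refine Real.tendsto_exp_neg_atTop_nhds_zero.comp ?_
    exact tendsto_natCast_atTop_atTop.const_mul_atTop hc
  have h2 : Filter.Tendsto (fun n : ℕ => 1 / 2 + Real.exp (-(ε ^ 2 / 128 * Real.log 2 * n)) +
      Real.sqrt (3 * Real.exp (-(ε ^ 2 / 128 * Real.log 2 * n)))) Filter.atTop (nhds (1 / 2)) := by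
    have := (h1.const_add (1 / 2)).add ((h1.const_mul 3).sqrt)
    simpa using this
  filter_upwards [h2.eventually_le_const hβ, Filter.eventually_ge_atTop 3] with n hn hn3 r P hP h
  exact SymLaw.corr_firstBit_le hn3 (fun P hP h => (hP.corr_one_le_exp hε hε1 h).trans hn) r P hP h

/-! ### The channels -/

lemma average_le_of_le {W : Type*} [Fintype W] [Nonempty W] {F : W → ℝ} {c : ℝ}
    (h : ∀ w, F w ≤ c) : (∑ w, F w) / Fintype.card W ≤ c := by
  have hM : (0 : ℝ) < Fintype.card W := Nat.cast_pos.2 Fintype.card_pos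
  rw [div_le_iff₀ hM]
  calc ∑ w, F w ≤ ∑ _w : W, c := Finset.sum_le_sum fun w _ => h w
    _ = c * Fintype.card W := by rw [Finset.sum_const, Finset.card_univ, nsmul_eq_mul, mul_comm]

lemma one_sub_average_le {W : Type*} [Fintype W] [Nonempty W] {F G : W → ℝ}
    (h : ∀ w, 1 - F w ≤ G w) :
    1 - (∑ w, F w) / Fintype.card W ≤ (∑ w, G w) / Fintype.card W := by
  have hM : (0 : ℝ) < Fintype.card W := Nat.cast_pos.2 Fintype.card_pos
  rw [sub_le_iff_le_add, ← add_div, ← Finset.sum_add_distrib, le_div_iff₀ hM, one_mul]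
  calc (Fintype.card W : ℝ) = ∑ _w : W, (1 : ℝ) := by simp
    _ ≤ _ := Finset.sum_le_sum fun w _ => by linarith [h w]

lemma measureReal_recDecode_ne_le (m r : ℕ) (P : Measure ℝ) [IsProbabilityMeasure P]
    (w : InfoBlock m r) (S : Finset (Fin m)) :
    (Measure.pi fun _ : Cube m => P).real
      {e | recDecode m r (fun x => bpsk (encode w.1 x) * e x) S ≠ w.1 S} ≤ bad m r P := by
  refine measureReal_mono (fun e he => ?_) (measure_ne_top _ _)
  simp only [Set.mem_ofPred_eq] at he ⊢
  intro hgood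
  exact he (by rw [recDecode_eq_of_good m r e hgood w])

/-! #### Soft decision reception -/

/-- The law of the likelihood of a symbol `0` on the channel AWGN(`v`). -/
def softLaw (v : ℝ) : Measure ℝ := gaussianReal (2 / v) (4 / v).toNNReal

lemma gaussianPDFReal_neg {v : ℝ} (hv : 0 < v) (e : ℝ) :
    gaussianPDFReal (2 / v) (4 / v).toNNReal (-e) =
      gaussianPDFReal (2 / v) (4 / v).toNNReal e * Real.exp (-e) := by
  unfold gaussianPDFReal
  conv_rhs => rw [mul_assoc, ← Real.exp_add]
  rw [Real.coe_toNNReal _ (by positivity)]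
  congr 2
  field_simp
  ring

lemma softLaw_symLaw {v : ℝ} (hv : 0 < v) : SymLaw (softLaw v) := by
  refine ⟨by unfold softLaw; infer_instance, fun f hf => ?_⟩
  have hv' : (4 / v).toNNReal ≠ 0 := by
    rw [Ne, Real.toNNReal_eq_zero, not_le]; positivity
  have hpdf := measurable_gaussianPDF (2 / v) (4 / v).toNNReal
  unfold softLaw
  rw [gaussianReal_of_var_ne_zero _ hv', lintegral_withDensity_eq_lintegral_mul _ hpdf (by fun_prop),
    lintegral_withDensity_eq_lintegral_mul _ hpdf (by fun_prop),
    ← lintegral_neg_eq_self]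
  refine lintegral_congr fun e => ?_
  simp only [Pi.mul_apply, gaussianPDF, neg_neg, spread_neg, sub_neg_eq_add]
  rw [gaussianPDFReal_neg hv, one_sub_spread,
    ENNReal.ofReal_mul (gaussianPDFReal_nonneg _ _ _), ENNReal.ofReal_mul (one_add_spread_pos e).le]
  ring

lemma awgn_map {m : ℕ} {v : ℝ} (hv : 0 < v) (z : Cube m → ZMod 2) :
    (awgn v z).map (fun y x => bpsk (z x) * (2 / v) * y x) =
      Measure.pi fun _ : Cube m => softLaw v := by
  unfold awgn
  have hp : ∀ x, IsProbabilityMeasure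
      ((gaussianReal (bpsk (z x)) v.toNNReal).map fun y => bpsk (z x) * (2 / v) * y) := fun x =>
    Measure.isProbabilityMeasure_map (by fun_prop)
  rw [Measure.pi_map_pi (f := fun x y => bpsk (z x) * (2 / v) * y) fun x => by fun_prop]
  congr 1
  funext x
  rw [gaussianReal_map_const_mul, softLaw]
  congr 1
  · rw [mul_right_comm, bpsk_mul_self, one_mul]
  · apply NNReal.eq
    push_cast
    rw [Real.coe_toNNReal _ hv.le, Real.coe_toNNReal _ (by positivity), mul_pow, sq (bpsk _),
      bpsk_mul_self]
    field_simp
    ring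

/-- After removal of the transmitted signs the likelihoods are independent with one law, whatever
the codeword. The one-sided inequality serves both directions, being applied once to the event of a
wrong bit and once to that of a right bit. -/
lemma awgn_real_le {m : ℕ} {v : ℝ} (hv : 0 < v) (z : Cube m → ZMod 2)
    (p : (Cube m → ℝ) → Prop) :
    (awgn v z).real {y | p fun x => 2 * y x / v} ≤
      (Measure.pi fun _ : Cube m => softLaw v).real {e | p fun x => bpsk (z x) * e x} := by
  have : IsProbabilityMeasure (awgn v z) := by unfold awgn; infer_instance
  rw [← awgn_map hv z]
  refine le_trans (measureReal_mono (fun y hy => ?_) (measure_ne_top _ _))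
    (measureReal_preimage_le (by fun_prop) _)
  simp only [Set.mem_preimage, Set.mem_ofPred_eq, ← mul_assoc, bpsk_mul_self, one_mul] at hy ⊢
  convert hy using 2 with x
  ring

lemma softBitError_le_bad {m r : ℕ} {v : ℝ} (hv : 0 < v) (S : Finset (Fin m)) :
    softBitError m r v S ≤ bad m r (softLaw v) := by
  have := (softLaw_symLaw hv).prob
  exact average_le_of_le fun w =>
    (awgn_real_le hv (encode w.1) fun g => recDecode m r g S ≠ w.1 S).trans
      (measureReal_recDecode_ne_le m r _ w S)

lemma one_sub_corr_le_softBitError {m r : ℕ} {v : ℝ} (hv : 0 < v) (S : Finset (Fin m)) :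
    1 - corr m r (softLaw v) S ≤ softBitError m r v S := by
  have := (softLaw_symLaw hv).prob
  refine one_sub_average_le fun w => ?_
  have : IsProbabilityMeasure (awgn v (encode w.1)) := by unfold awgn; infer_instance
  have h1 := awgn_real_le hv (encode w.1) fun g => recDecode m r g S = w.1 S
  -- Subadditivity replaces complementation, since the events are not known to be measurable.
  have h2 : 1 ≤ (awgn v (encode w.1)).real {y | recDecode m r (fun x => 2 * y x / v) S = w.1 S} +
      (awgn v (encode w.1)).real {y | recDecode m r (fun x => 2 * y x / v) S ≠ w.1 S} := by
    refine le_trans ?_ (measureReal_union_le _ _)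
    rw [show {y : Cube m → ℝ | recDecode m r (fun x => 2 * y x / v) S = w.1 S} ∪
      {y : Cube m → ℝ | recDecode m r (fun x => 2 * y x / v) S ≠ w.1 S} = Set.univ by
        ext y; simp [em]]
    simp
  linarith

lemma mem_softPowers_of_bad_le {α v : ℝ} {m r : ℕ} (hv : 0 < v) (h : bad m r (softLaw v) ≤ α) :
    v ∈ softPowers α m r :=
  ⟨hv, fun S _ => (softBitError_le_bad hv S).trans h⟩

lemma notMem_softPowers_of_corr_le {α v : ℝ} {m r : ℕ} (S : Finset (Fin m)) (hS : S.card ≤ r)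
    (h : 0 < v → corr m r (softLaw v) S < 1 - α) : v ∉ softPowers α m r := fun hmem => by
  linarith [one_sub_corr_le_softBitError (r := r) hmem.1 S, hmem.2 S hS, h hmem.1]

/-! #### Hard decision reception -/

/-- The law of the likelihood of a symbol `0` on the channel BSC(`p`). -/
def hardLaw (p : ℝ) : Measure ℝ :=
  ENNReal.ofReal (1 - p) • Measure.dirac (Real.log ((1 - p) / p)) +
    ENNReal.ofReal p • Measure.dirac (-Real.log ((1 - p) / p))

lemma spread_log {p : ℝ} (hp : 0 < p) (hp1 : p < 1) :
    spread (Real.log ((1 - p) / p)) = 1 - 2 * p := by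
  have h : 0 < 1 - p := by linarith
  rw [spread_eq, Real.exp_neg, Real.exp_log (by positivity)]
  field_simp
  ring

lemma hardLaw_symLaw {p : ℝ} (hp : 0 < p) (hp1 : p < 1) : SymLaw (hardLaw p) := by
  have h : 0 < 1 - p := by linarith
  refine ⟨⟨?_⟩, fun f hf => ?_⟩
  · simp only [hardLaw, Measure.coe_add, Measure.coe_smul, Pi.add_apply, Pi.smul_apply,
      measure_univ, smul_eq_mul, mul_one]
    rw [← ENNReal.ofReal_add h.le hp.le]; simp
  · simp only [hardLaw, lintegral_add_measure, lintegral_smul_measure, lintegral_dirac, smul_eq_mul,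
      spread_neg, spread_log hp hp1, neg_neg, sub_neg_eq_add]
    rw [show 1 - (1 - 2 * p) = 2 * p by ring, show 1 + (1 - 2 * p) = 2 * (1 - p) by ring,
      ENNReal.ofReal_mul (by norm_num), ENNReal.ofReal_mul (by norm_num)]
    ring

lemma integral_hardLaw {p : ℝ} (hp : 0 < p) (hp1 : p < 1) {f : ℝ → ℝ} (hf : Measurable f) :
    ∫ e, f e ∂(hardLaw p) = (1 - p) * f (Real.log ((1 - p) / p)) +
      p * f (-Real.log ((1 - p) / p)) := by
  have h : 0 < 1 - p := by linarith
  have hi : ∀ x : ℝ, Integrable f (Measure.dirac x) := fun x =>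
    integrable_dirac' hf.stronglyMeasurable (by simp)
  rw [hardLaw, integral_add_measure ((hi _).smul_measure (by simp)) ((hi _).smul_measure (by simp)),
    integral_smul_measure, integral_smul_measure, integral_dirac, integral_dirac,
    ENNReal.toReal_ofReal h.le, ENNReal.toReal_ofReal hp.le]
  rfl

lemma theta_hardLaw {p : ℝ} (hp : 0 < p) (hp1 : p < 1) : theta (hardLaw p) = (1 - 2 * p) ^ 2 := by
  rw [theta, integral_hardLaw hp hp1 (by fun_prop), spread_neg, spread_log hp hp1]; ring

lemma kappa_hardLaw {p : ℝ} (hp : 0 < p) (hp1 : p < 1) : kappa (hardLaw p) = (1 - 2 * p) ^ 4 := by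
  rw [kappa, integral_hardLaw hp hp1 (by fun_prop), spread_neg, spread_log hp hp1]; ring

lemma hardLaw_real_singleton {p : ℝ} (hp : 0 < p) (hp1 : p < 1) (b : ZMod 2) :
    (if b = 0 then 1 - p else p) ≤ (hardLaw p).real {bpsk b * Real.log ((1 - p) / p)} := by
  have h : 0 < 1 - p := by linarith
  have := (hardLaw_symLaw hp hp1).prob
  have h10 : (1 : ZMod 2) ≠ 0 := by decide
  refine (ENNReal.ofReal_le_iff_le_toReal (measure_ne_top _ _)).1 ?_
  rcases zmod_two_cases b with rfl | rfl
  · simp [hardLaw]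
  · simp [hardLaw]

lemma sum_bsc {m : ℕ} (p : ℝ) (z : Cube m → ZMod 2) : ∑ a, bsc p z a = 1 := by
  have h := Finset.prod_univ_sum (fun _ : Cube m => (Finset.univ : Finset (ZMod 2)))
    (fun x b => if b = z x then 1 - p else p)
  rw [Fintype.piFinset_univ] at h
  unfold bsc
  rw [← h]
  refine Finset.prod_eq_one fun x _ => ?_
  have h1 : ∑ b : ZMod 2, (if b = z x then 1 - p else p) =
      (if (0 : ZMod 2) = z x then 1 - p else p) + (if (1 : ZMod 2) = z x then 1 - p else p) :=
    Fin.sum_univ_two (fun b : ZMod 2 => if b = z x then 1 - p else p)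
  rw [h1]
  have h10 : (1 : ZMod 2) ≠ 0 := by decide
  rcases zmod_two_cases (z x) with h2 | h2 <;> rw [h2] <;> simp

lemma sum_bsc_le {m : ℕ} {p : ℝ} (hp : 0 < p) (hp1 : p < 1 / 2) (z : Cube m → ZMod 2)
    (E : (Cube m → ℝ) → Prop) [∀ a : Cube m → ZMod 2,
      Decidable (E fun x => bpsk (a x) * Real.log ((1 - p) / p))] :
    (∑ a : Cube m → ZMod 2,
      if E fun x => bpsk (a x) * Real.log ((1 - p) / p) then bsc p z a else 0) ≤
    (Measure.pi fun _ : Cube m => hardLaw p).real {e | E fun x => bpsk (z x) * e x} := by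
  classical
  have := (hardLaw_symLaw hp (by linarith)).prob
  have hL0 : Real.log ((1 - p) / p) ≠ 0 := by
    refine (Real.log_pos ?_).ne'
    rw [lt_div_iff₀ hp]; linarith
  -- The likelihoods with the signs of z removed. As p < 1/2 makes the logarithm nonzero, φ is
  -- injective, and the received words correspond to distinct atoms of the product law.
  let φ : (Cube m → ZMod 2) → Cube m → ℝ := fun a x => bpsk (z x + a x) * Real.log ((1 - p) / p)
  have hb : ∀ a b : ZMod 2, bpsk a = bpsk b → a = b := by
    intro a b
    rcases zmod_two_cases a with rfl | rfl <;> rcases zmod_two_cases b with rfl | rfl <;>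
      simp <;> norm_num
  have hφ : Function.Injective φ := by
    intro a a' h
    funext x
    have h1 := congrFun h x
    simp only [φ] at h1
    exact add_left_cancel (hb _ _ (mul_right_cancel₀ hL0 h1))
  have hle : ∀ a, bsc p z a ≤ (Measure.pi fun _ : Cube m => hardLaw p).real {φ a} := by
    intro a
    have h1 : (Measure.pi fun _ : Cube m => hardLaw p).real {φ a} =
        ∏ x, (hardLaw p).real {φ a x} := by
      rw [← Set.univ_pi_singleton, measureReal_def, Measure.pi_pi, ENNReal.toReal_prod]
      rfl
    rw [h1]
    refine Finset.prod_le_prod (fun x _ => by split_ifs <;> linarith) fun x _ => ?_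
    refine le_trans (le_of_eq ?_) (hardLaw_real_singleton hp (by linarith) (z x + a x))
    congr 1
    rw [CharTwo.add_eq_zero, eq_comm (a := a x)]
  rw [← Finset.sum_filter]
  calc _ ≤ ∑ a ∈ Finset.univ.filter fun a : Cube m → ZMod 2 =>
          E fun x => bpsk (a x) * Real.log ((1 - p) / p),
        (Measure.pi fun _ : Cube m => hardLaw p).real {φ a} := Finset.sum_le_sum fun a _ => hle a
    _ = ∑ e ∈ (Finset.univ.filter fun a : Cube m → ZMod 2 =>
          E fun x => bpsk (a x) * Real.log ((1 - p) / p)).image φ,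
        (Measure.pi fun _ : Cube m => hardLaw p).real {e} :=
      by rw [Finset.sum_image fun a _ a' _ h => hφ h]
    _ = (Measure.pi fun _ : Cube m => hardLaw p).real
        ((Finset.univ.filter fun a : Cube m → ZMod 2 =>
          E fun x => bpsk (a x) * Real.log ((1 - p) / p)).image φ) :=
      sum_measureReal_singleton _
    _ ≤ _ := by
      refine measureReal_mono (fun e he => ?_) (measure_ne_top _ _)
      simp only [Finset.coe_image, Finset.coe_filter, Finset.mem_univ, true_and, Set.mem_image,
        Set.mem_ofPred_eq] at he ⊢
      obtain ⟨a, ha, rfl⟩ := he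
      convert ha using 2 with x
      simp only [φ]
      rw [bpsk_add, ← mul_assoc, ← mul_assoc, bpsk_mul_self, one_mul]

lemma hardBitError_le_bad {m r : ℕ} {p : ℝ} (hp : 0 < p) (hp1 : p < 1 / 2) (S : Finset (Fin m)) :
    hardBitError m r p S ≤ bad m r (hardLaw p) := by
  have := (hardLaw_symLaw hp (by linarith)).prob
  exact average_le_of_le fun w =>
    (sum_bsc_le hp hp1 (encode w.1) fun g => recDecode m r g S ≠ w.1 S).trans
      (measureReal_recDecode_ne_le m r _ w S)

lemma one_sub_corr_le_hardBitError {m r : ℕ} {p : ℝ} (hp : 0 < p) (hp1 : p < 1 / 2)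
    (S : Finset (Fin m)) : 1 - corr m r (hardLaw p) S ≤ hardBitError m r p S := by
  refine one_sub_average_le fun w => ?_
  have h1 := sum_bsc_le hp hp1 (encode w.1) fun g => recDecode m r g S = w.1 S
  have h2 := sum_bsc p (encode w.1)
  have h3 : ∑ a, bsc p (encode w.1) a =
      (∑ a : Cube m → ZMod 2, if recDecode m r (fun x => bpsk (a x) * Real.log ((1 - p) / p)) S =
        w.1 S then bsc p (encode w.1) a else 0) +
      ∑ a : Cube m → ZMod 2, if recDecode m r (fun x => bpsk (a x) * Real.log ((1 - p) / p)) S ≠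
        w.1 S then bsc p (encode w.1) a else 0 := by
    rw [← Finset.sum_add_distrib]
    refine Finset.sum_congr rfl fun a _ => ?_
    by_cases h : recDecode m r (fun x => bpsk (a x) * Real.log ((1 - p) / p)) S = w.1 S <;>
      simp [h]
  linarith

/-! ### The Gaussian tail -/

/-- The standard Gaussian density. -/
def phi (y : ℝ) : ℝ := Real.exp (-y ^ 2 / 2) / Real.sqrt (2 * Real.pi)

lemma sqrt_two_pi_pos : 0 < Real.sqrt (2 * Real.pi) := Real.sqrt_pos.2 (by positivity)

lemma phi_pos (y : ℝ) : 0 < phi y := div_pos (Real.exp_pos _) sqrt_two_pi_pos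

lemma continuous_phi : Continuous phi := by unfold phi; fun_prop

lemma phi_eq : phi = fun y => Real.exp (-(1 / 2) * y ^ 2) / Real.sqrt (2 * Real.pi) := by
  funext y; unfold phi; congr 2; ring

lemma integrable_phi : Integrable phi := by
  rw [phi_eq]
  exact (integrable_exp_neg_mul_sq (by norm_num)).div_const _

lemma Q_zero : Q 0 = 1 / 2 := by
  have h : Q 0 = ∫ y in Set.Ioi (0 : ℝ), phi y := rfl
  rw [h, phi_eq, integral_div, integral_gaussian_Ioi, show Real.pi / (1 / 2) = 2 * Real.pi by ring]
  have := sqrt_two_pi_pos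
  field_simp

lemma Q_eq (x : ℝ) : Q x = 1 / 2 - ∫ y in (0 : ℝ)..x, phi y := by
  have h := intervalIntegral.integral_Ioi_sub_Ioi' (f := phi) (μ := volume) (a := 0) (b := x)
    integrable_phi.integrableOn integrable_phi.integrableOn
  have h1 : Q 0 - Q x = ∫ y in (0 : ℝ)..x, phi y := h
  rw [Q_zero] at h1
  linarith

lemma hasDerivAt_Q (x : ℝ) : HasDerivAt Q (-phi x) x := by
  have h := (intervalIntegral.integral_hasDerivAt_right
    (continuous_phi.intervalIntegrable 0 x) (continuous_phi.stronglyMeasurableAtFilter _ _)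
    continuous_phi.continuousAt).const_sub (1 / 2)
  rwa [← funext Q_eq] at h

lemma continuous_Q : Continuous Q :=
  continuous_iff_continuousAt.2 fun x => (hasDerivAt_Q x).continuousAt

lemma strictAnti_Q : StrictAnti Q :=
  strictAnti_of_deriv_neg fun x => by rw [(hasDerivAt_Q x).deriv]; linarith [phi_pos x]

lemma tendsto_Q_atTop : Filter.Tendsto Q Filter.atTop (nhds 0) := by
  have h := (intervalIntegral_tendsto_integral_Ioi (0 : ℝ) (f := phi) (μ := volume)
    integrable_phi.integrableOn Filter.tendsto_id).const_sub (1 / 2)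
  have h1 : ∫ y in Set.Ioi (0 : ℝ), phi y = 1 / 2 := Q_zero
  rw [h1, sub_self] at h
  rw [funext Q_eq]
  exact h

lemma Q_pos (x : ℝ) : 0 < Q x := by
  have h : 0 ≤ Q (x + 1) := strictAnti_Q.antitone.le_of_tendsto tendsto_Q_atTop _
  linarith [strictAnti_Q (show x < x + 1 by linarith)]

lemma Q_lt_half {x : ℝ} (hx : 0 < x) : Q x < 1 / 2 := by
  rw [← Q_zero]; exact strictAnti_Q hx

lemma exists_Q_eq {b : ℝ} (hb : 0 < b) (hb1 : b < 1 / 2) : ∃ x, 0 < x ∧ Q x = b := by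
  obtain ⟨y, hy⟩ := ((tendsto_Q_atTop.eventually_lt_const hb).and
    (Filter.eventually_ge_atTop 0)).exists
  obtain ⟨x, hx, hxb⟩ := intermediate_value_Icc' hy.2 continuous_Q.continuousOn
    (show b ∈ Set.Icc (Q y) (Q 0) from ⟨hy.1.le, by rw [Q_zero]; exact hb1.le⟩)
  refine ⟨x, lt_of_le_of_ne hx.1 ?_, hxb⟩
  rintro rfl
  rw [Q_zero] at hxb; linarith

lemma hasDerivAt_phi (x : ℝ) : HasDerivAt phi (-x * phi x) x := by
  have h := ((((hasDerivAt_id x).pow 2).neg.div_const 2).exp).div_const (Real.sqrt (2 * Real.pi))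
  refine h.congr_deriv ?_
  simp only [phi, id, Pi.neg_apply, Pi.pow_apply]
  ring

lemma tendsto_phi_div_atTop : Filter.Tendsto (fun x => phi x / x) Filter.atTop (nhds 0) := by
  refine squeeze_zero' (g := fun x : ℝ => (Real.sqrt (2 * Real.pi))⁻¹ * x⁻¹) ?_ ?_ ?_
  · filter_upwards [Filter.eventually_gt_atTop 0] with x hx
    exact div_nonneg (phi_pos x).le hx.le
  · filter_upwards [Filter.eventually_gt_atTop 0] with x hx
    rw [div_eq_mul_inv]
    refine mul_le_mul_of_nonneg_right ?_ (by positivity)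
    rw [phi, div_eq_mul_inv]
    refine mul_le_of_le_one_left (by positivity) (Real.exp_le_one_iff.2 ?_)
    nlinarith [sq_nonneg x]
  · simpa using tendsto_inv_atTop_zero.const_mul (Real.sqrt (2 * Real.pi))⁻¹

/-- The asymptotics of the Gaussian tail. -/
lemma tendsto_Q_div : Filter.Tendsto (fun x => Q x / (phi x / x)) Filter.atTop (nhds 1) := by
  have hg : ∀ x : ℝ, 0 < x → HasDerivAt (fun x => phi x / x) (-phi x * (1 + (x ^ 2)⁻¹)) x := by
    intro x hx
    refine ((hasDerivAt_phi x).div (hasDerivAt_id x) hx.ne').congr_deriv ?_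
    simp only [id]
    field_simp
    ring
  refine HasDerivAt.lhopital_zero_atTop (f' := fun x => -phi x)
    (g' := fun x => -phi x * (1 + (x ^ 2)⁻¹)) (Filter.Eventually.of_forall hasDerivAt_Q) ?_ ?_
    tendsto_Q_atTop tendsto_phi_div_atTop ?_
  · filter_upwards [Filter.eventually_gt_atTop 0] with x hx using hg x hx
  · filter_upwards [Filter.eventually_gt_atTop 0] with x hx
    have := phi_pos x
    exact mul_ne_zero (by linarith) (by positivity)
  · have h1 : Filter.Tendsto (fun x : ℝ => (1 + (x ^ 2)⁻¹)⁻¹) Filter.atTop (nhds 1) := by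
      have : Filter.Tendsto (fun x : ℝ => (x ^ 2)⁻¹) Filter.atTop (nhds 0) :=
        (Filter.tendsto_pow_atTop two_ne_zero).inv_tendsto_atTop
      have h2 := (this.const_add 1).inv₀ (by norm_num)
      simpa using h2
    refine h1.congr fun x => ?_
    have := phi_pos x
    have h3 : 0 < 1 + (x ^ 2)⁻¹ := by positivity
    field_simp

lemma tendsto_one_sub_two_mul_Q_div :
    Filter.Tendsto (fun x => (1 - 2 * Q x) / x) (nhdsWithin 0 (Set.Ioi 0))
      (nhds (2 / Real.sqrt (2 * Real.pi))) := by
  have h := (hasDerivAt_iff_tendsto_slope_zero.1 (hasDerivAt_Q 0)).mono_left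
    (nhdsWithin_mono 0 (fun x (hx : 0 < x) => hx.ne'))
  have h1 := h.const_mul (-2)
  have h2 : -2 * -phi 0 = 2 / Real.sqrt (2 * Real.pi) := by simp [phi]; ring
  rw [h2] at h1
  refine h1.congr fun x => ?_
  rw [zero_add, Q_zero, smul_eq_mul]
  ring

/-! ### The transition error probability as a function of the noise power -/

/-- The transition error probability of hard decision reception for the noise power `v`. -/
def transition (v : ℝ) : ℝ := Q (1 / Real.sqrt v)

lemma transition_pos (v : ℝ) : 0 < transition v := Q_pos _

lemma transition_lt_half {v : ℝ} (hv : 0 < v) : transition v < 1 / 2 :=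
  Q_lt_half (one_div_pos.2 (Real.sqrt_pos.2 hv))

lemma transition_le {v w : ℝ} (hv : 0 < v) (h : v ≤ w) : transition v ≤ transition w :=
  strictAnti_Q.antitone
    (one_div_le_one_div_of_le (Real.sqrt_pos.2 hv) (Real.sqrt_le_sqrt h))

lemma exists_transition_eq {b : ℝ} (hb : 0 < b) (hb1 : b < 1 / 2) :
    ∃ v, 0 < v ∧ transition v = b := by
  obtain ⟨x, hx, h⟩ := exists_Q_eq hb hb1
  refine ⟨(1 / x) ^ 2, by positivity, ?_⟩
  rw [transition, Real.sqrt_sq (by positivity), one_div_one_div, h]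

lemma tendsto_one_div_sqrt_atTop :
    Filter.Tendsto (fun v : ℝ => 1 / Real.sqrt v) Filter.atTop (nhdsWithin 0 (Set.Ioi 0)) := by
  simp only [one_div]
  exact tendsto_inv_atTop_nhdsGT_zero.comp Real.tendsto_sqrt_atTop

lemma tendsto_one_div_sqrt_zero :
    Filter.Tendsto (fun v : ℝ => 1 / Real.sqrt v) (nhdsWithin 0 (Set.Ioi 0)) Filter.atTop := by
  simp only [one_div]
  refine tendsto_inv_nhdsGT_zero.comp (tendsto_nhdsWithin_iff.2 ⟨?_, ?_⟩)
  · have := Real.continuous_sqrt.tendsto 0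
    rw [Real.sqrt_zero] at this
    exact this.mono_left nhdsWithin_le_nhds
  · filter_upwards [self_mem_nhdsWithin] with v hv using Real.sqrt_pos.2 hv

lemma mem_hardPowers_of_bad_le {α v : ℝ} {m r : ℕ} (hv : 0 < v)
    (h : bad m r (hardLaw (transition v)) ≤ α) : v ∈ hardPowers α m r :=
  ⟨hv, fun S _ => (hardBitError_le_bad (transition_pos v) (transition_lt_half hv) S).trans h⟩

lemma notMem_hardPowers_of_corr_lt {α v : ℝ} {m r : ℕ} (S : Finset (Fin m)) (hS : S.card ≤ r)
    (h : 0 < v → corr m r (hardLaw (transition v)) S < 1 - α) : v ∉ hardPowers α m r :=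
  fun hmem => by
    have h1 := one_sub_corr_le_hardBitError (m := m) (r := r) (transition_pos v)
      (transition_lt_half hmem.1) S
    have h2 := hmem.2 S hS
    have h3 := h hmem.1
    unfold transition at *
    linarith

lemma hardLaw_transition_symLaw {v : ℝ} (hv : 0 < v) : SymLaw (hardLaw (transition v)) :=
  hardLaw_symLaw (transition_pos v) (by linarith [transition_lt_half hv])

/-! #### Moments of the spreads in hard decision reception -/

lemma theta_hard {v : ℝ} (hv : 0 < v) :
    theta (hardLaw (transition v)) = (1 - 2 * transition v) ^ 2 :=
  theta_hardLaw (transition_pos v) (by linarith [transition_lt_half hv])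

lemma theta_hard_antitone {v w : ℝ} (hv : 0 < v) (h : v ≤ w) :
    theta (hardLaw (transition w)) ≤ theta (hardLaw (transition v)) := by
  have hw := hv.trans_le h
  rw [theta_hard hv, theta_hard hw]
  refine pow_le_pow_left₀ ?_ ?_ 2
  · linarith [transition_lt_half hw]
  · linarith [transition_le hv h]

/-- The slope of 1 - 2Q at 0 is 2/√(2π). Its square is 2/π, and x = 1/√v contributes the factor 1/v.
-/
lemma tendsto_mul_theta_hard :
    Filter.Tendsto (fun v => v * theta (hardLaw (transition v))) Filter.atTop
      (nhds (2 / Real.pi)) := by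
  have h := (tendsto_one_sub_two_mul_Q_div.comp tendsto_one_div_sqrt_atTop).pow 2
  have h1 : (2 / Real.sqrt (2 * Real.pi)) ^ 2 = 2 / Real.pi := by
    rw [div_pow, Real.sq_sqrt (by positivity)]; field_simp
  rw [h1] at h
  refine h.congr' ?_
  filter_upwards [Filter.eventually_gt_atTop 0] with v hv
  rw [theta_hard hv]
  have h2 := Real.sqrt_pos.2 hv
  simp only [Function.comp, transition]
  rw [div_pow, div_pow, Real.sq_sqrt hv.le]
  field_simp

lemma tendsto_kappa_div_theta_hard :
    Filter.Tendsto (fun v => kappa (hardLaw (transition v)) / theta (hardLaw (transition v)))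
      Filter.atTop (nhds 0) := by
  have h : Filter.Tendsto (fun v => (1 - 2 * transition v) ^ 2) Filter.atTop (nhds 0) := by
    have h1 := (continuous_Q.tendsto 0).comp
      (tendsto_one_div_sqrt_atTop.mono_right nhdsWithin_le_nhds)
    rw [Q_zero] at h1
    have h2 := ((h1.const_mul 2).const_sub 1).pow 2
    simpa [transition] using h2
  refine h.congr' ?_
  filter_upwards [Filter.eventually_gt_atTop 0] with v hv
  have h3 : 0 < 1 - 2 * transition v := by linarith [transition_lt_half hv]
  rw [theta_hard hv, kappa_hardLaw (transition_pos v) (by linarith [transition_lt_half hv])]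
  field_simp

lemma tendsto_one_sub_theta_div_hard :
    Filter.Tendsto (fun v => (1 - theta (hardLaw (transition v))) / transition v)
      (nhdsWithin 0 (Set.Ioi 0)) (nhds 4) := by
  have h : Filter.Tendsto (fun v => 4 - 4 * transition v) (nhdsWithin 0 (Set.Ioi 0)) (nhds 4) := by
    have := ((tendsto_Q_atTop.comp tendsto_one_div_sqrt_zero).const_mul 4).const_sub 4
    simpa [transition] using this
  refine h.congr' ?_
  filter_upwards [self_mem_nhdsWithin] with v hv
  have := transition_pos v
  rw [theta_hard hv]
  field_simp
  ring

/-! ### Moments of the spreads in soft decision reception -/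

lemma hasDerivAt_spread (e : ℝ) : HasDerivAt spread ((1 - spread e ^ 2) / 2) e := by
  have h1 : HasDerivAt (fun e : ℝ => Real.exp (-e)) (-Real.exp (-e)) e := by
    simpa using (hasDerivAt_neg e).exp
  have hp := Real.exp_pos (-e)
  have h2 := (h1.const_sub 1).div (h1.const_add 1) (by positivity)
  have h3 : spread = fun e => (1 - Real.exp (-e)) / (1 + Real.exp (-e)) := funext spread_eq
  rw [h3]
  refine h2.congr_deriv ?_
  field_simp
  ring

lemma spread_zero : spread 0 = 0 := by simp [spread]

lemma continuous_spread : Continuous spread :=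
  continuous_iff_continuousAt.2 fun e => (hasDerivAt_spread e).continuousAt

attribute [fun_prop] continuous_spread

lemma abs_spread_le (e : ℝ) : |spread e| ≤ |e| / 2 := by
  have h := convex_univ.norm_image_sub_le_of_norm_hasDerivWithin_le (f := spread) (C := 1 / 2)
    (fun x _ => (hasDerivAt_spread x).hasDerivWithinAt) (fun x _ => by
      rw [Real.norm_eq_abs, abs_of_nonneg (by linarith [spread_sq_lt_one x])]
      linarith [sq_nonneg (spread x)]) (Set.mem_univ 0) (Set.mem_univ e)
  rw [spread_zero, sub_zero, sub_zero, Real.norm_eq_abs, Real.norm_eq_abs] at h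
  linarith

lemma spread_sq_le (e : ℝ) : spread e ^ 2 ≤ e ^ 2 / 4 := by
  have h := pow_le_pow_left₀ (abs_nonneg _) (abs_spread_le e) 2
  rw [sq_abs, div_pow, sq_abs] at h
  linarith

/-! #### Strong noise -/

lemma softLaw_eq_map {v : ℝ} (hv : 0 < v) :
    softLaw v = (gaussianReal 0 1).map fun z => 2 / Real.sqrt v * z + 2 / v := by
  have h1 := gaussianReal_map_const_mul (μ := 0) (v := 1) (2 / Real.sqrt v)
  have h2 := gaussianReal_map_add_const (μ := 2 / Real.sqrt v * 0)
    (v := .mk ((2 / Real.sqrt v) ^ 2) (sq_nonneg _) * 1) (2 / v)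
  rw [← h1, Measure.map_map (by fun_prop) (by fun_prop)] at h2
  refine Eq.trans ?_ h2.symm
  rw [softLaw]
  congr 1
  · ring
  · apply NNReal.eq
    push_cast
    rw [Real.coe_toNNReal _ (by positivity), div_pow, Real.sq_sqrt hv.le]
    norm_num

/-- The spread has slope 1/2 at 0, and the likelihood is 2z/√v + 2/v with z standard Gaussian. Thus
vθ tends to E z² = 1 by dominated convergence, and vκ to 0. -/
lemma tendsto_sqrt_mul_spread (z : ℝ) : Filter.Tendsto
    (fun v => Real.sqrt v * spread (2 / Real.sqrt v * z + 2 / v)) Filter.atTop (nhds z) := by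
  have h1 : Filter.Tendsto (fun v : ℝ => 1 / Real.sqrt v) Filter.atTop (nhds 0) :=
    tendsto_one_div_sqrt_atTop.mono_right nhdsWithin_le_nhds
  have h2 : Filter.Tendsto (fun v : ℝ => 2 / Real.sqrt v * z + 2 / v) Filter.atTop (nhds 0) := by
    have h3 : Filter.Tendsto (fun v : ℝ => 2 / v) Filter.atTop (nhds 0) :=
      tendsto_const_nhds.div_atTop Filter.tendsto_id
    have := ((h1.const_mul 2).mul_const z).add h3
    simp only [mul_zero, zero_mul, add_zero] at this
    refine this.congr fun v => ?_
    ring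
  have h4 := (hasDerivAt_spread 0).isLittleO
  have h5 := (h4.comp_tendsto h2)
  have h6 : Filter.Tendsto (fun v => Real.sqrt v * (2 / Real.sqrt v * z + 2 / v)) Filter.atTop
      (nhds (2 * z)) := by
    have h7 := (h1.const_mul 2).const_add (2 * z)
    simp only [mul_zero, add_zero] at h7
    refine h7.congr' ?_
    filter_upwards [Filter.eventually_gt_atTop 0] with v hv
    have := Real.sqrt_pos.2 hv
    have h8 := Real.sq_sqrt hv.le
    field_simp
    linear_combination (-1 : ℝ) * h8
  have h9 : Filter.Tendsto (fun v => Real.sqrt v * (spread (2 / Real.sqrt v * z + 2 / v) -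
      (2 / Real.sqrt v * z + 2 / v) / 2)) Filter.atTop (nhds 0) := by
    have h10 : (fun v => Real.sqrt v * (spread (2 / Real.sqrt v * z + 2 / v) -
        (2 / Real.sqrt v * z + 2 / v) / 2)) =o[Filter.atTop]
        fun v => Real.sqrt v * (2 / Real.sqrt v * z + 2 / v) := by
      refine (Asymptotics.isBigO_refl (fun v : ℝ => Real.sqrt v) Filter.atTop).mul_isLittleO ?_
      refine (h5.congr (fun v => ?_) fun v => ?_)
      · simp only [Function.comp, spread_zero, smul_eq_mul]; ring
      · simp only [Function.comp, sub_zero]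
    have h11 := (h10.trans_isBigO (h6.isBigO_one ℝ))
    exact (Asymptotics.isLittleO_one_iff ℝ).1 h11
  have h12 := h9.add (h6.div_const 2)
  rw [show (0 : ℝ) + 2 * z / 2 = z by ring] at h12
  refine h12.congr fun v => ?_
  ring

lemma mul_spread_sq_le {v : ℝ} (hv : 1 ≤ v) (z : ℝ) :
    v * spread (2 / Real.sqrt v * z + 2 / v) ^ 2 ≤ 2 * z ^ 2 + 2 := by
  have hv0 : 0 < v := by linarith
  have hs : 1 ≤ Real.sqrt v := Real.one_le_sqrt.2 hv
  have h1 := mul_le_mul_of_nonneg_left (spread_sq_le (2 / Real.sqrt v * z + 2 / v)) hv0.le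
  have h2 : 2 / Real.sqrt v * z + 2 / v = 2 / Real.sqrt v * (z + 1 / Real.sqrt v) := by
    have := Real.sq_sqrt hv0.le
    have h3 : 2 / v = 2 / Real.sqrt v * (1 / Real.sqrt v) := by
      rw [div_mul_div_comm, mul_one, Real.mul_self_sqrt hv0.le]
    rw [h3]; ring
  have h4 : v * ((2 / Real.sqrt v * z + 2 / v) ^ 2 / 4) = (z + 1 / Real.sqrt v) ^ 2 := by
    rw [h2, mul_pow, div_pow, Real.sq_sqrt hv0.le]
    field_simp
    ring
  rw [h4] at h1
  have h5 : 1 / Real.sqrt v ≤ 1 := by rw [div_le_one (by linarith)]; exact hs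
  have h6 : 0 ≤ 1 / Real.sqrt v := by positivity
  have h7 : (1 / Real.sqrt v) ^ 2 ≤ 1 := pow_le_one₀ h6 h5
  linarith [sq_nonneg (z - 1 / Real.sqrt v)]

lemma integrable_sq_gaussian : Integrable (fun z : ℝ => z ^ 2) (gaussianReal 0 1) :=
  (memLp_id_gaussianReal (μ := 0) (v := 1) 2).integrable_sq

lemma integral_sq_gaussian : ∫ z : ℝ, z ^ 2 ∂(gaussianReal 0 1) = 1 := by
  have h := variance_fun_id_gaussianReal (μ := 0) (v := 1)
  rw [variance_eq_integral (by fun_prop), integral_id_gaussianReal] at h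
  simpa using h

lemma integral_softLaw {v : ℝ} (hv : 0 < v) {f : ℝ → ℝ} (hf : Measurable f) :
    ∫ e, f e ∂(softLaw v) = ∫ z, f (2 / Real.sqrt v * z + 2 / v) ∂(gaussianReal 0 1) := by
  rw [softLaw_eq_map hv, integral_map (by fun_prop) hf.aestronglyMeasurable]

lemma tendsto_mul_theta_soft :
    Filter.Tendsto (fun v => v * theta (softLaw v)) Filter.atTop (nhds 1) := by
  have h : Filter.Tendsto (fun v => ∫ z, v * spread (2 / Real.sqrt v * z + 2 / v) ^ 2
      ∂(gaussianReal 0 1)) Filter.atTop (nhds (∫ z : ℝ, z ^ 2 ∂(gaussianReal 0 1))) := by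
    refine tendsto_integral_filter_of_dominated_convergence (fun z => 2 * z ^ 2 + 2)
      (Filter.Eventually.of_forall fun v => by fun_prop) ?_
      ((integrable_sq_gaussian.const_mul 2).add (integrable_const _))
      (Filter.Eventually.of_forall fun z => ?_)
    · filter_upwards [Filter.eventually_ge_atTop 1] with v hv
      refine Filter.Eventually.of_forall fun z => ?_
      rw [Real.norm_eq_abs, abs_of_nonneg (mul_nonneg (by linarith) (sq_nonneg _))]
      exact mul_spread_sq_le hv z
    · refine ((tendsto_sqrt_mul_spread z).pow 2).congr' ?_
      filter_upwards [Filter.eventually_gt_atTop 0] with v hv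
      rw [mul_pow, Real.sq_sqrt hv.le]
  rw [integral_sq_gaussian] at h
  refine h.congr' ?_
  filter_upwards [Filter.eventually_gt_atTop 0] with v hv
  rw [integral_const_mul, theta, integral_softLaw hv (by fun_prop)]

lemma tendsto_mul_kappa_soft :
    Filter.Tendsto (fun v => v * kappa (softLaw v)) Filter.atTop (nhds 0) := by
  have h : Filter.Tendsto (fun v => ∫ z, v * spread (2 / Real.sqrt v * z + 2 / v) ^ 4
      ∂(gaussianReal 0 1)) Filter.atTop (nhds (∫ _ : ℝ, (0 : ℝ) ∂(gaussianReal 0 1))) := by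
    refine tendsto_integral_filter_of_dominated_convergence (fun z => 2 * z ^ 2 + 2)
      (Filter.Eventually.of_forall fun v => by fun_prop) ?_
      ((integrable_sq_gaussian.const_mul 2).add (integrable_const _))
      (Filter.Eventually.of_forall fun z => ?_)
    · filter_upwards [Filter.eventually_ge_atTop 1] with v hv
      refine Filter.Eventually.of_forall fun z => ?_
      rw [Real.norm_eq_abs, abs_of_nonneg (mul_nonneg (by linarith) (by positivity))]
      refine le_trans (mul_le_mul_of_nonneg_left ?_ (by linarith)) (mul_spread_sq_le hv z)
      nlinarith [spread_sq_lt_one (2 / Real.sqrt v * z + 2 / v), sq_nonneg (spread (2 / Real.sqrt v * z + 2 / v))]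
    · have h1 := (tendsto_sqrt_mul_spread z).pow 4
      have h2 : Filter.Tendsto (fun v : ℝ => v⁻¹) Filter.atTop (nhds 0) := tendsto_inv_atTop_zero
      have h3 := h2.mul h1
      rw [zero_mul] at h3
      refine h3.congr' ?_
      filter_upwards [Filter.eventually_gt_atTop 0] with v hv
      have h4 : Real.sqrt v ^ 4 = v ^ 2 := by
        rw [show 4 = 2 * 2 by norm_num, pow_mul, Real.sq_sqrt hv.le]
      rw [mul_pow, h4]
      field_simp
  rw [integral_zero] at h
  refine h.congr' ?_
  filter_upwards [Filter.eventually_gt_atTop 0] with v hv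
  rw [integral_const_mul, kappa, integral_softLaw hv (by fun_prop)]

lemma tendsto_kappa_div_theta_soft :
    Filter.Tendsto (fun v => kappa (softLaw v) / theta (softLaw v)) Filter.atTop (nhds 0) := by
  have h := tendsto_mul_kappa_soft.div tendsto_mul_theta_soft one_ne_zero
  rw [zero_div] at h
  refine h.congr' ?_
  filter_upwards [Filter.eventually_gt_atTop 0] with v hv
  simp only [Pi.div_apply]
  rw [mul_div_mul_left _ _ hv.ne']

/-! #### Weak noise -/

lemma cosh_half_pos (e : ℝ) : 0 < Real.cosh (e / 2) := Real.cosh_pos _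

lemma one_sub_spread_eq (e : ℝ) : 1 - spread e = Real.exp (-e / 2) / Real.cosh (e / 2) := by
  have h1 := Real.exp_pos (e / 2)
  have h2 := Real.exp_pos (-e / 2)
  have h3 : Real.exp (-e) = Real.exp (-e / 2) * Real.exp (-e / 2) := by
    rw [← Real.exp_add]; congr 1; ring
  have h4 : Real.exp (e / 2) * Real.exp (-e / 2) = 1 := by
    rw [← Real.exp_add, ← Real.exp_zero]; congr 1; ring
  have h5 : Real.exp (e / 2) = (Real.exp (-e / 2))⁻¹ := eq_inv_of_mul_eq_one_left h4
  rw [spread_eq, Real.cosh_eq, show -(e / 2) = -e / 2 by ring, h3, h5]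
  field_simp
  ring

/-- The overlap of the laws of the likelihoods of the two symbols, up to a factor. -/
def overlap (v : ℝ) : ℝ := ∫ e, Real.exp (-v * e ^ 2 / 8) / Real.cosh (e / 2)

/-- By symmetry 1 - θ = E (1 - h), with 1 - h = exp (-e/2)/cosh (e/2). Completing the square moves
the Gaussian to the centre and splits off exp (-1/(2v)), the factor that governs Q(1/√v). -/
lemma one_sub_theta_soft {v : ℝ} (hv : 0 < v) : 1 - theta (softLaw v) =
    Real.sqrt v / Real.sqrt (8 * Real.pi) * Real.exp (-1 / (2 * v)) * overlap v := by
  have hP := softLaw_symLaw hv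
  have := hP.prob
  have i1 : Integrable (fun e => spread e) (softLaw v) := by simpa using hP.integrable_pow 1
  have h1 : 1 - theta (softLaw v) = ∫ e, (1 - spread e) ∂(softLaw v) := by
    rw [integral_sub (integrable_const _) i1, hP.integral_spread]; simp
  have hv' : (4 / v).toNNReal ≠ 0 := by
    rw [Ne, Real.toNNReal_eq_zero, not_le]; positivity
  rw [h1, softLaw, integral_gaussianReal_eq_integral_smul hv', overlap, ← integral_const_mul]
  refine integral_congr_ae (Filter.Eventually.of_forall fun e => ?_)
  simp only [smul_eq_mul]
  rw [one_sub_spread_eq, gaussianPDFReal, Real.coe_toNNReal _ (by positivity)]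
  have h2 : Real.exp (-(e - 2 / v) ^ 2 / (2 * (4 / v))) * Real.exp (-e / 2) =
      Real.exp (-1 / (2 * v)) * Real.exp (-v * e ^ 2 / 8) := by
    rw [← Real.exp_add, ← Real.exp_add]; congr 1; field_simp; ring
  have h3 : (Real.sqrt (2 * Real.pi * (4 / v)))⁻¹ = Real.sqrt v / Real.sqrt (8 * Real.pi) := by
    rw [← Real.sqrt_inv, ← Real.sqrt_div hv.le]
    congr 1; field_simp; norm_num
  rw [h3]
  calc _ = Real.sqrt v / Real.sqrt (8 * Real.pi) * (Real.exp (-(e - 2 / v) ^ 2 / (2 * (4 / v))) *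
        Real.exp (-e / 2)) / Real.cosh (e / 2) := by ring
    _ = _ := by rw [h2]; ring

lemma inv_cosh_le (e : ℝ) : (Real.cosh (e / 2))⁻¹ ≤ 16 * (1 + e ^ 2)⁻¹ := by
  have h1 : 1 + e ^ 2 / 16 ≤ Real.cosh (e / 2) := by
    rw [← Real.cosh_abs, Real.cosh_eq]
    have h2 := Real.quadratic_le_exp_of_nonneg (abs_nonneg (e / 2))
    have h3 := Real.add_one_le_exp (-|e / 2|)
    rw [sq_abs] at h2
    linarith
  rw [← div_eq_mul_inv, inv_le_comm₀ (cosh_half_pos e) (by positivity), inv_div]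
  linarith [sq_nonneg e]

lemma continuous_inv_cosh : Continuous fun e : ℝ => (Real.cosh (e / 2))⁻¹ :=
  (Real.continuous_cosh.comp (continuous_id.div_const 2)).inv₀ fun e => (cosh_half_pos e).ne'

lemma integrable_inv_cosh : Integrable fun e : ℝ => (Real.cosh (e / 2))⁻¹ := by
  refine (integrable_inv_one_add_sq.const_mul 16).mono'
    continuous_inv_cosh.aestronglyMeasurable (Filter.Eventually.of_forall fun e => ?_)
  rw [Real.norm_eq_abs, abs_of_pos (inv_pos.2 (cosh_half_pos e))]
  exact inv_cosh_le e

/-- An antiderivative is 4 arctan (exp (e/2)). This integral is the origin of the constant π for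
weak noise. -/
lemma integral_inv_cosh : ∫ e : ℝ, (Real.cosh (e / 2))⁻¹ = 2 * Real.pi := by
  have hd : ∀ e : ℝ, HasDerivAt (fun e => 4 * Real.arctan (Real.exp (e / 2)))
      (Real.cosh (e / 2))⁻¹ e := by
    intro e
    refine ((((hasDerivAt_id e).div_const 2).exp.arctan).const_mul 4).congr_deriv ?_
    have h1 := Real.exp_pos (e / 2)
    rw [Real.cosh_eq, Real.exp_neg]
    simp only [id]
    field_simp
    ring
  have ht : Filter.Tendsto (fun e : ℝ => 4 * Real.arctan (Real.exp (e / 2))) Filter.atTop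
      (nhds (4 * (Real.pi / 2))) := by
    refine Filter.Tendsto.const_mul 4 ?_
    exact (Real.tendsto_arctan_atTop.mono_right nhdsWithin_le_nhds).comp
      (Real.tendsto_exp_atTop.comp (Filter.tendsto_id.atTop_div_const (by norm_num)))
  have hb : Filter.Tendsto (fun e : ℝ => 4 * Real.arctan (Real.exp (e / 2))) Filter.atBot
      (nhds (4 * 0)) := by
    refine Filter.Tendsto.const_mul 4 ?_
    have := (Real.continuous_arctan.tendsto 0).comp
      (Real.tendsto_exp_atBot.comp (Filter.tendsto_id.atBot_div_const (show (0 : ℝ) < 2 by norm_num)))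
    rwa [Real.arctan_zero] at this
  rw [integral_of_hasDerivAt_of_tendsto hd integrable_inv_cosh hb ht]
  ring

lemma overlap_integrand_le {v : ℝ} (hv : 0 ≤ v) (e : ℝ) :
    Real.exp (-v * e ^ 2 / 8) / Real.cosh (e / 2) ≤ (Real.cosh (e / 2))⁻¹ := by
  rw [div_eq_mul_inv]
  refine mul_le_of_le_one_left (inv_nonneg.2 (cosh_half_pos e).le) (Real.exp_le_one_iff.2 ?_)
  have := mul_nonneg hv (sq_nonneg e)
  linarith

lemma tendsto_overlap :
    Filter.Tendsto overlap (nhdsWithin 0 (Set.Ioi 0)) (nhds (2 * Real.pi)) := by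
  rw [← integral_inv_cosh]
  unfold overlap
  refine tendsto_integral_filter_of_dominated_convergence (fun e => (Real.cosh (e / 2))⁻¹)
    (Filter.Eventually.of_forall fun v => ?_) ?_ integrable_inv_cosh
    (Filter.Eventually.of_forall fun e => ?_)
  · refine (Continuous.div (by fun_prop) (Real.continuous_cosh.comp (continuous_id.div_const 2))
      fun e => (cosh_half_pos e).ne').aestronglyMeasurable
  · filter_upwards [self_mem_nhdsWithin] with v hv
    refine Filter.Eventually.of_forall fun e => ?_
    rw [Real.norm_eq_abs, abs_of_nonneg (div_nonneg (Real.exp_nonneg _) (cosh_half_pos e).le)]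
    exact overlap_integrand_le (le_of_lt hv) e
  · have h : Filter.Tendsto (fun v : ℝ => Real.exp (-v * e ^ 2 / 8) / Real.cosh (e / 2)) (nhds 0)
        (nhds (Real.exp (-0 * e ^ 2 / 8) / Real.cosh (e / 2))) :=
      Continuous.tendsto (by fun_prop) 0
    simp only [neg_zero, zero_mul, zero_div, Real.exp_zero, one_div] at h
    exact h.mono_left nhdsWithin_le_nhds

lemma sqrt_mul_overlap {v : ℝ} (hv : 0 < v) : Real.sqrt v * overlap v =
    ∫ s, Real.exp (-s ^ 2 / 8) / Real.cosh (s / Real.sqrt v / 2) := by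
  have hs := Real.sqrt_pos.2 hv
  have h := Measure.integral_comp_mul_left
    (fun s => Real.exp (-s ^ 2 / 8) / Real.cosh (s / Real.sqrt v / 2)) (Real.sqrt v)
  rw [abs_of_pos (inv_pos.2 hs), smul_eq_mul] at h
  have h2 : overlap v = (Real.sqrt v)⁻¹ *
      ∫ s, Real.exp (-s ^ 2 / 8) / Real.cosh (s / Real.sqrt v / 2) := by
    rw [← h, overlap]
    refine integral_congr_ae (Filter.Eventually.of_forall fun e => ?_)
    simp only
    rw [mul_pow, Real.sq_sqrt hv.le, mul_div_cancel_left₀ _ hs.ne', neg_mul]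
  rw [h2, ← mul_assoc, mul_inv_cancel₀ hs.ne', one_mul]

lemma integrable_exp_div_cosh (c : ℝ) :
    Integrable fun s : ℝ => Real.exp (-s ^ 2 / 8) / Real.cosh (s / c / 2) := by
  have h : Integrable fun s : ℝ => Real.exp (-(1 / 8) * s ^ 2) :=
    integrable_exp_neg_mul_sq (by norm_num)
  refine h.mono' (Continuous.div (by fun_prop)
    (Real.continuous_cosh.comp (by fun_prop)) fun e => (Real.cosh_pos _).ne').aestronglyMeasurable
    (Filter.Eventually.of_forall fun s => ?_)
  rw [Real.norm_eq_abs, abs_of_nonneg (div_nonneg (Real.exp_nonneg _) (Real.cosh_pos _).le)]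
  rw [show -(1 / 8) * s ^ 2 = -s ^ 2 / 8 by ring]
  exact div_le_self (Real.exp_nonneg _) (Real.one_le_cosh _)

/-- After the substitution s = √v e, both √v · `overlap` v and exp (-1/(2v)) visibly increase with
v. -/
lemma theta_soft_antitone {v w : ℝ} (hv : 0 < v) (h : v ≤ w) :
    theta (softLaw w) ≤ theta (softLaw v) := by
  have hw := hv.trans_le h
  have hsv := Real.sqrt_pos.2 hv
  have hsvw := Real.sqrt_le_sqrt h
  have h1 : Real.sqrt v * overlap v ≤ Real.sqrt w * overlap w := by
    rw [sqrt_mul_overlap hv, sqrt_mul_overlap hw]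
    refine integral_mono (integrable_exp_div_cosh _) (integrable_exp_div_cosh _) fun s => ?_
    refine div_le_div_of_nonneg_left (Real.exp_nonneg _) (Real.cosh_pos _) ?_
    rw [Real.cosh_le_cosh, abs_div, abs_div, abs_div (s / Real.sqrt v), abs_div s, abs_of_pos hsv,
      abs_of_pos (hsv.trans_le hsvw)]
    gcongr
  have h2 : Real.exp (-1 / (2 * v)) ≤ Real.exp (-1 / (2 * w)) := by
    refine Real.exp_le_exp.2 ?_
    rw [neg_div, neg_div, neg_le_neg_iff]
    exact one_div_le_one_div_of_le (by positivity) (by linarith)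
  have h3 : 0 ≤ overlap v := integral_nonneg fun e =>
    div_nonneg (Real.exp_nonneg _) (cosh_half_pos e).le
  have h4 : 1 - theta (softLaw v) ≤ 1 - theta (softLaw w) := by
    rw [one_sub_theta_soft hv, one_sub_theta_soft hw]
    calc _ = (Real.sqrt (8 * Real.pi))⁻¹ * (Real.exp (-1 / (2 * v)) *
          (Real.sqrt v * overlap v)) := by ring
      _ ≤ (Real.sqrt (8 * Real.pi))⁻¹ * (Real.exp (-1 / (2 * w)) *
          (Real.sqrt w * overlap w)) := by
          refine mul_le_mul_of_nonneg_left (mul_le_mul h2 h1 (by positivity) (Real.exp_nonneg _))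
            (by positivity)
      _ = _ := by ring
  linarith

/-- The prefactor in `one_sub_theta_soft` is half of φ(x)/x at x = 1/√v, hence asymptotic to Q(x)/2,
while the overlap tends to 2π. -/
lemma tendsto_one_sub_theta_div_soft :
    Filter.Tendsto (fun v => (1 - theta (softLaw v)) / transition v)
      (nhdsWithin 0 (Set.Ioi 0)) (nhds Real.pi) := by
  have h := (tendsto_overlap.div_const 2).div (tendsto_Q_div.comp tendsto_one_div_sqrt_zero)
    one_ne_zero
  rw [show 2 * Real.pi / 2 / 1 = Real.pi by ring] at h
  refine h.congr' ?_
  filter_upwards [self_mem_nhdsWithin] with v hv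
  have hv : 0 < v := hv
  have hs := Real.sqrt_pos.2 hv
  have h1 : phi (1 / Real.sqrt v) / (1 / Real.sqrt v) =
      2 * (Real.sqrt v / Real.sqrt (8 * Real.pi) * Real.exp (-1 / (2 * v))) := by
    have h2 : Real.sqrt (8 * Real.pi) = 2 * Real.sqrt (2 * Real.pi) := by
      rw [show 8 * Real.pi = 2 ^ 2 * (2 * Real.pi) by ring, Real.sqrt_mul (by norm_num),
        Real.sqrt_sq (by norm_num)]
    have h3 : -(1 / Real.sqrt v) ^ 2 / 2 = -1 / (2 * v) := by
      rw [div_pow, Real.sq_sqrt hv.le]; field_simp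
    have := sqrt_two_pi_pos
    rw [phi, h2, h3]
    field_simp
  have hQ := transition_pos v
  simp only [Pi.div_apply, Function.comp]
  rw [one_sub_theta_soft hv, h1]
  have h8 : 0 < Real.sqrt (8 * Real.pi) := Real.sqrt_pos.2 (by positivity)
  have he := Real.exp_pos (-1 / (2 * v))
  unfold transition at *
  field_simp

/-! ### Sustainable noise powers -/

/-- The sets `S m` of noise powers are those for which recursive decoding of the codes of orders
`r m` has bit error probability at most `α`, where `P v` is the law of the likelihood of the symbol
`0` for the noise power `v`. -/
structure IsReception (α : ℝ) (r : ℕ → ℕ) (P : ℝ → Measure ℝ) (S : ℕ → Set ℝ) : Prop where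
  symLaw : ∀ v, 0 < v → SymLaw (P v)
  mem : ∀ m v, 0 < v → bad m (r m) (P v) ≤ α → v ∈ S m
  notMem : ∀ m v (s : Finset (Fin m)), s.card ≤ r m →
    (0 < v → corr m (r m) (P v) s < 1 - α) → v ∉ S m

lemma isReception_soft (α : ℝ) (r : ℕ → ℕ) :
    IsReception α r softLaw fun m => softPowers α m (r m) :=
  ⟨fun _ hv => softLaw_symLaw hv, fun _ _ hv h => mem_softPowers_of_bad_le hv h,
    fun _ _ s hs h => notMem_softPowers_of_corr_le s hs h⟩

lemma isReception_hard (α : ℝ) (r : ℕ → ℕ) :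
    IsReception α r (fun v => hardLaw (transition v)) fun m => hardPowers α m (r m) :=
  ⟨fun _ hv => hardLaw_transition_symLaw hv, fun _ _ hv h => mem_hardPowers_of_bad_le hv h,
    fun _ _ s hs h => notMem_hardPowers_of_corr_lt s hs h⟩

/-- One sustainable noise power and the failure of all powers from b on pin down the supremum; the
set need not be an interval, so no monotonicity of the error probability is required. -/
lemma csSup_bounds {S : Set ℝ} {a b : ℝ} (ha : a ∈ S) (hb : ∀ v, b ≤ v → v ∉ S) :
    (S.Nonempty ∧ BddAbove S) ∧ a ≤ sSup S ∧ sSup S ≤ b := by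
  have h : ∀ v ∈ S, v ≤ b := fun v hv => by
    by_contra hlt
    exact hb v (not_le.1 hlt).le hv
  exact ⟨⟨⟨a, ha⟩, ⟨b, h⟩⟩, le_csSup ⟨b, h⟩ ha, csSup_le ⟨a, ha⟩ h⟩

lemma tendsto_of_forall_eventually {f : ℕ → ℝ} {c : ℝ} (hc : 0 < c)
    (h : ∀ a b, 0 < a → a < c → c < b → ∀ᶠ m in Filter.atTop, a ≤ f m ∧ f m ≤ b) :
    Filter.Tendsto f Filter.atTop (nhds c) := by
  rw [tendsto_order]
  constructor
  · intro a ha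
    obtain ⟨a', ha', hac⟩ := exists_between (max_lt ha hc)
    filter_upwards [h a' (c + 1) ((le_max_right _ _).trans_lt ha') hac (by linarith)] with m hm
    exact ((le_max_left _ _).trans_lt ha').trans_le hm.1
  · intro b hb
    obtain ⟨b', hb', hbb⟩ := exists_between hb
    filter_upwards [h (c / 2) b' (by linarith) (by linarith) hb'] with m hm
    exact hm.2.trans_lt hbb

/-! #### Fixed order -/

/-- The least second moment of the spreads that the code of order `k + 1` and length `2 ^ (n + k)`
tolerates, to first order. -/
def threshold (k n : ℕ) : ℝ := (2 * (n * Real.log 2) / 2 ^ n) ^ (((2 ^ k : ℕ) : ℝ)⁻¹)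

lemma threshold_pow (k n : ℕ) : threshold k n ^ 2 ^ k = 2 * (n * Real.log 2) / 2 ^ n :=
  Real.rpow_inv_natCast_pow (by have := Real.log_nonneg one_le_two; positivity) (by positivity)

lemma threshold_pos (k : ℕ) {n : ℕ} (hn : 1 ≤ n) : 0 < threshold k n := by
  have := Real.log_pos one_lt_two
  have : (0 : ℝ) < n := Nat.cast_pos.2 hn
  exact Real.rpow_pos_of_pos (by positivity) _

lemma tendsto_threshold (k : ℕ) : Filter.Tendsto (threshold k) Filter.atTop (nhds 0) := by
  have h1 := (tendsto_pow_const_div_const_pow_of_one_lt 1 one_lt_two).const_mul (2 * Real.log 2)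
  rw [mul_zero] at h1
  have hpos : (0 : ℝ) < ((2 ^ k : ℕ) : ℝ)⁻¹ := by positivity
  have h2 := h1.rpow_const (p := ((2 ^ k : ℕ) : ℝ)⁻¹) (Or.inr hpos.le)
  rw [Real.zero_rpow hpos.ne'] at h2
  refine h2.congr fun n => ?_
  unfold threshold
  congr 1
  ring

/-- A κ that is small against θ costs only part of the margin, whatever the power N. -/
lemma pow_div_two_add_le {θ κ t ε : ℝ} {N : ℕ} (hN : N ≠ 0) (hθ0 : 0 ≤ θ) (hκ0 : 0 ≤ κ)
    (hε : 0 < ε) (hε1 : ε ≤ 1) (ht : 0 ≤ t) (hθ : θ ≤ (1 - ε) * t) (hκ : κ ≤ ε / 2 * θ) :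
    θ ^ N / 2 + κ ^ N / 3 ≤ (1 - ε / 2) * (t ^ N / 2) := by
  have h1 : κ ^ N ≤ ε / 2 * θ ^ N := by
    refine (pow_le_pow_left₀ hκ0 hκ N).trans ?_
    rw [mul_pow]
    exact mul_le_mul_of_nonneg_right (pow_le_of_le_one (by linarith) (by linarith) hN)
      (pow_nonneg hθ0 N)
  have h2 : θ ^ N ≤ (1 - ε) * t ^ N := by
    refine (pow_le_pow_left₀ hθ0 hθ N).trans ?_
    rw [mul_pow]
    exact mul_le_mul_of_nonneg_right (pow_le_of_le_one (by linarith) (by linarith) hN)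
      (pow_nonneg ht N)
  have h3 : 0 ≤ t ^ N := pow_nonneg ht N
  have h4 := mul_le_mul_of_nonneg_left h2 (show 0 ≤ 1 / 2 + ε / 6 by linarith)
  have h5 : (1 / 2 + ε / 6) * (1 - ε) ≤ (1 - ε / 2) * (1 / 2) := by nlinarith
  have h6 := mul_le_mul_of_nonneg_right h5 h3
  linarith

/-- Since vθ is close to c, noise below c/`threshold` leaves θ above the threshold and noise above
it leaves θ below, each by a constant factor. The power 2^k keeps such factors on their side of 1.
-/
lemma eventually_mem_and_forall_notMem {α : ℝ} {k : ℕ} {P : ℝ → Measure ℝ} {S : ℕ → Set ℝ} {c : ℝ}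
    (hα : 0 < α) (hα1 : α < 1 / 2) (hS : IsReception α (fun _ => k + 1) P S) (hc : 0 < c)
    (hθ : Filter.Tendsto (fun v => v * theta (P v)) Filter.atTop (nhds c))
    (hκ : Filter.Tendsto (fun v => kappa (P v) / theta (P v)) Filter.atTop (nhds 0))
    {a b : ℝ} (ha : 0 < a) (hac : a < c) (hcb : c < b) :
    ∀ᶠ n in Filter.atTop, a / threshold k n ∈ S (n + k) ∧
      ∀ v, b / threshold k n ≤ v → v ∉ S (n + k) := by
  have hb : 0 < b := hc.trans hcb
  have hinv : ∀ x : ℝ, 0 < x →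
      Filter.Tendsto (fun n => x / threshold k n) Filter.atTop Filter.atTop := fun x hx => by
    have h1 : Filter.Tendsto (threshold k) Filter.atTop (nhdsWithin 0 (Set.Ioi 0)) :=
      tendsto_nhdsWithin_iff.2 ⟨tendsto_threshold k, by
        filter_upwards [Filter.eventually_ge_atTop 1] with n hn using threshold_pos k hn⟩
    simp only [div_eq_mul_inv]
    exact (tendsto_inv_nhdsGT_zero.comp h1).const_mul_atTop hx
  have hpow : ∀ n : ℕ, (2 : ℝ) ^ n * threshold k n ^ 2 ^ k = 2 * (n * Real.log 2) := fun n => by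
    rw [threshold_pow]; field_simp
  have hgood : ∀ᶠ n in Filter.atTop, a / threshold k n ∈ S (n + k) := by
    obtain ⟨a', haa, hac'⟩ := exists_between hac
    set ε := min 1 (a' / a - 1) with hε
    have hε0 : 0 < ε := lt_min one_pos (by rw [sub_pos, lt_div_iff₀ ha]; linarith)
    have hεa : (1 + ε) * a ≤ a' := by
      have : ε ≤ a' / a - 1 := min_le_right _ _
      rw [← le_div_iff₀ ha]; linarith
    have h1 := (hθ.comp (hinv a ha)).eventually_const_le hac'
    have h2 := (Filter.tendsto_add_atTop_nat k).eventually
      (eventually_bad_le_fixed (r := k + 1) (by omega) hε0 (min_le_left _ _) hα)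
    filter_upwards [h1, h2, Filter.eventually_ge_atTop 1] with n hn1 hn2 hn
    have ht := threshold_pos k hn
    have hv : 0 < a / threshold k n := by positivity
    refine hS.mem _ _ hv (hn2 _ (hS.symLaw _ hv) ?_)
    rw [show n + k - (k + 1) + 1 = n by omega, Nat.add_sub_cancel]
    simp only [Function.comp] at hn1
    have h3 : (1 + ε) * threshold k n ≤ theta (P (a / threshold k n)) := by
      rw [div_mul_eq_mul_div, le_div_iff₀ ht] at hn1
      have := mul_le_mul_of_nonneg_right hεa ht.le
      exact le_of_mul_le_mul_left (by linarith) ha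
    have h4 : (1 + ε) * threshold k n ^ 2 ^ k ≤ theta (P (a / threshold k n)) ^ 2 ^ k := by
      refine le_trans ?_ (pow_le_pow_left₀ (by positivity) h3 _)
      rw [mul_pow]
      exact mul_le_mul_of_nonneg_right (le_self_pow₀ (by linarith) (by positivity)) (by positivity)
    calc _ = (1 + ε) * (2 ^ n * threshold k n ^ 2 ^ k) := by rw [hpow]; ring
      _ = 2 ^ n * ((1 + ε) * threshold k n ^ 2 ^ k) := by ring
      _ ≤ _ := mul_le_mul_of_nonneg_left h4 (by positivity)
  have hbad : ∀ᶠ n in Filter.atTop, ∀ v, b / threshold k n ≤ v → v ∉ S (n + k) := by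
    obtain ⟨b', hcb', hbb⟩ := exists_between hcb
    set ε := 1 - b' / b with hε
    have hb' : 0 < b' := hc.trans hcb'
    have hε0 : 0 < ε := by rw [hε, sub_pos, div_lt_one hb]; exact hbb
    have hε1 : ε ≤ 1 := by rw [hε]; linarith [div_pos hb' hb]
    have h1 := hθ.eventually_le_const hcb'
    have h2 := hκ.eventually_le_const (show 0 < ε / 2 by positivity)
    have h2' := hθ.eventually_const_lt hc
    -- The estimates hold for all v ≥ V, hence for every noise power from b/`threshold` on at once.
    obtain ⟨V, hV⟩ := Filter.eventually_atTop.1 ((h1.and h2).and h2')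
    -- Here α < 1/2 enters: β is taken between 1/2 and 1 - α.
    have h3 := eventually_corr_le (ε := ε / 2) (β := (1 / 2 + (1 - α)) / 2) (by positivity)
      (by linarith) (by linarith)
    filter_upwards [h3, (hinv b hb).eventually_ge_atTop V, Filter.eventually_ge_atTop 1]
      with n hn hnV hn1 v hv
    have ht := threshold_pos k hn1
    refine hS.notMem _ v (firstBit k (n + k)) ((card_firstBit_le k _).trans (by omega)) fun hv0 => ?_
    obtain ⟨⟨hv1, hv2⟩, hv3⟩ := hV v (hnV.trans hv)
    have hP := hS.symLaw v hv0
    have hθpos : 0 < theta (P v) := pos_of_mul_pos_right hv3 hv0.le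
    have h4 : theta (P v) ≤ (1 - ε) * threshold k n := by
      rw [div_le_iff₀ ht] at hv
      rw [hε, sub_sub_cancel, div_mul_eq_mul_div, le_div_iff₀ hb]
      have h5 := mul_le_mul_of_nonneg_left hv hθpos.le
      have h6 := mul_le_mul_of_nonneg_right hv1 ht.le
      linarith
    have h5 : kappa (P v) ≤ ε / 2 * theta (P v) := by rwa [div_le_iff₀ hθpos] at hv2
    have h6 := pow_div_two_add_le (N := 2 ^ k) (by positivity) hθpos.le hP.kappa_nonneg hε0 hε1 ht.le
      h4 h5
    have h7 := hn k (P v) hP ?_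
    · linarith
    · refine (mul_le_mul_of_nonneg_left h6 (by positivity : (0 : ℝ) ≤ 2 ^ n)).trans (le_of_eq ?_)
      calc _ = (1 - ε / 2) * ((2 ^ n * threshold k n ^ 2 ^ k) / 2) := by ring
        _ = _ := by rw [hpow]; ring
  filter_upwards [hgood, hbad] with n h1 h2 using ⟨h1, h2⟩

/-- The sustainable noise powers of the codes of a fixed order. -/
theorem fixed_order_asymptotics {α : ℝ} {k : ℕ} {P : ℝ → Measure ℝ} {S : ℕ → Set ℝ} {c : ℝ}
    (hα : 0 < α) (hα1 : α < 1 / 2) (hS : IsReception α (fun _ => k + 1) P S) (hc : 0 < c)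
    (hθ : Filter.Tendsto (fun v => v * theta (P v)) Filter.atTop (nhds c))
    (hκ : Filter.Tendsto (fun v => kappa (P v) / theta (P v)) Filter.atTop (nhds 0)) :
    (∀ᶠ n in Filter.atTop, (S (n + k)).Nonempty ∧ BddAbove (S (n + k))) ∧
      Filter.Tendsto (fun n => sSup (S (n + k)) * threshold k n) Filter.atTop (nhds c) := by
  constructor
  · filter_upwards [eventually_mem_and_forall_notMem hα hα1 hS hc hθ hκ (show 0 < c / 2 by linarith)
      (by linarith) (show c < c + 1 by linarith)] with n hn
    exact (csSup_bounds hn.1 hn.2).1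
  · refine tendsto_of_forall_eventually hc fun a b ha hac hcb => ?_
    filter_upwards [eventually_mem_and_forall_notMem hα hα1 hS hc hθ hκ ha hac hcb,
      Filter.eventually_ge_atTop 1] with n hn hn1
    have ht := threshold_pos k hn1
    obtain ⟨-, h1, h2⟩ := csSup_bounds hn.1 hn.2
    rw [div_le_iff₀ ht] at h1
    rw [le_div_iff₀ ht] at h2
    exact ⟨h1, h2⟩

/-! #### Fixed rate -/

/-- The variance of the symmetric binomial law, from the Bernstein polynomials at 1/2. Chebyshev's
inequality then confines the orders of codes of rate away from 0 and 1 to within m/100 of m/2. -/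
lemma sum_choose_mul_sq (m : ℕ) :
    ∑ i ∈ Finset.range (m + 1), ((i : ℝ) - m / 2) ^ 2 * (m.choose i : ℝ) =
      (2 : ℝ) ^ m * ((m : ℝ) / 4) := by
  have h := congrArg (Polynomial.eval (1 / 2 : ℝ)) (bernsteinPolynomial.variance ℝ m)
  simp only [Polynomial.eval_finsetSum, Polynomial.eval_mul, Polynomial.eval_pow,
    Polynomial.eval_sub, bernsteinPolynomial, Polynomial.eval_natCast, nsmul_eq_mul,
    Polynomial.eval_X, Polynomial.eval_one] at h
  have h2 : (2 : ℝ) ^ m * (1 / 2) ^ m = 1 := by rw [← mul_pow]; norm_num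
  calc _ = 2 ^ m * ∑ i ∈ Finset.range (m + 1), ((m : ℝ) * (1 / 2) - i) ^ 2 *
        (m.choose i * (1 / 2) ^ i * (1 - 1 / 2) ^ (m - i)) := by
        rw [Finset.mul_sum]
        refine Finset.sum_congr rfl fun i hi => ?_
        have h3 : (1 / 2 : ℝ) ^ i * (1 - 1 / 2) ^ (m - i) = (1 / 2) ^ m := by
          rw [show (1 : ℝ) - 1 / 2 = 1 / 2 by norm_num, ← pow_add]
          congr 1
          have := Finset.mem_range.1 hi
          omega
        calc ((i : ℝ) - m / 2) ^ 2 * (m.choose i : ℝ) =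
              ((i : ℝ) - m / 2) ^ 2 * (m.choose i : ℝ) * (2 ^ m * (1 / 2) ^ m) := by rw [h2, mul_one]
          _ = _ := by rw [← h3]; ring
    _ = _ := by rw [h]; ring

lemma sum_choose_le {m : ℕ} (hm : 1 ≤ m) {A : Finset ℕ} (hA : A ⊆ Finset.range (m + 1))
    (h : ∀ i ∈ A, (m : ℝ) / 100 ≤ |(i : ℝ) - m / 2|) :
    (∑ i ∈ A, (m.choose i : ℝ)) / 2 ^ m ≤ 2500 / m := by
  have hm0 : (0 : ℝ) < m := Nat.cast_pos.2 hm
  have h1 : (∑ i ∈ A, (m.choose i : ℝ)) * (m / 100) ^ 2 ≤ 2 ^ m * (m / 4) := by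
    rw [← sum_choose_mul_sq, Finset.sum_mul]
    refine (Finset.sum_le_sum fun i hi => ?_).trans
      (Finset.sum_le_sum_of_subset_of_nonneg hA fun i _ _ => by positivity)
    rw [mul_comm, ← sq_abs ((i : ℝ) - m / 2)]
    exact mul_le_mul_of_nonneg_right (pow_le_pow_left₀ (by positivity) (h i hi) 2)
      (Nat.cast_nonneg _)
  rw [div_le_div_iff₀ (by positivity) hm0]
  refine le_of_mul_le_mul_right ?_ hm0
  linarith

lemma sum_choose_real (m : ℕ) :
    ∑ i ∈ Finset.range (m + 1), (m.choose i : ℝ) = 2 ^ m := by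
  exact_mod_cast Nat.sum_range_choose m

lemma rate_le {m r : ℕ} (hm : 1 ≤ m) (h : (r : ℝ) ≤ m / 2 - m / 100) : rate m r ≤ 2500 / m := by
  have hm0 : (0 : ℝ) < m := Nat.cast_pos.2 hm
  have hr : r ≤ m := by
    have : (r : ℝ) ≤ m := by linarith
    exact_mod_cast this
  refine sum_choose_le hm (Finset.range_mono (by omega)) fun i hi => ?_
  have h1 : (i : ℝ) ≤ r := by exact_mod_cast Nat.lt_succ_iff.1 (Finset.mem_range.1 hi)
  rw [abs_of_nonpos (by linarith)]
  linarith

lemma one_sub_rate_le {m r : ℕ} (hm : 1 ≤ m) (h : (m : ℝ) / 2 + m / 100 ≤ r) :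
    1 - rate m r ≤ 2500 / m := by
  have hm0 : (0 : ℝ) < m := Nat.cast_pos.2 hm
  have h0 : (0 : ℝ) < 2 ^ m := by positivity
  have h1 := sum_choose_le hm (A := Finset.range (m + 1) \ Finset.range (r + 1))
    Finset.sdiff_subset fun i hi => by
      rw [Finset.mem_sdiff, Finset.mem_range, Finset.mem_range] at hi
      have h1 : (r : ℝ) ≤ i := by exact_mod_cast (by omega : r ≤ i)
      rw [abs_of_nonneg (by linarith)]
      linarith
  refine le_trans ?_ h1
  rw [rate, sub_le_iff_le_add, ← add_div, le_div_iff₀ h0, one_mul, ← sum_choose_real]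
  have h2 := Finset.sum_sdiff (f := fun i => (m.choose i : ℝ))
    (Finset.inter_subset_left (s₁ := Finset.range (m + 1)) (s₂ := Finset.range (r + 1)))
  rw [Finset.sdiff_inter_self_left] at h2
  rw [← h2]
  refine add_le_add le_rfl ?_
  exact Finset.sum_le_sum_of_subset_of_nonneg Finset.inter_subset_right
    fun i _ _ => Nat.cast_nonneg _

/-- The orders of codes of a fixed rate are close to half the number of variables. -/
lemma eventually_abs_sub_le {R : ℝ} {r : ℕ → ℕ} (hR : 0 < R) (hR1 : R < 1)
    (h : Filter.Tendsto (fun m => rate m (r m)) Filter.atTop (nhds R)) :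
    ∀ᶠ m : ℕ in Filter.atTop, |(r m : ℝ) - m / 2| ≤ m / 100 := by
  have h1 : Filter.Tendsto (fun m : ℕ => (2500 : ℝ) / m) Filter.atTop (nhds 0) :=
    tendsto_const_div_atTop_nhds_zero_nat _
  have h2 := h.const_sub 1
  filter_upwards [h.eventually_const_lt (show R / 2 < R by linarith),
    h2.eventually_const_lt (show (1 - R) / 2 < 1 - R by linarith),
    h1.eventually_lt_const (show 0 < R / 2 by linarith),
    h1.eventually_lt_const (show 0 < (1 - R) / 2 by linarith),
    Filter.eventually_ge_atTop 1] with m hm1 hm2 hm3 hm4 hm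
  rw [abs_le]
  constructor
  · by_contra hcon
    have := rate_le hm (r := r m) (by linarith)
    linarith
  · by_contra hcon
    have := one_sub_rate_le hm (r := r m) (by linarith)
    linarith

/-- The complement of the second moment of the spreads that the code of order `r` and length
`2 ^ m` tolerates, to first order. -/
def slack (m r : ℕ) : ℝ := (m - r + 1 : ℕ) * Real.log 2 / 2 ^ (r - 1)

lemma exp_neg_mul_slack (m r : ℕ) (x : ℝ) : Real.exp (-(x * slack m r)) ^ 2 ^ (r - 1) =
    Real.exp (-(x * ((m - r + 1 : ℕ) * Real.log 2))) := by
  rw [← Real.exp_nat_mul]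
  congr 1
  unfold slack
  push_cast
  field_simp

lemma slack_pos (m r : ℕ) : 0 < slack m r := by
  have := Real.log_pos one_lt_two
  unfold slack; positivity

lemma tendsto_slack {r : ℕ → ℕ} (h : ∀ᶠ m : ℕ in Filter.atTop, |(r m : ℝ) - m / 2| ≤ m / 100) :
    Filter.Tendsto (fun m => slack m (r m)) Filter.atTop (nhds 0) := by
  have hq : Filter.Tendsto (fun m : ℕ => m / 4) Filter.atTop Filter.atTop :=
    Nat.tendsto_div_const_atTop (by norm_num)
  have h1 := ((tendsto_pow_const_div_const_pow_of_one_lt 1 one_lt_two).const_mul (8 : ℝ)).comp hq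
  rw [mul_zero] at h1
  refine squeeze_zero' (Filter.Eventually.of_forall fun m => (slack_pos m (r m)).le) ?_ h1
  filter_upwards [h, Filter.eventually_ge_atTop 8] with m hm hm8
  have hm8' : (8 : ℝ) ≤ m := by exact_mod_cast hm8
  obtain ⟨h2, h3⟩ := abs_le.1 hm
  have h4 : m / 4 ≤ r m - 1 := by
    have h5 : (m : ℝ) / 4 + 1 ≤ r m := by linarith
    have h6 : ((m / 4 : ℕ) : ℝ) ≤ m / 4 := Nat.cast_div_le
    have h7 : ((m / 4 + 1 : ℕ) : ℝ) ≤ r m := by push_cast; linarith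
    have h8 : m / 4 + 1 ≤ r m := by exact_mod_cast h7
    omega
  have h9 : m - r m + 1 ≤ 8 * (m / 4) := by omega
  simp only [Function.comp, pow_one]
  rw [slack, ← mul_div_assoc]
  have h10 : ((m - r m + 1 : ℕ) : ℝ) * Real.log 2 ≤ 8 * (m / 4 : ℕ) := by
    have h11 : ((m - r m + 1 : ℕ) : ℝ) ≤ 8 * (m / 4 : ℕ) := by exact_mod_cast h9
    have h12 : Real.log 2 ≤ 1 := by linarith [Real.log_two_lt_d9]
    have h13 : (0 : ℝ) ≤ ((m - r m + 1 : ℕ) : ℝ) := Nat.cast_nonneg _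
    nlinarith
  exact div_le_div₀ (by positivity) h10 (by positivity) (pow_le_pow_right₀ one_le_two h4)

/-- The quadratic remainder of exp is at most δB, which turns the margin 2δ in q into the margin δ
in the exponent. -/
lemma exp_neg_le_of_le {δ B q : ℝ} (hδ1 : δ ≤ 1 / 4) (hB : 0 ≤ B) (hBδ : B ≤ δ)
    (hq : q ≤ (1 - 2 * δ) * B) : Real.exp (-((1 - δ) * B)) ≤ 1 - q := by
  have hx : |-((1 - δ) * B)| ≤ 1 := by
    rw [abs_neg, abs_of_nonneg (mul_nonneg (by linarith) hB)]
    nlinarith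
  have h1 := (abs_le.1 (Real.abs_exp_sub_one_sub_id_le hx)).2
  have h2 : (-((1 - δ) * B)) ^ 2 ≤ δ * B := by
    have h3 : (1 - δ) ^ 2 ≤ 1 := by nlinarith
    have h4 : B ^ 2 ≤ δ * B := by nlinarith
    have h5 := mul_le_mul_of_nonneg_right h3 (sq_nonneg B)
    nlinarith
  linarith

/-- At critical noise θ^(2^(r-1)) is 2^(-n) up to factors of lower order, so 1 - θ ≈ `slack`;
dividing by c, the limit of (1 - θ)/p, gives p ≈ `slack`/c. -/
lemma eventually_transition_bounds {α : ℝ} {r : ℕ → ℕ} {P : ℝ → Measure ℝ} {S : ℕ → Set ℝ} {c : ℝ}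
    (hα : 0 < α) (hα1 : α < 1 / 2) (hS : IsReception α r P S) (hc : 0 < c)
    (hr : ∀ᶠ m : ℕ in Filter.atTop, |(r m : ℝ) - m / 2| ≤ m / 100)
    (hθ : ∀ v w, 0 < v → v ≤ w → theta (P w) ≤ theta (P v))
    (hlim : Filter.Tendsto (fun v => (1 - theta (P v)) / transition v) (nhdsWithin 0 (Set.Ioi 0))
      (nhds c)) {a b : ℝ} (ha : 0 < a) (hac : a < 1 / c) (hcb : 1 / c < b) :
    ∀ᶠ m in Filter.atTop, (∃ v, 0 < v ∧ transition v = a * slack m (r m) ∧ v ∈ S m) ∧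
      ∃ v, 0 < v ∧ transition v = b * slack m (r m) ∧ ∀ w, v ≤ w → w ∉ S m := by
  have hb : 0 < b := (one_div_pos.2 hc).trans hcb
  have hB := tendsto_slack hr
  -- Since the slack tends to 0, the noise power with this transition probability falls in any
  -- interval (0, V) on which the limit relation is already accurate.
  have hsmall : ∀ x : ℝ, 0 < x → ∀ V : ℝ, ∀ᶠ m in Filter.atTop, 0 < V →
      ∃ v, 0 < v ∧ v < V ∧ transition v = x * slack m (r m) := by
    intro x hx V
    have h1 : Filter.Tendsto (fun m => x * slack m (r m)) Filter.atTop (nhds 0) := by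
      simpa using hB.const_mul x
    filter_upwards [h1.eventually_lt_const (show (0 : ℝ) < 1 / 2 by norm_num),
      h1.eventually_lt_const (transition_pos V)] with m hm1 hm2 hV
    obtain ⟨v, hv, hv1⟩ := exists_transition_eq (mul_pos hx (slack_pos m (r m))) hm1
    refine ⟨v, hv, ?_, hv1⟩
    by_contra hcon
    linarith [transition_le hV (not_lt.1 hcon)]
  have hgood : ∀ᶠ m in Filter.atTop,
      ∃ v, 0 < v ∧ transition v = a * slack m (r m) ∧ v ∈ S m := by
    obtain ⟨c', hcc, hca⟩ := exists_between (show c < 1 / a by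
      rw [lt_div_iff₀ ha]; rwa [lt_div_iff₀ hc, mul_comm] at hac)
    rw [lt_div_iff₀ ha] at hca
    set δ := min (1 / 4) ((1 - c' * a) / 2) with hδ
    have hδ0 : 0 < δ := lt_min (by norm_num) (by linarith)
    have hδ1 : δ ≤ 1 / 4 := min_le_left _ _
    have hδ2 : c' * a ≤ 1 - 2 * δ := by
      have : δ ≤ (1 - c' * a) / 2 := min_le_right _ _
      linarith
    have h1 := hlim.eventually_le_const hcc
    obtain ⟨V, hV, hV1⟩ := mem_nhdsGT_iff_exists_Ioo_subset.1 h1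
    filter_upwards [hr, eventually_bad_le_rate hδ0 hδ1 hα, hsmall a ha V,
      hB.eventually_le_const hδ0] with m hm1 hm2 hm3 hm4
    obtain ⟨v, hv, hvV, hvt⟩ := hm3 hV
    have h2 : (1 - theta (P v)) / transition v ≤ c' := hV1 ⟨hv, hvV⟩
    rw [div_le_iff₀ (transition_pos v), hvt] at h2
    have hs := slack_pos m (r m)
    have h3 := exp_neg_le_of_le (q := 1 - theta (P v)) hδ1 hs.le hm4 (h2.trans (by
      rw [← mul_assoc]; exact mul_le_mul_of_nonneg_right hδ2 hs.le))
    rw [sub_sub_cancel] at h3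
    refine ⟨v, hv, hvt, hS.mem _ _ hv (hm2 _ hm1 _ (hS.symLaw v hv) ?_)⟩
    rw [← exp_neg_mul_slack]
    exact pow_le_pow_left₀ (Real.exp_nonneg _) h3 _
  have hbad : ∀ᶠ m in Filter.atTop,
      ∃ v, 0 < v ∧ transition v = b * slack m (r m) ∧ ∀ w, v ≤ w → w ∉ S m := by
    obtain ⟨c', hbc, hcc⟩ := exists_between (show 1 / b < c by
      rw [div_lt_iff₀ hb]; rwa [div_lt_iff₀ hc, mul_comm] at hcb)
    rw [div_lt_iff₀ hb] at hbc
    have h1 := hlim.eventually_const_le hcc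
    obtain ⟨V, hV, hV1⟩ := mem_nhdsGT_iff_exists_Ioo_subset.1 h1
    -- A crude ε suffices: 2^n θ^(2^k) ≤ 1 will hold at this noise, while the rate n log 2 grows
    -- without bound.
    have h3 := eventually_corr_le (ε := 1 / 2) (β := (1 / 2 + (1 - α)) / 2) (by norm_num)
      (by norm_num) (by linarith)
    obtain ⟨n₀, hn₀⟩ := Filter.eventually_atTop.1 h3
    filter_upwards [hr, hsmall b hb V, Filter.eventually_ge_atTop (4 * n₀ + 16)] with m hm1 hm2 hm3
    obtain ⟨v, hv, hvV, hvt⟩ := hm2 hV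
    refine ⟨v, hv, hvt, fun w hw => ?_⟩
    have h2 : c' ≤ (1 - theta (P v)) / transition v := hV1 ⟨hv, hvV⟩
    have hs := slack_pos m (r m)
    rw [le_div_iff₀ (transition_pos v), hvt] at h2
    have h4 : slack m (r m) ≤ 1 - theta (P v) := by
      refine le_trans ?_ h2
      rw [← mul_assoc]
      exact le_mul_of_one_le_left hs.le hbc.le
    have hw0 := hv.trans_le hw
    have hP := hS.symLaw w hw0
    -- The limit relation is used at v only. Larger noise powers w may lie outside its range and are
    -- reached by the monotonicity of θ.
    have h5 : theta (P w) ≤ Real.exp (-(1 * slack m (r m))) := by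
      have := Real.add_one_le_exp (-(1 * slack m (r m)))
      have := hθ v w hv hw
      linarith
    have h6 := pow_le_pow_left₀ hP.theta_nonneg h5 (2 ^ (r m - 1))
    rw [exp_neg_mul_slack, one_mul] at h6
    have h7 := pow_le_pow_left₀ hP.kappa_nonneg hP.kappa_le_theta (2 ^ (r m - 1))
    have hm3' : (4 * n₀ + 16 : ℝ) ≤ m := by exact_mod_cast hm3
    have hn0 : (0 : ℝ) ≤ n₀ := Nat.cast_nonneg _
    obtain ⟨h8, h9⟩ := abs_le.1 hm1
    have hr1 : 1 ≤ r m := by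
      have : (1 : ℝ) ≤ r m := by linarith
      exact_mod_cast this
    have hrm : r m + n₀ + 3 ≤ m := by
      have : (r m : ℝ) + n₀ + 3 ≤ m := by linarith
      exact_mod_cast this
    obtain ⟨k, hk⟩ : ∃ k, r m = k + 1 := ⟨r m - 1, by omega⟩
    obtain ⟨n, hn⟩ : ∃ n, m = n + k := ⟨m - k, by omega⟩
    have hnn : n₀ ≤ n ∧ 4 ≤ n := by omega
    subst hn
    refine hS.notMem _ w (firstBit k (n + k)) ((card_firstBit_le k _).trans (by omega)) fun _ => ?_
    rw [hk] at h6 h7 ⊢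
    rw [show n + k - (k + 1) + 1 = n by omega, Nat.add_sub_cancel] at h6
    rw [Nat.add_sub_cancel] at h7
    have h10 := hn₀ n hnn.1 k (P w) hP ?_
    · linarith
    · have h11 : (2 : ℝ) ^ n * Real.exp (-(n * Real.log 2)) = 1 := by
        rw [Real.exp_neg, mul_comm (n : ℝ), Real.exp_mul, Real.exp_log (by norm_num),
          Real.rpow_natCast, mul_inv_cancel₀ (by positivity)]
      have h12 := mul_le_mul_of_nonneg_left h6 (show (0 : ℝ) ≤ 2 ^ n by positivity)
      have h13 := mul_le_mul_of_nonneg_left h7 (show (0 : ℝ) ≤ 2 ^ n by positivity)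
      rw [h11] at h12
      have h14 : (4 : ℝ) * 0.6 ≤ n * Real.log 2 :=
        mul_le_mul (by exact_mod_cast hnn.2) (by linarith [Real.log_two_gt_d9]) (by norm_num)
          (Nat.cast_nonneg _)
      linarith
  filter_upwards [hgood, hbad] with m h1 h2 using ⟨h1, h2⟩

/-- The sustainable transition error probabilities of codes of a fixed rate. -/
theorem fixed_rate_asymptotics {α : ℝ} {r : ℕ → ℕ} {P : ℝ → Measure ℝ} {S : ℕ → Set ℝ} {c : ℝ}
    (hα : 0 < α) (hα1 : α < 1 / 2) (hS : IsReception α r P S) (hc : 0 < c)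
    (hr : ∀ᶠ m : ℕ in Filter.atTop, |(r m : ℝ) - m / 2| ≤ m / 100)
    (hθ : ∀ v w, 0 < v → v ≤ w → theta (P w) ≤ theta (P v))
    (hlim : Filter.Tendsto (fun v => (1 - theta (P v)) / transition v) (nhdsWithin 0 (Set.Ioi 0))
      (nhds c)) :
    (∀ᶠ m in Filter.atTop, (S m).Nonempty ∧ BddAbove (S m)) ∧
      Filter.Tendsto (fun m => transition (sSup (S m)) / slack m (r m)) Filter.atTop
        (nhds (1 / c)) := by
  have hc' : 0 < 1 / c := one_div_pos.2 hc
  constructor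
  · filter_upwards [eventually_transition_bounds hα hα1 hS hc hr hθ hlim
      (show 0 < 1 / c / 2 by linarith) (by linarith) (show 1 / c < 1 / c + 1 by linarith)]
      with m hm
    obtain ⟨⟨v, -, -, hv⟩, w, -, -, hw⟩ := hm
    exact (csSup_bounds hv hw).1
  · refine tendsto_of_forall_eventually hc' fun a b ha hac hcb => ?_
    filter_upwards [eventually_transition_bounds hα hα1 hS hc hr hθ hlim ha hac hcb] with m hm
    obtain ⟨⟨v, hv0, hvt, hv⟩, w, hw0, hwt, hw⟩ := hm
    obtain ⟨-, h1, h2⟩ := csSup_bounds hv hw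
    have hs := slack_pos m (r m)
    rw [le_div_iff₀ hs, div_le_iff₀ hs, ← hvt, ← hwt]
    exact ⟨transition_le hv0 h1, transition_le (hv0.trans_le h1) h2⟩

lemma eventually_shift {p : ℕ → Prop} (k : ℕ) (h : ∀ᶠ n in Filter.atTop, p (n + k)) :
    ∀ᶠ m in Filter.atTop, p m := by
  obtain ⟨n₀, hn₀⟩ := Filter.eventually_atTop.1 h
  filter_upwards [Filter.eventually_ge_atTop (n₀ + k)] with m hm
  have := hn₀ (m - k) (by omega)
  rwa [Nat.sub_add_cancel (by omega)] at this

lemma sustainable_of_fixed_order {α : ℝ} (hα : 0 < α) (hα1 : α < 1 / 2) (k : ℕ) :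
    (∀ᶠ m : ℕ in Filter.atTop, SustainableAt α m (k + 1)) ∧
      Filter.Tendsto (fun m : ℕ => softNoisePower α m (k + 1) / hardNoisePower α m (k + 1))
        Filter.atTop (nhds (Real.pi / 2)) := by
  obtain ⟨hs, hs'⟩ := fixed_order_asymptotics hα hα1 (isReception_soft α fun _ => k + 1) one_pos
    tendsto_mul_theta_soft tendsto_kappa_div_theta_soft
  obtain ⟨hh, hh'⟩ := fixed_order_asymptotics hα hα1 (isReception_hard α fun _ => k + 1)
    (by positivity) tendsto_mul_theta_hard tendsto_kappa_div_theta_hard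
  refine ⟨eventually_shift k (by filter_upwards [hs, hh] with n h1 h2 using ⟨h1, h2⟩), ?_⟩
  rw [← Filter.tendsto_add_atTop_iff_nat k]
  have h := hs'.div hh' (by positivity)
  rw [one_div_div] at h
  refine h.congr' ?_
  filter_upwards [Filter.eventually_ge_atTop 1] with n hn
  simp only [Pi.div_apply]
  rw [mul_div_mul_right _ _ (threshold_pos k hn).ne']
  rfl

lemma sustainable_of_fixed_rate {α : ℝ} (hα : 0 < α) (hα1 : α < 1 / 2) {R : ℝ} {r : ℕ → ℕ}
    (hR : 0 < R) (hR1 : R < 1)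
    (h : Filter.Tendsto (fun m : ℕ => rate m (r m)) Filter.atTop (nhds R)) :
    (∀ᶠ m : ℕ in Filter.atTop, SustainableAt α m (r m)) ∧
      Filter.Tendsto (fun m : ℕ => softTransition α m (r m) / hardTransition α m (r m))
        Filter.atTop (nhds (4 / Real.pi)) := by
  have hr := eventually_abs_sub_le hR hR1 h
  obtain ⟨hs, hs'⟩ := fixed_rate_asymptotics hα hα1 (isReception_soft α r) Real.pi_pos hr
    (fun _ _ => theta_soft_antitone) tendsto_one_sub_theta_div_soft
  obtain ⟨hh, hh'⟩ := fixed_rate_asymptotics hα hα1 (isReception_hard α r) (by norm_num) hr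
    (fun _ _ => theta_hard_antitone) tendsto_one_sub_theta_div_hard
  refine ⟨by filter_upwards [hs, hh] with n h1 h2 using ⟨h1, h2⟩, ?_⟩
  have h := hs'.div hh' (by norm_num)
  rw [show 1 / Real.pi / (1 / 4) = 4 / Real.pi by ring] at h
  refine h.congr fun m => ?_
  simp only [Pi.div_apply]
  rw [div_div_div_cancel_right₀ (slack_pos m (r m)).ne']
  rfl

end RecursiveRM

end

theorem theorem3 (α : ℝ) (hα₀ : 0 < α) (hα₁ : α < 1 / 2) :
    (∀ r : ℕ, 1 ≤ r →
      (∀ᶠ m : ℕ in Filter.atTop, RecursiveRM.SustainableAt α m r) ∧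
      Filter.Tendsto
        (fun m : ℕ => RecursiveRM.softNoisePower α m r / RecursiveRM.hardNoisePower α m r)
        Filter.atTop (nhds (Real.pi / 2))) ∧
    (∀ (R : ℝ) (r : ℕ → ℕ), 0 < R → R < 1 →
      Filter.Tendsto (fun m : ℕ => RecursiveRM.rate m (r m)) Filter.atTop (nhds R) →
      (∀ᶠ m : ℕ in Filter.atTop, RecursiveRM.SustainableAt α m (r m)) ∧
      Filter.Tendsto
        (fun m : ℕ => RecursiveRM.softTransition α m (r m) / RecursiveRM.hardTransition α m (r m))
        Filter.atTop (nhds (4 / Real.pi))) := by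
  refine ⟨fun r hr => ?_, fun R r hR hR1 h =>
    RecursiveRM.sustainable_of_fixed_rate hα₀ hα₁ hR hR1 h⟩
  obtain ⟨k, rfl⟩ : ∃ k, r = k + 1 := ⟨r - 1, by omega⟩
  exact RecursiveRM.sustainable_of_fixed_order hα₀ hα₁ k
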